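/- A discrete memoryless half-duplex multiple access relay channel has finite alphabets and transition probabilities $p(y_{D1},y_R\mid x_{11},x_{21})$ in the first slot and $p(y_{D2}\mid x_{12},x_{22},x_R)$ in the second: source $i\in\{1,2\}$ sends $x_{i1}$ in slot 1 and $x_{i2}$ in slot 2, the relay receives $y_R$ in slot 1 and sends $x_R$ in slot 2, and the destination receives $y_{D1}$ and $y_{D2}$. A block of $l=n+m$ channel uses consists of a first slot of length $n$ and a second slot of length $m$, with a fixed fraction $\beta=n/l\in[0,1]$. Independent messages $w_i$ are uniform on sets of $\lceil 2^{lR_i}\rceil$ elements, $R_i\ge 0$. Fix pmfs $p(x_{11}),p(x_{21}),p(x_{12}),p(x_{22}),p(x_R)$, a conditional pmf $p(\hat y_R\mid y_R)$ on a finite alphabet, a rate $R_U$ and numbers $0<\epsilon'<\epsilon$. Mutual informations (in bits) and typical sets refer to $$p(x_{11})p(x_{21})\,p(y_{D1},y_R\mid x_{11},x_{21})\,p(\hat y_R\mid y_R)\quad\text{and}\quad p(x_{12})p(x_{22})p(x_R)\,p(y_{D2}\mid x_{12},x_{22},x_R)$$ for the two slots; a sequence is $\epsilon$-typical for a pmf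 $q$ if its empirical distribution $\pi$ satisfies $|\pi(a)-q(a)|\le\epsilon\, q(a)$ for all $a$ (the empty sequence is typical). The generalized quantize-and-forward (GQF) scheme. The codewords $x_{i1}^n(w_i)$, $x_{i2}^m(w_i)$ ($i=1,2$), and, for $u$ in a set $\mathcal U$ of $\lceil 2^{lR_U}\rceil$ indices, $x_R^m(u)$ and $\hat y_R^n(u)$, are drawn independently, with i.i.d. letters of laws $p(x_{i1})$, $p(x_{i2})$, $p(x_R)$ and the marginal $p(\hat y_R)$. Source $i$ sends $x_{i1}^n(w_i)$ and then $x_{i2}^m(w_i)$. After slot 1 the relay picks $u$ uniformly at random among the indices for which $(y_R^n,\hat y_R^n(u))$ is $\epsilon'$-typical (among all indices if there is none) and sends $x_R^m(u)$ in slot 2; no binning is used. The destination outputs the unique pair $(\hat w_1,\hat w_2)$ such that for some $u\in\mathcal U$ both $(x_{11}^n(\hat w_1),x_{21}^n(\hat w_2),y_{D1}^n,\hat y_R^n(u))$ and $(x_{12}^m(\hat w_1),x_{22}^m(\hat w_2),x_R^m(u),y_{D2}^m)$ are $\epsilon$-typical; if there is no such unique pair, an error is declared. The scheme achieves $(R_1,R_2)$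 if for all sufficiently small $\epsilon$ and all $\epsilon'\in(0,\epsilon)$, as $l\to\infty$ along the block lengths for which $n=\beta l$ is an integer, the error probability averaged over the random codebooks tends to $0$, and there are codebooks for which the error probability of the scheme tends to $0$. Theorem. For every such choice of input distributions and quantizer, the GQF scheme achieves every rate pair $(R_1,R_2)$ with $R_1,R_2\ge 0$ such that $$\begin{aligned} R_1&<\beta I(X_{11};Y_{D1},\hat Y_R\mid X_{21})+(1-\beta)I(X_{12};Y_{D2}\mid X_{22},X_R),\\ R_1+R_U&<\beta\,[I(X_{11},\hat Y_R;X_{21},Y_{D1})+I(X_{11};\hat Y_R)]+(1-\beta)I(X_{12},X_R;Y_{D2}\mid X_{22}),\\ R_2&<\beta I(X_{21};Y_{D1},\hat Y_R\mid X_{11})+(1-\beta)I(X_{22};Y_{D2}\mid X_{12},X_R),\\ R_2+R_U&<\beta\,[I(X_{21},\hat Y_R;Y_{D1}\mid X_{11})+I(X_{21};\hat Y_R)]+(1-\beta)I(X_{22},X_R;Y_{D2}\mid X_{12}),\\ R_1+R_2&<\beta I(X_{11},X_{21};Y_{D1},\hat Y_R)+(1-\beta)I(X_{12},X_{22};Y_{D2}\mid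 X_R),\\ R_1+R_2+R_U&<\beta\,[I(X_{11},X_{21},\hat Y_R;Y_{D1})+I(X_{11},X_{21};\hat Y_R)]+(1-\beta)I(X_{12},X_{22},X_R;Y_{D2}), \end{aligned}$$ where $R_U>\beta I(Y_R;\hat Y_R)$. -/

import Mathlib

namespace HalfDuplexMARC

noncomputable section

/-! ### Laws, mutual information and typicality on finite alphabets -/

section Information

variable {Ω A B C : Type*} [Fintype Ω]

open Classical in
/-- The law of the random variable `X` when the outcome has probability mass function `p`. -/
def law (p : Ω → ℝ) (X : Ω → A) (a : A) : ℝ :=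
  ∑ ω, if X ω = a then p ω else 0

/-- Mutual information `I(X; Y)` in bits. A term with `p(x, y) = 0` contributes `0`; where
`p(x, y) > 0` both marginals are positive. -/
def mutualInfo [Fintype A] [Fintype B] (p : Ω → ℝ) (X : Ω → A) (Y : Ω → B) : ℝ :=
  ∑ a, ∑ b, law p (fun ω => (X ω, Y ω)) (a, b) *
    Real.logb 2 (law p (fun ω => (X ω, Y ω)) (a, b) / (law p X a * law p Y b))

/-- Conditional mutual information `I(X; Y | Z)` in bits, i.e. the mean of
`log (p(x, y | z) / (p(x | z) p(y | z)))`, with all conditional probabilities written out. -/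
def condMutualInfo [Fintype A] [Fintype B] [Fintype C]
    (p : Ω → ℝ) (X : Ω → A) (Y : Ω → B) (Z : Ω → C) : ℝ :=
  ∑ a, ∑ b, ∑ c, law p (fun ω => (X ω, Y ω, Z ω)) (a, b, c) *
    Real.logb 2 ((law p (fun ω => (X ω, Y ω, Z ω)) (a, b, c) * law p Z c) /
      (law p (fun ω => (X ω, Z ω)) (a, c) * law p (fun ω => (Y ω, Z ω)) (b, c)))

open Classical in
/-- The sequence `s` is `ε`-strongly (robustly) typical for `q`: its empirical distribution `π`
satisfies `|π a - q a| ≤ ε * q a` for all `a`. The inequality is multiplied by the length `n`, so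
that the empty sequence is typical. -/
def Typical (q : A → ℝ) (ε : ℝ) {n : ℕ} (s : Fin n → A) : Prop :=
  ∀ a, |((Finset.univ.filter fun i => s i = a).card : ℝ) - n * q a| ≤ ε * (n * q a)

end Information

/-! ### The channel and its codes -/

/-- A discrete memoryless half-duplex multiple access relay channel. In the first slot the sources
send `x₁₁, x₂₁`, the destination receives `y_D1` and the relay receives `y_R`; in the second slot
the sources send `x₁₂, x₂₂`, the relay sends `x_R` and the destination receives `y_D2`. -/
structure Channel (X₁₁ X₂₁ X₁₂ X₂₂ XR YD1 YR YD2 : Type*)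
    [Fintype YD1] [Fintype YR] [Fintype YD2] where
  /-- the transition probabilities `p(y_D1, y_R | x₁₁, x₂₁)` -/
  slot1 : X₁₁ → X₂₁ → stdSimplex ℝ (YD1 × YR)
  /-- the transition probabilities `p(y_D2 | x₁₂, x₂₂, x_R)` -/
  slot2 : X₁₂ → X₂₂ → XR → stdSimplex ℝ YD2

/-- A code with message sets `W₁, W₂` for slots of lengths `n` and `m`. The relay is half-duplex:
it sends in the second slot only, at random, depending on what it received in the first slot. The
decoder may declare a failure, `none`. -/
structure Code (X₁₁ X₂₁ X₁₂ X₂₂ XR YD1 YR YD2 : Type*) [Fintype XR]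
    (W₁ W₂ : Type) (n m : ℕ) where
  enc11 : W₁ → Fin n → X₁₁
  enc12 : W₁ → Fin m → X₁₂
  enc21 : W₂ → Fin n → X₂₁
  enc22 : W₂ → Fin m → X₂₂
  relay : (Fin n → YR) → stdSimplex ℝ (Fin m → XR)
  dec : (Fin n → YD1) → (Fin m → YD2) → Option (W₁ × W₂)

/-- The parameters of the random coding: the input distributions
`p(x₁₁) p(x₂₁) p(x₁₂) p(x₂₂) p(x_R)` and the quantizer `p(ŷ_R | y_R)`. -/
structure Inputs (X₁₁ X₂₁ X₁₂ X₂₂ XR YR YQ : Type*) [Fintype X₁₁] [Fintype X₂₁]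
    [Fintype X₁₂] [Fintype X₂₂] [Fintype XR] [Fintype YQ] where
  p11 : stdSimplex ℝ X₁₁
  p21 : stdSimplex ℝ X₂₁
  p12 : stdSimplex ℝ X₁₂
  p22 : stdSimplex ℝ X₂₂
  pR : stdSimplex ℝ XR
  quant : YR → stdSimplex ℝ YQ

/-- A codebook of the generalized quantize-and-forward scheme. The quantization index set `U` is the
same for the quantization codewords `ŷ_R(u)` and for the relay codewords `x_R(u)`: there is no
binning. -/
structure Codebook (X₁₁ X₂₁ X₁₂ X₂₂ XR YQ : Type*) (W₁ W₂ U : Type) (n m : ℕ) where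
  x11 : W₁ → Fin n → X₁₁
  x12 : W₁ → Fin m → X₁₂
  x21 : W₂ → Fin n → X₂₁
  x22 : W₂ → Fin m → X₂₂
  xR : U → Fin m → XR
  yQ : U → Fin n → YQ

/-- The outcomes `(x₁₁, x₂₁, y_D1, y_R, ŷ_R)` of one use of the channel in the first slot. -/
abbrev Outcome1 (X₁₁ X₂₁ YD1 YR YQ : Type*) := X₁₁ × X₂₁ × YD1 × YR × YQ

namespace Outcome1

variable {X₁₁ X₂₁ YD1 YR YQ : Type*}

abbrev x11 (s : Outcome1 X₁₁ X₂₁ YD1 YR YQ) : X₁₁ := s.1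
abbrev x21 (s : Outcome1 X₁₁ X₂₁ YD1 YR YQ) : X₂₁ := s.2.1
abbrev yD1 (s : Outcome1 X₁₁ X₂₁ YD1 YR YQ) : YD1 := s.2.2.1
abbrev yR (s : Outcome1 X₁₁ X₂₁ YD1 YR YQ) : YR := s.2.2.2.1
abbrev yQ (s : Outcome1 X₁₁ X₂₁ YD1 YR YQ) : YQ := s.2.2.2.2

end Outcome1

/-- The outcomes `(x₁₂, x₂₂, x_R, y_D2)` of one use of the channel in the second slot. -/
abbrev Outcome2 (X₁₂ X₂₂ XR YD2 : Type*) := X₁₂ × X₂₂ × XR × YD2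

namespace Outcome2

variable {X₁₂ X₂₂ XR YD2 : Type*}

abbrev x12 (s : Outcome2 X₁₂ X₂₂ XR YD2) : X₁₂ := s.1
abbrev x22 (s : Outcome2 X₁₂ X₂₂ XR YD2) : X₂₂ := s.2.1
abbrev xR (s : Outcome2 X₁₂ X₂₂ XR YD2) : XR := s.2.2.1
abbrev yD2 (s : Outcome2 X₁₂ X₂₂ XR YD2) : YD2 := s.2.2.2

end Outcome2

section Scheme

variable {X₁₁ X₂₁ X₁₂ X₂₂ XR YD1 YR YD2 YQ : Type*}
  [Fintype X₁₁] [Fintype X₂₁] [Fintype X₁₂] [Fintype X₂₂] [Fintype XR]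
  [Fintype YD1] [Fintype YR] [Fintype YD2] [Fintype YQ]
  {W₁ W₂ U : Type} [Fintype U] {n m : ℕ}

open Classical in
/-- The probability that the decoder does not output the pair of messages sent, for independent
uniformly distributed messages. -/
def Code.errorProb [Fintype W₁] [Fintype W₂]
    (c : Code X₁₁ X₂₁ X₁₂ X₂₂ XR YD1 YR YD2 W₁ W₂ n m)
    (ch : Channel X₁₁ X₂₁ X₁₂ X₂₂ XR YD1 YR YD2) : ℝ :=
  (1 / ((Fintype.card W₁ : ℝ) * Fintype.card W₂)) * ∑ w₁, ∑ w₂,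
    ∑ yD1 : Fin n → YD1, ∑ yR : Fin n → YR, ∑ xR : Fin m → XR, ∑ yD2 : Fin m → YD2,
      (∏ i, ch.slot1 (c.enc11 w₁ i) (c.enc21 w₂ i) (yD1 i, yR i)) * c.relay yR xR *
        (∏ j, ch.slot2 (c.enc12 w₁ j) (c.enc22 w₂ j) (xR j) (yD2 j)) *
        (if c.dec yD1 yD2 = some (w₁, w₂) then 0 else 1)

/-- The joint probability mass function of `(X₁₁, X₂₁, Y_D1, Y_R, Ŷ_R)`. -/
def joint1 (ch : Channel X₁₁ X₂₁ X₁₂ X₂₂ XR YD1 YR YD2)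
    (p : Inputs X₁₁ X₂₁ X₁₂ X₂₂ XR YR YQ) : Outcome1 X₁₁ X₂₁ YD1 YR YQ → ℝ :=
  fun s => p.p11 s.x11 * p.p21 s.x21 * ch.slot1 s.x11 s.x21 (s.yD1, s.yR) * p.quant s.yR s.yQ

/-- The joint probability mass function of `(X₁₂, X₂₂, X_R, Y_D2)`. -/
def joint2 (ch : Channel X₁₁ X₂₁ X₁₂ X₂₂ XR YD1 YR YD2)
    (p : Inputs X₁₁ X₂₁ X₁₂ X₂₂ XR YR YQ) : Outcome2 X₁₂ X₂₂ XR YD2 → ℝ :=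
  fun s => p.p12 s.x12 * p.p22 s.x22 * p.pR s.xR * ch.slot2 s.x12 s.x22 s.xR s.yD2

/-- The quantization index `u` is compatible with the relay's observation:
`(y_R, ŷ_R(u))` is jointly `ε`-typical. -/
def RelayTypical (ch : Channel X₁₁ X₂₁ X₁₂ X₂₂ XR YD1 YR YD2)
    (p : Inputs X₁₁ X₂₁ X₁₂ X₂₂ XR YR YQ) (ε : ℝ)
    (c : Codebook X₁₁ X₂₁ X₁₂ X₂₂ XR YQ W₁ W₂ U n m) (yR : Fin n → YR) (u : U) : Prop :=
  Typical (law (joint1 ch p) fun s => (s.yR, s.yQ)) ε fun i => (yR i, c.yQ u i)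

open Classical in
/-- The relay picks an index uniformly at random among the compatible ones, or among all indices if
none is compatible. -/
def relayIndexProb (ch : Channel X₁₁ X₂₁ X₁₂ X₂₂ XR YD1 YR YD2)
    (p : Inputs X₁₁ X₂₁ X₁₂ X₂₂ XR YR YQ) (ε : ℝ)
    (c : Codebook X₁₁ X₂₁ X₁₂ X₂₂ XR YQ W₁ W₂ U n m) (yR : Fin n → YR) (u : U) : ℝ :=
  let T : Finset U := Finset.univ.filter fun v => RelayTypical ch p ε c yR v
  if T.Nonempty then (if u ∈ T then (1 : ℝ) / T.card else 0) else (1 : ℝ) / Fintype.card U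

theorem relayIndexProb_nonneg (ch : Channel X₁₁ X₂₁ X₁₂ X₂₂ XR YD1 YR YD2)
    (p : Inputs X₁₁ X₂₁ X₁₂ X₂₂ XR YR YQ) (ε : ℝ)
    (c : Codebook X₁₁ X₂₁ X₁₂ X₂₂ XR YQ W₁ W₂ U n m) (yR : Fin n → YR) (u : U) :
    0 ≤ relayIndexProb ch p ε c yR u := by
  unfold relayIndexProb
  dsimp only
  split_ifs <;> positivity

theorem sum_relayIndexProb [Nonempty U] (ch : Channel X₁₁ X₂₁ X₁₂ X₂₂ XR YD1 YR YD2)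
    (p : Inputs X₁₁ X₂₁ X₁₂ X₂₂ XR YR YQ) (ε : ℝ)
    (c : Codebook X₁₁ X₂₁ X₁₂ X₂₂ XR YQ W₁ W₂ U n m) (yR : Fin n → YR) :
    ∑ u, relayIndexProb ch p ε c yR u = 1 := by
  classical
  unfold relayIndexProb
  dsimp only
  split_ifs with h
  · rw [Finset.sum_ite_mem, Finset.univ_inter, Finset.sum_const, nsmul_eq_mul]
    have := h.card_pos
    field_simp
  · rw [Finset.sum_const, nsmul_eq_mul, Finset.card_univ]
    have := Fintype.card_pos (α := U)
    field_simp

/-- The pair of messages `w` passes the destination's joint typicality test over both slots, for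
some quantization index `u` common to the two slots. -/
def DestTypical (ch : Channel X₁₁ X₂₁ X₁₂ X₂₂ XR YD1 YR YD2)
    (p : Inputs X₁₁ X₂₁ X₁₂ X₂₂ XR YR YQ) (ε : ℝ)
    (c : Codebook X₁₁ X₂₁ X₁₂ X₂₂ XR YQ W₁ W₂ U n m)
    (yD1 : Fin n → YD1) (yD2 : Fin m → YD2) (w : W₁ × W₂) : Prop :=
  ∃ u : U,
    Typical (law (joint1 ch p) fun s => (s.x11, s.x21, s.yD1, s.yQ)) ε
      (fun i => (c.x11 w.1 i, c.x21 w.2 i, yD1 i, c.yQ u i)) ∧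
    Typical (joint2 ch p) ε
      (fun j => (c.x12 w.1 j, c.x22 w.2 j, c.xR u j, yD2 j))

open Classical in
/-- The code that the generalized quantize-and-forward scheme builds from a codebook. The relay
quantizes with parameter `ε'` and sends `x_R(u)` for the chosen index `u`; the destination looks for
a unique pair of messages that passes its test with parameter `ε`. -/
def Codebook.toCode [Nonempty U] (c : Codebook X₁₁ X₂₁ X₁₂ X₂₂ XR YQ W₁ W₂ U n m)
    (ch : Channel X₁₁ X₂₁ X₁₂ X₂₂ XR YD1 YR YD2)
    (p : Inputs X₁₁ X₂₁ X₁₂ X₂₂ XR YR YQ) (ε' ε : ℝ) :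
    Code X₁₁ X₂₁ X₁₂ X₂₂ XR YD1 YR YD2 W₁ W₂ n m where
  enc11 := c.x11
  enc12 := c.x12
  enc21 := c.x21
  enc22 := c.x22
  relay yR := ⟨fun x => ∑ u, if c.xR u = x then relayIndexProb ch p ε' c yR u else 0,
    fun x => Finset.sum_nonneg fun u _ => by
      split_ifs
      · exact relayIndexProb_nonneg ch p ε' c yR u
      · exact le_rfl,
    by
      rw [Finset.sum_comm]
      simpa using sum_relayIndexProb ch p ε' c yR⟩
  dec yD1 yD2 :=
    if h : ∃! w, DestTypical ch p ε c yD1 yD2 w then some h.choose else none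

/-- The error probability of the scheme averaged over the random codebook: all letters of all
codewords are independent, with laws `p(x₁₁)`, `p(x₁₂)`, `p(x₂₁)`, `p(x₂₂)`, `p(x_R)` and, for the
quantization codewords, the marginal `p(ŷ_R)`. -/
def ensembleError (W₁ W₂ U : Type) [Fintype W₁] [Fintype W₂] [Fintype U] [Nonempty U]
    [DecidableEq W₁] [DecidableEq W₂] [DecidableEq U] (n m : ℕ)
    (ch : Channel X₁₁ X₂₁ X₁₂ X₂₂ XR YD1 YR YD2)
    (p : Inputs X₁₁ X₂₁ X₁₂ X₂₂ XR YR YQ) (ε' ε : ℝ) : ℝ :=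
  ∑ x11 : W₁ → Fin n → X₁₁, ∑ x12 : W₁ → Fin m → X₁₂,
  ∑ x21 : W₂ → Fin n → X₂₁, ∑ x22 : W₂ → Fin m → X₂₂,
  ∑ xR : U → Fin m → XR, ∑ yQ : U → Fin n → YQ,
    (∏ w, ∏ i, p.p11 (x11 w i)) * (∏ w, ∏ j, p.p12 (x12 w j)) *
    (∏ w, ∏ i, p.p21 (x21 w i)) * (∏ w, ∏ j, p.p22 (x22 w j)) *
    (∏ u, ∏ j, p.pR (xR u j)) *
    (∏ u, ∏ i, law (joint1 ch p) (fun s => s.yQ) (yQ u i)) *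
    ((Codebook.mk x11 x12 x21 x22 xR yQ).toCode ch p ε' ε).errorProb ch

end Scheme

/-- The number `⌈2 ^ (l R)⌉` of messages of a code of block length `l` and rate `R`. -/
def numMsgs (l : ℕ) (R : ℝ) : ℕ := ⌈(2 : ℝ) ^ ((l : ℝ) * R)⌉₊

instance (l : ℕ) (R : ℝ) : NeZero (numMsgs l R) :=
  ⟨(Nat.ceil_pos.mpr (Real.rpow_pos_of_pos two_pos _)).ne'⟩

/-- The generalized quantize-and-forward scheme with input distributions and quantizer `p`,
fraction `β` of the first slot and quantization rate `RU` achieves the rate pair `(R₁, R₂)`: for all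
sufficiently small typicality parameters `ε' < ε`, as the block length `l = n + m` with `n = β l`
grows, the error probability averaged over the random codebooks tends to `0`, and there are
codebooks for which the error probability of the scheme tends to `0`. -/
def GQFAchievable {X₁₁ X₂₁ X₁₂ X₂₂ XR YD1 YR YD2 YQ : Type*}
    [Fintype X₁₁] [Fintype X₂₁] [Fintype X₁₂] [Fintype X₂₂] [Fintype XR]
    [Fintype YD1] [Fintype YR] [Fintype YD2] [Fintype YQ]
    (ch : Channel X₁₁ X₂₁ X₁₂ X₂₂ XR YD1 YR YD2)
    (p : Inputs X₁₁ X₂₁ X₁₂ X₂₂ XR YR YQ) (β : ℚ) (RU R₁ R₂ : ℝ) : Prop :=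
  ∃ ε₀ : ℝ, 0 < ε₀ ∧ ∀ ε' ε : ℝ, 0 < ε' → ε' < ε → ε < ε₀ →
    ∀ η : ℝ, 0 < η → ∃ L : ℕ, ∀ n m : ℕ, L ≤ n + m → (n : ℚ) = β * ((n + m : ℕ) : ℚ) →
      ensembleError (Fin (numMsgs (n + m) R₁)) (Fin (numMsgs (n + m) R₂))
        (Fin (numMsgs (n + m) RU)) n m ch p ε' ε ≤ η ∧
      ∃ c : Codebook X₁₁ X₂₁ X₁₂ X₂₂ XR YQ (Fin (numMsgs (n + m) R₁))
          (Fin (numMsgs (n + m) R₂)) (Fin (numMsgs (n + m) RU)) n m,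
        (c.toCode ch p ε' ε).errorProb ch ≤ η

end

end HalfDuplexMARC

/-! The proof is a random coding argument. For a random codebook an error forces one of three
things: the relay finds no compatible index; it finds one, but the words sent fail the destination's
test with the chosen index; or another message pair passes the test with some index. The decoder
asks for uniqueness of the message pair only, so a wrong index with the right messages is harmless.
What remains are six kinds of wrong pairs (first message, second message or both wrong; relay's
index or another one), and each of them accounts for one of the six rate inequalities. The union
bound is `sum_error_le`, stated for abstract alphabets whose letters are whole words.

The difficulty is that the relay's index depends on the whole quantization codebook, so that
conditioning on it destroys the independence of the words. Conditioning is replaced by redrawing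
words (`Resampling`). If the index is the relay's, only wrong source words are redrawn, and the law
of the outcome ignores them. If the index is `u' ≠ u`, the law of the outcome on `u ≠ u'` is
dominated by that of a relay that never considers `u'` (`selProb_le`). This is a sub-probability law
that ignores the words of `u'`, so they can be redrawn without any loss. For the words sent, the
choice of the index looks at quantization words only. Hence the chosen relay word is still fresh,
and given the observation the slot 1 words are independent of the quantization word. The conditional
typicality lemma `exists_sum_ind_not_typical_le` then applies to every compatible index.

All exponents come from one change of measure, `seqLaw_eq_condProb_mul`: on the typical set, a
product law is the conditional law times `2` to the minus sum of the information densities, and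
typicality pins this sum to `n` times a divergence, up to an error proportional to `ε`. Read as an
upper bound it controls wrong words; read as a lower bound it shows that `RU > β I(Y_R; Ŷ_R)`
suffices for the relay. The divergences are the stated mutual informations, because the inputs are
independent. In the case of second message and index, the divergence is only bounded below by the
stated expression.

Finally, strict inequalities survive for small `ε` by continuity, and every term of the bound is
`O(1/n)`, `O(1/m)` or at most exponentially small in the block length. An empty slot (`β = 0` or `β
= 1`) needs no separate treatment: the empty word is typical, and `C / 0 = 0`. -/

namespace HalfDuplexMARC

noncomputable section

/-! ### Expectations on finite products -/

section Expectation

open Classical in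
/-- The indicator of a proposition, as a real number. -/
def ind (P : Prop) : ℝ := if P then 1 else 0

theorem ind_of {P : Prop} (h : P) : ind P = 1 := if_pos h

theorem ind_of_not {P : Prop} (h : ¬P) : ind P = 0 := if_neg h

theorem ind_nonneg (P : Prop) : 0 ≤ ind P := by
  unfold ind; split_ifs <;> norm_num

theorem ind_le_one (P : Prop) : ind P ≤ 1 := by
  unfold ind; split_ifs <;> norm_num

theorem ind_mono {P Q : Prop} (h : P → Q) : ind P ≤ ind Q := by
  by_cases hP : P
  · rw [ind_of hP, ind_of (h hP)]
  · rw [ind_of_not hP]; exact ind_nonneg Q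

theorem ind_and (P Q : Prop) : ind (P ∧ Q) = ind P * ind Q := by
  by_cases hP : P <;> by_cases hQ : Q <;> simp [ind, hP, hQ]

theorem ind_not (P : Prop) : ind (¬P) = 1 - ind P := by
  by_cases hP : P <;> simp [ind, hP]

theorem ind_or_le (P Q : Prop) : ind (P ∨ Q) ≤ ind P + ind Q := by
  by_cases hP : P <;> by_cases hQ : Q <;> simp [ind, hP, hQ]

theorem ind_exists_le {ι : Type*} [Fintype ι] (P : ι → Prop) : ind (∃ i, P i) ≤ ∑ i, ind (P i) := by
  by_cases h : ∃ i, P i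
  · obtain ⟨i, hi⟩ := h
    rw [ind_of ⟨i, hi⟩, ← ind_of hi]
    exact Finset.single_le_sum (fun j _ => ind_nonneg (P j)) (Finset.mem_univ i)
  · rw [ind_of_not h]
    exact Finset.sum_nonneg fun j _ => ind_nonneg _

theorem ind_forall {ι : Type*} [Fintype ι] (P : ι → Prop) : ind (∀ i, P i) = ∏ i, ind (P i) := by
  by_cases h : ∀ i, P i
  · rw [ind_of h, Finset.prod_eq_one fun i _ => ind_of (h i)]
  · obtain ⟨i, hi⟩ := not_forall.1 h
    rw [ind_of_not h, Finset.prod_eq_zero (Finset.mem_univ i) (ind_of_not hi)]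

theorem ind_sum_eq {ι : Type*} [Fintype ι] (a : ι) (f : ι → ℝ) : ∑ i, ind (i = a) * f i = f a := by
  classical
  simp [ind]

theorem sum_mul_ind_eq {ι : Type*} [Fintype ι] (a : ι) (f : ι → ℝ) :
    ∑ i, f i * ind (i = a) = f a := by
  simp only [mul_comm (f _), ind_sum_eq]

theorem mul_ind_le {x : ℝ} (hx : 0 ≤ x) (P : Prop) : x * ind P ≤ x :=
  mul_le_of_le_one_right hx (ind_le_one P)

variable {ι α A B : Type*} [Fintype ι] [DecidableEq ι] [Fintype α] [Fintype A] [Fintype B]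

/-- The weight of a sequence with independent letters, the `i`-th one of law `p i`. -/
def seqLaw (p : ι → α → ℝ) (x : ι → α) : ℝ := ∏ i, p i (x i)

omit [DecidableEq ι] [Fintype α] in
theorem seqLaw_nonneg {p : ι → α → ℝ} (hp : ∀ i a, 0 ≤ p i a) (x : ι → α) : 0 ≤ seqLaw p x :=
  Finset.prod_nonneg fun i _ => hp i (x i)

theorem sum_prod_apply (f : ι → α → ℝ) : ∑ x : ι → α, ∏ i, f i (x i) = ∏ i, ∑ a, f i a := by
  rw [Finset.prod_univ_sum, Fintype.piFinset_univ]

theorem seqLaw_mem {p : ι → α → ℝ} (hp : ∀ i, p i ∈ stdSimplex ℝ α) :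
    seqLaw p ∈ stdSimplex ℝ (ι → α) := by
  refine ⟨seqLaw_nonneg fun i => (hp i).1, ?_⟩
  unfold seqLaw
  rw [sum_prod_apply]
  exact Finset.prod_eq_one fun i _ => (hp i).2

/-- Functions into a product correspond to pairs of functions. -/
theorem sum_arrow_prod (f : (ι → A) → (ι → B) → ℝ) :
    ∑ x : ι → A, ∑ y : ι → B, f x y = ∑ c : ι → A × B, f (fun i => (c i).1) (fun i => (c i).2) := by
  rw [← Fintype.sum_prod_type' f]
  exact (Fintype.sum_equiv (Equiv.arrowProdEquivProdArrow ι (fun _ => A) (fun _ => B)) _ _ fun _ => rfl).symm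

/-- Redrawing one letter of a sequence does not change its law. -/
theorem sum_seqLaw_update {p : ι → α → ℝ} (hp : ∀ i, p i ∈ stdSimplex ℝ α) (j : ι)
    (F : (ι → α) → ℝ) :
    ∑ x, seqLaw p x * F x = ∑ x, seqLaw p x * ∑ a, p j a * F (Function.update x j a) := by
  have key : ∀ G : (ι → α) → ℝ, ∑ x, G x =
      ∑ a, ∑ y : {i // i ≠ j} → α, G ((Equiv.funSplitAt j α).symm (a, y)) := fun G => by
    rw [← (Equiv.funSplitAt j α).symm.sum_comp, Fintype.sum_prod_type]
  have hup : ∀ a b (y : {i // i ≠ j} → α), Function.update ((Equiv.funSplitAt j α).symm (a, y)) j b =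
      (Equiv.funSplitAt j α).symm (b, y) := fun a b y => by
    ext i
    by_cases h : i = j
    · subst h; simp [Equiv.funSplitAt, Equiv.piSplitAt]
    · simp [Equiv.funSplitAt, Equiv.piSplitAt, h]
  have hw : ∀ a (y : {i // i ≠ j} → α), seqLaw p ((Equiv.funSplitAt j α).symm (a, y)) =
      p j a * ∏ i : {i // i ≠ j}, p i (y i) := fun a y => by
    unfold seqLaw
    rw [Fintype.prod_eq_mul_prod_subtype_ne _ j]
    congr 1
    · simp [Equiv.funSplitAt, Equiv.piSplitAt]
    · refine Finset.prod_congr rfl fun i _ => ?_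
      simp [Equiv.funSplitAt, Equiv.piSplitAt, i.2]
  rw [key, key]
  simp only [hup, hw]
  have : ∀ a, ∑ y : {i // i ≠ j} → α, p j a * (∏ i : {i // i ≠ j}, p i (y i)) *
      ∑ b, p j b * F ((Equiv.funSplitAt j α).symm (b, y)) = p j a *
      ∑ y : {i // i ≠ j} → α, (∏ i : {i // i ≠ j}, p i (y i)) *
      ∑ b, p j b * F ((Equiv.funSplitAt j α).symm (b, y)) := fun a => by
    rw [Finset.mul_sum]
    simp only [mul_assoc]
  simp only [this]
  rw [← Finset.sum_mul, (hp j).2, one_mul, Finset.sum_comm]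
  refine Finset.sum_congr rfl fun y _ => ?_
  rw [Finset.mul_sum]
  refine Finset.sum_congr rfl fun b _ => by ring

theorem sum_seqLaw_apply {p : ι → α → ℝ} (hp : ∀ i, p i ∈ stdSimplex ℝ α) (j : ι) (F : α → ℝ) :
    ∑ x, seqLaw p x * F (x j) = ∑ a, p j a * F a := by
  rw [sum_seqLaw_update hp j]
  simp only [Function.update_self]
  rw [← Finset.sum_mul, (seqLaw_mem hp).2, one_mul]

theorem sum_seqLaw_apply_apply {p : ι → α → ℝ} (hp : ∀ i, p i ∈ stdSimplex ℝ α) {j k : ι}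
    (hjk : j ≠ k) (F G : α → ℝ) :
    ∑ x, seqLaw p x * (F (x j) * G (x k)) = (∑ a, p j a * F a) * ∑ a, p k a * G a := by
  rw [sum_seqLaw_update hp j]
  simp only [Function.update_self, Function.update_of_ne hjk.symm, ← mul_assoc, ← Finset.sum_mul]
  rw [← sum_seqLaw_apply hp k G, Finset.mul_sum]
  exact Finset.sum_congr rfl fun x _ => by ring

/-- The variance of a sum of independent centred variables bounded by `1`. -/
theorem sum_seqLaw_sq_le {p : ι → α → ℝ} (hp : ∀ i, p i ∈ stdSimplex ℝ α) {h : ι → α → ℝ}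
    (h0 : ∀ i, ∑ a, p i a * h i a = 0) (h1 : ∀ i a, |h i a| ≤ 1) :
    ∑ x, seqLaw p x * (∑ i, h i (x i)) ^ 2 ≤ Fintype.card ι := by
  have hx : ∀ x : ι → α, seqLaw p x * (∑ i, h i (x i)) ^ 2 =
      ∑ i, ∑ j, seqLaw p x * (h i (x i) * h j (x j)) := fun x => by
    rw [sq, Finset.sum_mul_sum, Finset.mul_sum]
    exact Finset.sum_congr rfl fun i _ => by rw [Finset.mul_sum]
  simp only [hx]
  rw [Finset.sum_comm]
  have : ∀ i, ∑ x, ∑ j, seqLaw p x * (h i (x i) * h j (x j)) ≤ 1 := fun i => by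
    -- Independence and centring kill the cross terms. Only the diagonal term `j = i` survives, and
    -- it is at most `1`.
    rw [Finset.sum_comm, Finset.sum_eq_single i]
    · rw [← (seqLaw_mem hp).2]
      refine Finset.sum_le_sum fun x _ => mul_le_of_le_one_right ((seqLaw_mem hp).1 x) ?_
      have := abs_le.1 (h1 i (x i))
      nlinarith
    · intro j _ hji
      rw [sum_seqLaw_apply_apply hp hji.symm, h0, zero_mul]
    · simp
  calc _ ≤ ∑ _i : ι, (1 : ℝ) := Finset.sum_le_sum fun i _ => this i
    _ = _ := by simp

/-- Chebyshev's inequality for a sum of independent variables with values in `[0, 1]`. -/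
theorem chebyshev_seqLaw {p : ι → α → ℝ} (hp : ∀ i, p i ∈ stdSimplex ℝ α) {h : ι → α → ℝ}
    (h0 : ∀ i a, 0 ≤ h i a) (h1 : ∀ i a, h i a ≤ 1) {t : ℝ} (ht : 0 < t) :
    ∑ x, seqLaw p x * ind (t < |∑ i, h i (x i) - ∑ i, ∑ a, p i a * h i a|) ≤
      Fintype.card ι / t ^ 2 := by
  have hm0 : ∀ i, 0 ≤ ∑ a, p i a * h i a := fun i =>
    Finset.sum_nonneg fun a _ => mul_nonneg ((hp i).1 a) (h0 i a)
  have hm1 : ∀ i, ∑ a, p i a * h i a ≤ 1 := fun i => by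
    rw [← (hp i).2]
    exact Finset.sum_le_sum fun a _ => mul_le_of_le_one_right ((hp i).1 a) (h1 i a)
  have hv := sum_seqLaw_sq_le hp (h := fun i a => h i a - ∑ b, p i b * h i b)
    (fun i => by
      simp only [mul_sub, Finset.sum_sub_distrib]
      rw [← Finset.sum_mul, (hp i).2, one_mul, sub_self])
    (fun i a => abs_le.2 ⟨by linarith [h0 i a, hm1 i], by linarith [h1 i a, hm0 i]⟩)
  simp only [Finset.sum_sub_distrib] at hv
  rw [le_div_iff₀ (by positivity), Finset.sum_mul]
  refine le_trans (Finset.sum_le_sum fun x _ => ?_) hv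
  rw [mul_assoc]
  refine mul_le_mul_of_nonneg_left ?_ ((seqLaw_mem hp).1 x)
  by_cases hx : t < |∑ i, h i (x i) - ∑ i, ∑ a, p i a * h i a|
  · rw [ind_of hx, one_mul, ← sq_abs (_ - _)]
    exact pow_le_pow_left₀ ht.le hx.le 2
  · rw [ind_of_not hx, zero_mul]
    positivity

end Expectation

/-! ### Typical sequences -/

section Typicality

variable {Ω A B X : Type*} [Fintype Ω] [Fintype A] [Fintype B] [Fintype X] {n : ℕ}

open Classical in
omit [Fintype Ω] in
theorem card_filter_eq_sum_ind (s : Fin n → Ω) (a : Ω) :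
    ((Finset.univ.filter fun i => s i = a).card : ℝ) = ∑ i, ind (s i = a) := by
  simp [ind]

omit [Fintype Ω] in
theorem typical_iff {q : Ω → ℝ} {ε : ℝ} {s : Fin n → Ω} :
    Typical q ε s ↔ ∀ a, |∑ i, ind (s i = a) - n * q a| ≤ ε * (n * q a) := by
  unfold Typical
  simp only [card_filter_eq_sum_ind]

-- The allowed deviation is proportional to `q a`, so letters of probability zero may not occur at
-- all. This makes every logarithm and conditional probability along a typical sequence meaningful.
omit [Fintype Ω] in
theorem Typical.pos {q : Ω → ℝ} {ε : ℝ} {s : Fin n → Ω} (hq : ∀ a, 0 ≤ q a) (hs : Typical q ε s)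
    (i : Fin n) : 0 < q (s i) := by
  refine lt_of_le_of_ne (hq _) fun h => ?_
  have := typical_iff.1 hs (s i)
  rw [← h] at this
  simp only [mul_zero, sub_zero, abs_nonpos_iff] at this
  have h1 := (Finset.sum_eq_zero_iff_of_nonneg fun j _ => ind_nonneg (s j = s i)).1 this i
    (Finset.mem_univ i)
  rw [ind_of rfl] at h1
  exact one_ne_zero h1

/-- The typical average lemma. -/
theorem Typical.abs_sum_sub_le {q : Ω → ℝ} {ε : ℝ} {s : Fin n → Ω} (hs : Typical q ε s)
    (g : Ω → ℝ) : |∑ i, g (s i) - n * ∑ a, q a * g a| ≤ ε * (n * ∑ a, q a * |g a|) := by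
  have h1 : ∑ i, g (s i) = ∑ a, (∑ i, ind (s i = a)) * g a := by
    simp only [Finset.sum_mul]
    rw [Finset.sum_comm]
    refine Finset.sum_congr rfl fun i _ => ?_
    rw [← ind_sum_eq (s i) g]
    simp only [eq_comm]
  have h2 : ∑ i, g (s i) - n * ∑ a, q a * g a = ∑ a, (∑ i, ind (s i = a) - n * q a) * g a := by
    rw [h1, Finset.mul_sum, ← Finset.sum_sub_distrib]
    exact Finset.sum_congr rfl fun a _ => by ring
  rw [h2, Finset.mul_sum, Finset.mul_sum]
  refine (Finset.abs_sum_le_sum_abs _ _).trans (Finset.sum_le_sum fun a _ => ?_)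
  rw [abs_mul]
  calc _ ≤ ε * (n * q a) * |g a| := mul_le_mul_of_nonneg_right (typical_iff.1 hs a) (abs_nonneg _)
    _ = _ := by ring

/-! #### Change of measure on the typical set -/

/-- The density of `q` with respect to the product of `r` and the second marginal of `q`, in bits.
The alphabet of `q` is split into two parts by `e`. -/
def infoDensity (q : Ω → ℝ) (e : A × B ≃ Ω) (r : A → ℝ) (c : Ω) : ℝ :=
  Real.logb 2 (q c / (r (e.symm c).1 * ∑ a, q (e (a, (e.symm c).2))))

/-- The relative entropy of `q` with respect to the product of `r` and its second marginal. -/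
def divergence (q : Ω → ℝ) (e : A × B ≃ Ω) (r : A → ℝ) : ℝ :=
  ∑ c, q c * infoDensity q e r c

/-- The mean of the absolute value of the information density. -/
def absDivergence (q : Ω → ℝ) (e : A × B ≃ Ω) (r : A → ℝ) : ℝ :=
  ∑ c, q c * |infoDensity q e r c|

/-- The conditional probability of the first part of a letter given the second. -/
def condProb (q : Ω → ℝ) (e : A × B ≃ Ω) (b : B) (a : A) : ℝ :=
  q (e (a, b)) / ∑ a', q (e (a', b))

omit [Fintype Ω] [Fintype B] in
theorem condProb_nonneg {q : Ω → ℝ} (hq : ∀ c, 0 ≤ q c) (e : A × B ≃ Ω) (b : B) (a : A) :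
    0 ≤ condProb q e b a :=
  div_nonneg (hq _) (Finset.sum_nonneg fun _ _ => hq _)

-- Equality fails exactly at letters `b` of marginal zero, where the sum is `0 / 0 = 0`. The
-- inequality is enough for upper bounds and spares a hypothesis on `b`.
omit [Fintype Ω] [Fintype B] in
theorem sum_condProb_le_one (q : Ω → ℝ) (e : A × B ≃ Ω) (b : B) :
    ∑ a, condProb q e b a ≤ 1 := by
  unfold condProb
  rw [← Finset.sum_div]
  exact div_self_le_one _

-- Change of measure, letter by letter: `r a = q(a | b) * 2 ^ (-i(a, b))` wherever `q (e (a, b)) >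
-- 0`, which typicality guarantees at every position. The hypothesis `hqr` is absolute continuity of
-- `q` with respect to `r`.
omit [Fintype Ω] [Fintype B] in
theorem seqLaw_eq_condProb_mul {q : Ω → ℝ} (hq : ∀ c, 0 ≤ q c) (e : A × B ≃ Ω) {r : A → ℝ}
    (hr : ∀ a, 0 ≤ r a) (hqr : ∀ a b, r a = 0 → q (e (a, b)) = 0) {ε : ℝ}
    {a : Fin n → A} {b : Fin n → B} (h : Typical q ε fun i => e (a i, b i)) :
    seqLaw (fun _ => r) a = seqLaw (fun i => condProb q e (b i)) a *
      (2 : ℝ) ^ (-∑ i, infoDensity q e r (e (a i, b i))) := by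
  unfold seqLaw
  rw [← Finset.sum_neg_distrib, Real.rpow_sum_of_pos two_pos, ← Finset.prod_mul_distrib]
  refine Finset.prod_congr rfl fun i _ => ?_
  have hpos : 0 < q (e (a i, b i)) := h.pos hq i
  have hr' : 0 < r (a i) := lt_of_le_of_ne (hr _) fun h0 => hpos.ne' (hqr _ _ h0.symm)
  have hm : 0 < ∑ a', q (e (a', b i)) :=
    hpos.trans_le (Finset.single_le_sum (fun a' _ => hq (e (a', b i))) (Finset.mem_univ (a i)))
  unfold infoDensity condProb
  rw [Real.rpow_neg two_pos.le, Real.rpow_logb two_pos (by norm_num) (by simpa using by positivity)]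
  simp only [Equiv.symm_apply_apply]
  field_simp

omit [Fintype B] in
/-- A word drawn from `r` is jointly typical with a given word with small probability. -/
theorem sum_seqLaw_ind_typical_le {q : Ω → ℝ} (hq : ∀ c, 0 ≤ q c) (e : A × B ≃ Ω) {r : A → ℝ}
    (hr : ∀ a, 0 ≤ r a) (hqr : ∀ a b, r a = 0 → q (e (a, b)) = 0) (ε : ℝ) (b : Fin n → B) :
    ∑ a : Fin n → A, seqLaw (fun _ => r) a * ind (Typical q ε fun i => e (a i, b i)) ≤
      (2 : ℝ) ^ (-(n * (divergence q e r - ε * absDivergence q e r))) := by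
  calc _ ≤ ∑ a : Fin n → A, seqLaw (fun i => condProb q e (b i)) a *
        (2 : ℝ) ^ (-(n * (divergence q e r - ε * absDivergence q e r))) := by
        refine Finset.sum_le_sum fun a _ => ?_
        have h0 : 0 ≤ seqLaw (fun i => condProb q e (b i)) a :=
          seqLaw_nonneg (fun i => condProb_nonneg hq e (b i)) a
        by_cases h : Typical q ε fun i => e (a i, b i)
        · rw [ind_of h, mul_one, seqLaw_eq_condProb_mul hq e hr hqr h]
          refine mul_le_mul_of_nonneg_left (Real.rpow_le_rpow_of_exponent_le one_le_two ?_) h0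
          have := (abs_le.1 (h.abs_sum_sub_le (infoDensity q e r))).1
          unfold divergence absDivergence
          linarith
        · rw [ind_of_not h, mul_zero]
          positivity
    _ ≤ 1 * (2 : ℝ) ^ (-(n * (divergence q e r - ε * absDivergence q e r))) := by
        rw [← Finset.sum_mul]
        refine mul_le_mul_of_nonneg_right ?_ (by positivity)
        unfold seqLaw
        rw [sum_prod_apply]
        exact Finset.prod_le_one (fun i _ => Finset.sum_nonneg fun a _ => condProb_nonneg hq e _ a)
          fun i _ => sum_condProb_le_one q e _
    _ = _ := one_mul _

omit [Fintype B] in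
/-- A word drawn from `r` is jointly typical with a given word with probability at least that of
a word drawn from the conditional law, up to an exponential factor. -/
theorem le_sum_seqLaw_ind_typical {q : Ω → ℝ} (hq : ∀ c, 0 ≤ q c) (e : A × B ≃ Ω) {r : A → ℝ}
    (hr : ∀ a, 0 ≤ r a) (hqr : ∀ a b, r a = 0 → q (e (a, b)) = 0) (ε : ℝ) (b : Fin n → B) :
    (∑ a : Fin n → A, seqLaw (fun i => condProb q e (b i)) a *
        ind (Typical q ε fun i => e (a i, b i))) *
      (2 : ℝ) ^ (-(n * (divergence q e r + ε * absDivergence q e r))) ≤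
    ∑ a : Fin n → A, seqLaw (fun _ => r) a * ind (Typical q ε fun i => e (a i, b i)) := by
  rw [Finset.sum_mul]
  refine Finset.sum_le_sum fun a _ => ?_
  have h0 : 0 ≤ seqLaw (fun i => condProb q e (b i)) a :=
    seqLaw_nonneg (fun i => condProb_nonneg hq e (b i)) a
  by_cases h : Typical q ε fun i => e (a i, b i)
  · rw [ind_of h, mul_one, mul_one, seqLaw_eq_condProb_mul hq e hr hqr h]
    refine mul_le_mul_of_nonneg_left (Real.rpow_le_rpow_of_exponent_le one_le_two ?_) h0
    have := (abs_le.1 (h.abs_sum_sub_le (infoDensity q e r))).2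
    unfold divergence absDivergence
    linarith
  · rw [ind_of_not h]
    simp

/-! #### Laws of large numbers -/

open Classical in
/-- The conditional typicality lemma: if `b` is `ε'`-typical and the letters `x i` are drawn
independently from `w (b i)`, the sequence `f (x i) (b i)` is `ε`-typical with high probability. -/
theorem exists_sum_ind_not_typical_le {pB : B → ℝ} (hpB : ∀ b, 0 ≤ pB b) {w : B → X → ℝ}
    (hw : ∀ b, pB b ≠ 0 → w b ∈ stdSimplex ℝ X) (f : X → B → Ω) {q : Ω → ℝ}
    (hq : ∀ c, q c = ∑ b, pB b * ∑ x, w b x * ind (f x b = c)) {ε' ε : ℝ} (hε : ε' < ε) :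
    ∃ C : ℝ, 0 ≤ C ∧ ∀ (n : ℕ) (b : Fin n → B), Typical pB ε' b →
      ∑ x : Fin n → X, seqLaw (fun i => w (b i)) x *
        ind (¬Typical q ε fun i => f (x i) (b i)) ≤ C / n := by
  -- Chebyshev with deviation `(ε - ε') n q(c)` gives `n / ((ε - ε') n q(c)) ^ 2` for each letter
  -- `c`. Letters with `q c = 0` contribute `1 / 0 = 0`.
  refine ⟨∑ c, 1 / ((ε - ε') * q c) ^ 2, Finset.sum_nonneg fun c _ => by positivity,
    fun n b hb => ?_⟩
  have hwb : ∀ i, w (b i) ∈ stdSimplex ℝ X := fun i => hw _ (hb.pos hpB i).ne'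
  have hq0 : ∀ c, 0 ≤ q c := fun c => by
    rw [hq]
    refine Finset.sum_nonneg fun d _ => ?_
    by_cases hd : pB d = 0
    · simp [hd]
    · exact mul_nonneg (hpB d) (Finset.sum_nonneg fun x _ =>
        mul_nonneg ((hw d hd).1 x) (ind_nonneg _))
  -- For `n = 0` the bound reads `C / 0 = 0`; it holds because the empty sequence is typical.
  rcases Nat.eq_zero_or_pos n with rfl | hn
  · refine (Finset.sum_eq_zero fun x _ => ?_).le.trans (by simp)
    rw [ind_of_not, mul_zero]
    rw [not_not]
    intro a
    simp
  have hn' : (0 : ℝ) < n := by exact_mod_cast hn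
  -- The expected number of occurrences of `c` is a sum over the letters of `b` of a nonnegative
  -- function. The typical average lemma puts it within `ε' n q(c)` of `n q(c)`, leaving the margin
  -- `ε - ε'` for random fluctuations.
  have hmean : ∀ c, |∑ i, (∑ x, w (b i) x * ind (f x (b i) = c)) - n * q c| ≤ ε' * (n * q c) := by
    intro c
    have habs : ∑ d, pB d * |∑ x, w d x * ind (f x d = c)| = q c := by
      rw [hq c]
      refine Finset.sum_congr rfl fun d _ => ?_
      by_cases hd : pB d = 0
      · simp [hd]
      · rw [abs_of_nonneg]
        exact Finset.sum_nonneg fun x _ => mul_nonneg ((hw d hd).1 x) (ind_nonneg _)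
    have := hb.abs_sum_sub_le fun d => ∑ x, w d x * ind (f x d = c)
    rwa [habs, ← hq c] at this
  have hletter : ∀ c, ∑ x : Fin n → X, seqLaw (fun i => w (b i)) x *
      ind (ε * (n * q c) < |∑ i, ind (f (x i) (b i) = c) - n * q c|) ≤
      1 / ((ε - ε') * q c) ^ 2 / n := by
    intro c
    -- If `q c = 0`, the claimed bound is `0`: by `hmean` the letter `c` has probability zero at
    -- every position, so it almost surely never occurs.
    rcases (hq0 c).eq_or_lt with h0 | hpos
    · have hm := hmean c
      rw [← h0] at hm ⊢
      simp only [mul_zero, sub_zero, abs_nonpos_iff] at hm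
      simp only [mul_zero, sub_zero]
      have hz : ∀ i, ∑ x, w (b i) x * ind (f x (b i) = c) = 0 := fun i =>
        (Finset.sum_eq_zero_iff_of_nonneg fun j _ => Finset.sum_nonneg fun x _ =>
          mul_nonneg ((hwb j).1 x) (ind_nonneg _)).1 hm i (Finset.mem_univ i)
      calc _ ≤ ∑ x : Fin n → X, seqLaw (fun i => w (b i)) x * ∑ i, ind (f (x i) (b i) = c) := by
            refine Finset.sum_le_sum fun x _ => mul_le_mul_of_nonneg_left ?_ ((seqLaw_mem hwb).1 x)
            refine le_trans (ind_mono fun h => ?_) (ind_exists_le _)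
            by_contra hne
            rw [Finset.sum_eq_zero fun i _ => ind_of_not fun h' => hne ⟨i, h'⟩] at h
            simp at h
        _ = ∑ i, ∑ x : Fin n → X, seqLaw (fun i => w (b i)) x * ind (f (x i) (b i) = c) := by
            simp only [Finset.mul_sum]
            rw [Finset.sum_comm]
        _ = 0 := Finset.sum_eq_zero fun i _ => by
            rw [sum_seqLaw_apply hwb i fun y => ind (f y (b i) = c), hz]
        _ ≤ _ := by positivity
    · have ht : 0 < (ε - ε') * (n * q c) := mul_pos (sub_pos.2 hε) (mul_pos hn' hpos)
      have := chebyshev_seqLaw hwb (h := fun i x => ind (f x (b i) = c))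
        (fun _ _ => ind_nonneg _) (fun _ _ => ind_le_one _) ht
      calc _ ≤ _ := Finset.sum_le_sum fun x _ => mul_le_mul_of_nonneg_left (ind_mono fun h => ?_)
            ((seqLaw_mem hwb).1 x)
        _ ≤ _ := this
        _ = _ := by
            rw [Fintype.card_fin]
            field_simp
      have h3 := abs_sub_le (∑ i, ind (f (x i) (b i) = c))
        (∑ i, (∑ x, w (b i) x * ind (f x (b i) = c))) (n * q c)
      linarith [hmean c]
  rw [Finset.sum_div]
  refine le_trans ?_ (Finset.sum_le_sum fun c _ => hletter c)
  rw [Finset.sum_comm]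
  refine Finset.sum_le_sum fun x _ => ?_
  rw [← Finset.mul_sum]
  refine mul_le_mul_of_nonneg_left ?_ ((seqLaw_mem hwb).1 x)
  refine le_trans (ind_mono fun h => ?_) (ind_exists_le _)
  rw [typical_iff] at h
  push Not at h
  exact h

/-- The weak law of large numbers: an i.i.d. sequence is typical with high probability. -/
theorem exists_sum_seqLaw_ind_not_typical_le {q : Ω → ℝ} (hq : q ∈ stdSimplex ℝ Ω) {ε : ℝ}
    (hε : 0 < ε) : ∃ C : ℝ, 0 ≤ C ∧ ∀ n : ℕ,
      ∑ x : Fin n → Ω, seqLaw (fun _ => q) x * ind (¬Typical q ε x) ≤ C / n := by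
  -- Conditioning on a one-letter alphabet is no conditioning; the constant sequence is `0`-typical,
  -- so the conditional lemma applies with `ε' = 0`.
  obtain ⟨C, hC0, hC⟩ := exists_sum_ind_not_typical_le (pB := fun _ : Unit => 1)
    (fun _ => zero_le_one) (w := fun _ => q) (fun _ _ => hq) (fun x _ => x) (q := q)
    (fun c => by
      simp only [Finset.univ_unique, Finset.sum_const, Finset.card_singleton, one_smul, one_mul]
      rw [← ind_sum_eq c q]
      exact Finset.sum_congr rfl fun x _ => mul_comm _ _) hε
  refine ⟨C, hC0, fun n => hC n (fun _ => ()) ?_⟩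
  rw [typical_iff]
  intro a
  simp [ind]

end Typicality

/-! ### Random coding over abstract alphabets -/

/-! ### The relay's random choice of an index -/

section Selection

variable {U : Type*} [Fintype U]

open Classical in
/-- The law of an index drawn uniformly among those that satisfy `s`, or among all indices if none
does. -/
def selProb (s : U → Prop) (u : U) : ℝ :=
  let T : Finset U := Finset.univ.filter s
  if T.Nonempty then (if u ∈ T then (1 : ℝ) / T.card else 0) else (1 : ℝ) / Fintype.card U

theorem selProb_nonneg (s : U → Prop) (u : U) : 0 ≤ selProb s u := by
  unfold selProb
  dsimp only
  split_ifs <;> positivity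

theorem sum_selProb [Nonempty U] (s : U → Prop) : ∑ u, selProb s u = 1 := by
  classical
  unfold selProb
  dsimp only
  split_ifs with h
  · rw [Finset.sum_ite_mem, Finset.univ_inter, Finset.sum_const, nsmul_eq_mul]
    have := h.card_pos
    field_simp
  · rw [Finset.sum_const, nsmul_eq_mul, Finset.card_univ]
    have := Fintype.card_pos (α := U)
    field_simp

theorem selProb_eq_zero {s : U → Prop} {u v : U} (hv : s v) (hu : ¬s u) : selProb s u = 0 := by
  classical
  have : (Finset.univ.filter s).Nonempty := ⟨v, by simpa using hv⟩
  simp [selProb, this, hu]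

theorem selProb_eq_one_div {s : U → Prop} {u : U} (hu : s u) :
    selProb s u = 1 / (Nat.card {t // s t} : ℝ) := by
  classical
  have : (Finset.univ.filter s).Nonempty := ⟨u, by simpa using hu⟩
  simp [selProb, this, hu, Fintype.card_subtype]

/-- Discarding a candidate increases the probability of all other indices. -/
theorem selProb_le {s : U → Prop} {u v : U} (huv : u ≠ v) :
    selProb s u ≤ selProb (fun t => s t ∧ t ≠ v) u := by
  by_cases hu : s u
  · rw [selProb_eq_one_div hu, selProb_eq_one_div ⟨hu, huv⟩]
    have : Nonempty {t // s t ∧ t ≠ v} := ⟨⟨u, hu, huv⟩⟩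
    refine one_div_le_one_div_of_le (by exact_mod_cast Nat.card_pos) ?_
    exact_mod_cast Nat.card_le_card_of_injective
      (fun t : {t // s t ∧ t ≠ v} => (⟨t.1, t.2.1⟩ : {t // s t}))
      fun t t' h => Subtype.ext (by simpa using h)
  · by_cases h : ∃ t, s t
    · obtain ⟨t, ht⟩ := h
      rw [selProb_eq_zero ht hu]
      exact selProb_nonneg _ _
    -- Without any candidate, discarding `v` changes nothing: both sides are the uniform law on all
    -- indices, `v` included.
    · push Not at h
      have : s = fun t => s t ∧ t ≠ v := by
        ext t
        simp [h t]
      exact (congrArg (fun f => selProb f u) this).le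

end Selection

/-! ### Redrawing independent words -/

section Resampling

variable {Γ Γ' K K' Ω : Type*} [Fintype Γ] [Fintype Γ'] [Fintype K] [Fintype K'] [Fintype Ω]

/-- Applying `σ k` for a random `k` of law `p` leaves the law `P` unchanged. -/
def Resampling (P : Γ → ℝ) (p : K → ℝ) (σ : K → Γ → Γ) : Prop :=
  ∀ F : Γ → ℝ, ∑ g, P g * F g = ∑ g, P g * ∑ k, p k * F (σ k g)

theorem Resampling.comp {P : Γ → ℝ} {p : K → ℝ} {p' : K' → ℝ} {σ : K → Γ → Γ} {σ' : K' → Γ → Γ}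
    (h : Resampling P p σ) (h' : Resampling P p' σ') :
    Resampling P (fun k : K × K' => p k.1 * p' k.2) fun k g => σ k.1 (σ' k.2 g) := by
  intro F
  rw [h F, h' fun g => ∑ k, p k * F (σ k g)]
  refine Finset.sum_congr rfl fun g _ => ?_
  rw [Fintype.sum_prod_type_right]
  congr 1
  refine Finset.sum_congr rfl fun k' _ => ?_
  rw [Finset.mul_sum]
  exact Finset.sum_congr rfl fun k _ => by ring

theorem Resampling.fst {P : Γ → ℝ} {p : K → ℝ} {σ : K → Γ → Γ} (h : Resampling P p σ)
    (P' : Γ' → ℝ) : Resampling (fun g : Γ × Γ' => P g.1 * P' g.2) p fun k g => (σ k g.1, g.2) := by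
  intro F
  rw [Fintype.sum_prod_type_right, Fintype.sum_prod_type_right]
  refine Finset.sum_congr rfl fun g' _ => ?_
  have := h fun g => F (g, g')
  simp only [mul_right_comm _ (P' g'), ← Finset.sum_mul]
  rw [this]

theorem Resampling.snd {P : Γ → ℝ} {p : K → ℝ} {σ : K → Γ → Γ} (h : Resampling P p σ)
    (P' : Γ' → ℝ) : Resampling (fun g : Γ' × Γ => P' g.1 * P g.2) p fun k g => (g.1, σ k g.2) := by
  intro F
  rw [Fintype.sum_prod_type, Fintype.sum_prod_type]
  refine Finset.sum_congr rfl fun g' _ => ?_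
  have := h fun g => F (g', g)
  simp only [mul_assoc, ← Finset.mul_sum]
  rw [this]

/-- If the law of the outcome does not depend on what is redrawn, the probability of an event is at
most the largest probability it has under redrawing. -/
theorem Resampling.sum_le {P : Γ → ℝ} {p : K → ℝ} {σ : K → Γ → Γ} (h : Resampling P p σ)
    (hP : P ∈ stdSimplex ℝ Γ) {μ : Γ → Ω → ℝ} (hμ₀ : ∀ g ω, 0 ≤ μ g ω) (hμ₁ : ∀ g, ∑ ω, μ g ω ≤ 1)
    (hμ : ∀ k g, μ (σ k g) = μ g) {H : Γ → Ω → ℝ} {κ : ℝ} (hκ₀ : 0 ≤ κ)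
    (hκ : ∀ g ω, ∑ k, p k * H (σ k g) ω ≤ κ) : ∑ g, P g * ∑ ω, μ g ω * H g ω ≤ κ := by
  rw [h]
  -- The weight of an outcome no longer sees the redrawn part, so the mean over `k` can be taken for
  -- each fixed outcome.
  simp only [hμ]
  calc _ ≤ ∑ g, P g * κ := by
        refine Finset.sum_le_sum fun g _ => mul_le_mul_of_nonneg_left ?_ (hP.1 g)
        simp only [Finset.mul_sum]
        rw [Finset.sum_comm]
        calc _ ≤ ∑ ω, μ g ω * κ := by
              refine Finset.sum_le_sum fun ω _ => ?_
              refine le_trans (le_of_eq ?_) (mul_le_mul_of_nonneg_left (hκ g ω) (hμ₀ g ω))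
              rw [Finset.mul_sum]
              exact Finset.sum_congr rfl fun k _ => by ring
          _ ≤ κ := by
              rw [← Finset.sum_mul]
              exact mul_le_of_le_one_left hκ₀ (hμ₁ g)
    _ = κ := by rw [← Finset.sum_mul, hP.2, one_mul]

/-- The union bound over competing messages or indices, each with the same bound `κ`. -/
theorem sum_mul_sum_mul_sum_le {ι : Type*} [Fintype ι] {P : Γ → ℝ} {μ : Γ → Ω → ℝ}
    {F : ι → Γ → Ω → ℝ} {κ : ℝ} (h : ∀ i, ∑ g, P g * ∑ ω, μ g ω * F i g ω ≤ κ) :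
    ∑ g, P g * ∑ ω, μ g ω * ∑ i, F i g ω ≤ Fintype.card ι * κ := by
  have : ∑ g, P g * ∑ ω, μ g ω * ∑ i, F i g ω = ∑ i, ∑ g, P g * ∑ ω, μ g ω * F i g ω := by
    simp only [Finset.mul_sum]
    rw [Finset.sum_comm (s := (Finset.univ : Finset ι))]
    refine Finset.sum_congr rfl fun g _ => ?_
    rw [Finset.sum_comm]
  rw [this]
  calc _ ≤ ∑ _i : ι, κ := Finset.sum_le_sum fun i _ => h i
    _ = _ := by simp

end Resampling

theorem mul_mem_stdSimplex_prod {A B : Type*} [Fintype A] [Fintype B] {p : A → ℝ} {q : B → ℝ}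
    (hp : p ∈ stdSimplex ℝ A) (hq : q ∈ stdSimplex ℝ B) :
    (fun c : A × B => p c.1 * q c.2) ∈ stdSimplex ℝ (A × B) := by
  refine ⟨fun c => mul_nonneg (hp.1 _) (hq.1 _), ?_⟩
  rw [Fintype.sum_prod_type]
  simp only [← Finset.mul_sum, hq.2, mul_one, hp.2]

/-! ### The law of the random codebook -/

section Book

variable {A B R Q : Type*} [Fintype A] [Fintype B] [Fintype R] [Fintype Q]
  {W₁ W₂ U : Type*} [Fintype W₁] [Fintype W₂] [Fintype U]
  [DecidableEq W₁] [DecidableEq W₂] [DecidableEq U]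

/-- The law of a random codebook with independent words: words in `A` for the first source, words
in `B` for the second source, and pairs of words in `R` and `Q` for the relay. -/
def bookLaw (P₁ : A → ℝ) (P₂ : B → ℝ) (PR : R → ℝ) (PQ : Q → ℝ)
    (g : (W₁ → A) × (W₂ → B) × (U → R × Q)) : ℝ :=
  seqLaw (fun _ => P₁) g.1 *
    (seqLaw (fun _ => P₂) g.2.1 * seqLaw (fun _ k => PR k.1 * PQ k.2) g.2.2)

variable {P₁ : A → ℝ} {P₂ : B → ℝ} {PR : R → ℝ} {PQ : Q → ℝ}

theorem bookLaw_mem (h₁ : P₁ ∈ stdSimplex ℝ A) (h₂ : P₂ ∈ stdSimplex ℝ B)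
    (hR : PR ∈ stdSimplex ℝ R) (hQ : PQ ∈ stdSimplex ℝ Q) :
    bookLaw P₁ P₂ PR PQ ∈ stdSimplex ℝ ((W₁ → A) × (W₂ → B) × (U → R × Q)) := by
  have h := mul_mem_stdSimplex_prod (seqLaw_mem fun _ : W₁ => h₁)
    (mul_mem_stdSimplex_prod (seqLaw_mem fun _ : W₂ => h₂)
      (seqLaw_mem fun _ : U => mul_mem_stdSimplex_prod hR hQ))
  exact h

theorem resampling_update₁ (h₁ : P₁ ∈ stdSimplex ℝ A) (w : W₁) :
    Resampling (bookLaw (W₁ := W₁) (W₂ := W₂) (U := U) P₁ P₂ PR PQ) P₁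
      fun a g => (Function.update g.1 w a, g.2) := by
  have h : Resampling (seqLaw fun _ : W₁ => P₁) P₁ fun a x => Function.update x w a :=
    sum_seqLaw_update (fun _ => h₁) w
  exact h.fst fun g : (W₂ → B) × (U → R × Q) =>
    seqLaw (fun _ => P₂) g.1 * seqLaw (fun _ k => PR k.1 * PQ k.2) g.2

theorem resampling_update₂ (h₂ : P₂ ∈ stdSimplex ℝ B) (w : W₂) :
    Resampling (bookLaw (W₁ := W₁) (W₂ := W₂) (U := U) P₁ P₂ PR PQ) P₂
      fun b g => (g.1, Function.update g.2.1 w b, g.2.2) := by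
  have h : Resampling (seqLaw fun _ : W₂ => P₂) P₂ fun a x => Function.update x w a :=
    sum_seqLaw_update (fun _ => h₂) w
  exact (h.fst (seqLaw fun (_ : U) (k : R × Q) => PR k.1 * PQ k.2)).snd (seqLaw fun _ : W₁ => P₁)

theorem resampling_update₃ (hR : PR ∈ stdSimplex ℝ R) (hQ : PQ ∈ stdSimplex ℝ Q) (u : U) :
    Resampling (bookLaw (W₁ := W₁) (W₂ := W₂) (U := U) P₁ P₂ PR PQ) (fun k => PR k.1 * PQ k.2)
      fun k g => (g.1, g.2.1, Function.update g.2.2 u k) := by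
  have h : Resampling (seqLaw fun (_ : U) (k : R × Q) => PR k.1 * PQ k.2)
      (fun k => PR k.1 * PQ k.2) fun a x => Function.update x u a :=
    sum_seqLaw_update (fun _ => mul_mem_stdSimplex_prod hR hQ) u
  exact (h.snd (seqLaw fun _ : W₂ => P₂)).snd (seqLaw fun _ : W₁ => P₁)

/-- The relay word of one index may be redrawn while its quantization word is kept. -/
theorem resampling_relay (hR : PR ∈ stdSimplex ℝ R) (hQ : PQ ∈ stdSimplex ℝ Q) (u : U) :
    Resampling (seqLaw fun (_ : U) (k : R × Q) => PR k.1 * PQ k.2) PR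
      fun r c => Function.update c u (r, (c u).2) := by
  intro F
  have h := sum_seqLaw_update (fun _ : U => mul_mem_stdSimplex_prod hR hQ) u
  rw [h F, h fun c => ∑ r, PR r * F (Function.update c u (r, (c u).2))]
  simp only [Function.update_self, Function.update_idem, Fintype.sum_prod_type_right]
  refine Finset.sum_congr rfl fun c _ => ?_
  congr 1
  refine Finset.sum_congr rfl fun q _ => ?_
  rw [← Finset.sum_mul, ← Finset.sum_mul, hR.2, one_mul, Finset.mul_sum]
  exact Finset.sum_congr rfl fun r _ => by ring

/-- The mean of a function of one word of each source and all words of the relay. -/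
theorem sum_bookLaw_apply (h₁ : P₁ ∈ stdSimplex ℝ A) (h₂ : P₂ ∈ stdSimplex ℝ B) (w₁ : W₁) (w₂ : W₂)
    (F : A → B → (U → R × Q) → ℝ) :
    ∑ g, bookLaw P₁ P₂ PR PQ g * F (g.1 w₁) (g.2.1 w₂) g.2.2 =
      ∑ a, P₁ a * ∑ b, P₂ b * ∑ c, seqLaw (fun (_ : U) (k : R × Q) => PR k.1 * PQ k.2) c * F a b c := by
  unfold bookLaw
  simp only [Fintype.sum_prod_type, mul_assoc, ← Finset.mul_sum]
  rw [← sum_seqLaw_apply (fun _ : W₁ => h₁) w₁]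
  refine Finset.sum_congr rfl fun x _ => ?_
  rw [← sum_seqLaw_apply (fun _ : W₂ => h₂) w₂]

end Book

/-! ### Error events for abstract alphabets -/

section OneShot

variable {A B R Q Y V Z : Type*} [Fintype A] [Fintype B] [Fintype R] [Fintype Q] [Fintype Y]
  [Fintype V] [Fintype Z]
  {W₁ W₂ U : Type*} [Fintype W₁] [Fintype W₂] [Fintype U]
  [DecidableEq W₁] [DecidableEq W₂] [DecidableEq U]

/-- The law of the first output `y`, the relay's observation `v`, its index `u` and the second
output `z`, for the words `a`, `b` of the sources and the words `c` of the relay. -/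
def outcomeLaw (k₁ : A → B → Y → V → ℝ) (k₂ : A → B → R → Z → ℝ) (sel : V → U → ℝ)
    (a : A) (b : B) (c : U → R × Q) (o : Y × V × U × Z) : ℝ :=
  k₁ a b o.1 o.2.1 * (sel o.2.1 o.2.2.1 * k₂ a b (c o.2.2.1).1 o.2.2.2)

variable {P₁ : A → ℝ} {P₂ : B → ℝ} {PR : R → ℝ} {PQ : Q → ℝ}
  {k₁ : A → B → Y → V → ℝ} {k₂ : A → B → R → Z → ℝ} {S : V → Q → Prop}
  {T : A → B → R × Q → Y → Z → Prop}

omit [Fintype A] [Fintype B] [Fintype R] [Fintype Q] [DecidableEq U] in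
theorem sum_outcomeLaw_mul (sel : V → U → ℝ) (a : A) (b : B) (c : U → R × Q)
    (F : Y → V → U → Z → ℝ) :
    ∑ o, outcomeLaw k₁ k₂ sel a b c o * F o.1 o.2.1 o.2.2.1 o.2.2.2 =
      ∑ y, ∑ v, k₁ a b y v * ∑ u, sel v u * ∑ z, k₂ a b (c u).1 z * F y v u z := by
  unfold outcomeLaw
  simp only [Fintype.sum_prod_type, mul_assoc, ← Finset.mul_sum]

-- The selection rule need only have mass at most `1`: the rule that leaves out an index in
-- `sum_wrong_index_le` is cut off at that index and may lose mass.
omit [Fintype A] [Fintype B] [Fintype R] [Fintype Q] [DecidableEq U] in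
theorem sum_outcomeLaw_le_one (hk₁ : ∀ a b, ∑ y, ∑ v, k₁ a b y v = 1) (hk₁₀ : ∀ a b y v, 0 ≤ k₁ a b y v)
    (hk₂ : ∀ a b r, k₂ a b r ∈ stdSimplex ℝ Z) {sel : V → U → ℝ} (hsel : ∀ v, ∑ u, sel v u ≤ 1)
    (a : A) (b : B) (c : U → R × Q) : ∑ o, outcomeLaw k₁ k₂ sel a b c o ≤ 1 := by
  have := sum_outcomeLaw_mul (k₁ := k₁) (k₂ := k₂) sel a b c fun _ _ _ _ => 1
  simp only [mul_one, (hk₂ _ _ _).2] at this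
  rw [this, ← hk₁ a b]
  exact Finset.sum_le_sum fun y _ => Finset.sum_le_sum fun v _ =>
    mul_le_of_le_one_right (hk₁₀ a b y v) (hsel v)

omit [Fintype A] [Fintype B] [Fintype R] [Fintype Q] [Fintype Y] [Fintype V] [Fintype U]
  [DecidableEq U] in
theorem outcomeLaw_nonneg (hk₁₀ : ∀ a b y v, 0 ≤ k₁ a b y v)
    (hk₂ : ∀ a b r, k₂ a b r ∈ stdSimplex ℝ Z) {sel : V → U → ℝ} (hsel : ∀ v u, 0 ≤ sel v u)
    (a : A) (b : B) (c : U → R × Q) (o : Y × V × U × Z) : 0 ≤ outcomeLaw k₁ k₂ sel a b c o :=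
  mul_nonneg (hk₁₀ _ _ _ _) (mul_nonneg (hsel _ _) ((hk₂ _ _ _).1 _))

/-- The law of the relay's observation. -/
def obsLaw (P₁ : A → ℝ) (P₂ : B → ℝ) (k₁ : A → B → Y → V → ℝ) (v : V) : ℝ :=
  ∑ a, P₁ a * ∑ b, P₂ b * ∑ y, k₁ a b y v

theorem sum_obsLaw_mul (F : V → ℝ) :
    ∑ v, obsLaw P₁ P₂ k₁ v * F v = ∑ a, P₁ a * ∑ b, P₂ b * ∑ y, ∑ v, k₁ a b y v * F v := by
  unfold obsLaw
  simp only [Finset.sum_mul, Finset.mul_sum, mul_assoc]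
  rw [Finset.sum_comm]
  refine Finset.sum_congr rfl fun a _ => ?_
  rw [Finset.sum_comm]
  refine Finset.sum_congr rfl fun b _ => ?_
  rw [Finset.sum_comm]

/-- The relay finds no compatible index. -/
theorem sum_relay_fails_le (h₁ : P₁ ∈ stdSimplex ℝ A) (h₂ : P₂ ∈ stdSimplex ℝ B)
    (hR : PR ∈ stdSimplex ℝ R) (hQ : PQ ∈ stdSimplex ℝ Q)
    (hk₂ : ∀ a b r, k₂ a b r ∈ stdSimplex ℝ Z) [Nonempty U] (w₁ : W₁) (w₂ : W₂) :
    ∑ g : (W₁ → A) × (W₂ → B) × (U → R × Q), bookLaw P₁ P₂ PR PQ g * ∑ o,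
      outcomeLaw k₁ k₂ (fun v => selProb fun u => S v (g.2.2 u).2) (g.1 w₁) (g.2.1 w₂) g.2.2 o *
        ind (∀ u, ¬S o.2.1 (g.2.2 u).2) =
    ∑ v, obsLaw P₁ P₂ k₁ v * (1 - ∑ q, PQ q * ind (S v q)) ^ Fintype.card U := by
  -- The quantization words are independent of each other and of the observation `v`, and each is
  -- incompatible with probability `1 - ∑ q, PQ q * ind (S v q)`.
  have hpow : ∀ v, ∑ c : U → R × Q, seqLaw (fun _ k => PR k.1 * PQ k.2) c *
      ind (∀ u, ¬S v (c u).2) = (1 - ∑ q, PQ q * ind (S v q)) ^ Fintype.card U := fun v => by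
    simp only [ind_forall, seqLaw, ← Finset.prod_mul_distrib]
    rw [sum_prod_apply fun (_ : U) (k : R × Q) => PR k.1 * PQ k.2 * ind (¬S v k.2)]
    rw [Finset.prod_const, Finset.card_univ]
    congr 1
    simp only [Fintype.sum_prod_type, mul_assoc, ← Finset.mul_sum]
    rw [← Finset.sum_mul, hR.2, one_mul]
    simp only [ind_not, mul_sub, Finset.sum_sub_distrib, mul_one, hQ.2]
  rw [sum_bookLaw_apply h₁ h₂ w₁ w₂ fun a b c => ∑ o,
      outcomeLaw k₁ k₂ (fun v => selProb fun u => S v (c u).2) a b c o *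
        ind (∀ u, ¬S o.2.1 (c u).2), sum_obsLaw_mul]
  refine Finset.sum_congr rfl fun a _ => ?_
  congr 1
  refine Finset.sum_congr rfl fun b _ => ?_
  congr 1
  simp only [← hpow]
  have : ∀ c : U → R × Q, ∑ o, outcomeLaw k₁ k₂ (fun v => selProb fun u => S v (c u).2) a b c o *
      ind (∀ u, ¬S o.2.1 (c u).2) = ∑ y, ∑ v, k₁ a b y v * ind (∀ u, ¬S v (c u).2) := fun c => by
    rw [sum_outcomeLaw_mul _ a b c fun _ v _ _ => ind (∀ u, ¬S v (c u).2)]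
    simp only [← Finset.sum_mul, (hk₂ _ _ _).2, sum_selProb, one_mul]
  simp only [this, Finset.mul_sum]
  rw [Finset.sum_comm]
  refine Finset.sum_congr rfl fun y _ => ?_
  rw [Finset.sum_comm]
  refine Finset.sum_congr rfl fun v _ => Finset.sum_congr rfl fun c _ => by ring

/-- The relay finds a compatible index, and the words sent fail the destination's test. -/
theorem sum_test_fails_le (h₁ : P₁ ∈ stdSimplex ℝ A) (h₂ : P₂ ∈ stdSimplex ℝ B)
    (hR : PR ∈ stdSimplex ℝ R) (hQ : PQ ∈ stdSimplex ℝ Q)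
    (hk₁ : ∀ a b, ∑ y, ∑ v, k₁ a b y v = 1) [Nonempty U] {τ : ℝ} (hτ₀ : 0 ≤ τ)
    (hτ : ∀ v q, S v q → ∑ a, P₁ a * ∑ b, P₂ b * ∑ y, k₁ a b y v * ∑ r, PR r * ∑ z, k₂ a b r z *
      ind (¬T a b (r, q) y z) ≤ τ * obsLaw P₁ P₂ k₁ v)
    (hobs : ∀ v, 0 ≤ obsLaw P₁ P₂ k₁ v) (w₁ : W₁) (w₂ : W₂) :
    ∑ g : (W₁ → A) × (W₂ → B) × (U → R × Q), bookLaw P₁ P₂ PR PQ g * ∑ o,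
      outcomeLaw k₁ k₂ (fun v => selProb fun u => S v (g.2.2 u).2) (g.1 w₁) (g.2.1 w₂) g.2.2 o *
        ind (S o.2.1 (g.2.2 o.2.2.1).2 ∧
          ¬T (g.1 w₁) (g.2.1 w₂) (g.2.2 o.2.2.1) o.1 o.2.2.2) ≤ τ := by
  -- `G v q a b` is the weight of observing `v` and then failing the test with quantization word
  -- `q`, when the relay word is a fresh draw from `PR`.
  set G : V → Q → A → B → ℝ := fun v q a b => ∑ y, k₁ a b y v * ∑ r, PR r * ∑ z, k₂ a b r z *
      ind (¬T a b (r, q) y z) with hG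
  set PU : (U → R × Q) → ℝ := seqLaw fun _ k => PR k.1 * PQ k.2 with hPU
  have hPUm : PU ∈ stdSimplex ℝ (U → R × Q) := seqLaw_mem fun _ => mul_mem_stdSimplex_prod hR hQ
  have hredraw : ∀ a b, ∑ c, PU c * ∑ o, outcomeLaw k₁ k₂ (fun v => selProb fun u => S v (c u).2)
      a b c o * ind (S o.2.1 (c o.2.2.1).2 ∧ ¬T a b (c o.2.2.1) o.1 o.2.2.2) =
      ∑ c, PU c * ∑ v, ∑ u, selProb (fun u => S v (c u).2) u * ind (S v (c u).2) *
        G v (c u).2 a b := by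
    intro a b
    have h3 : ∀ c : U → R × Q, ∑ o, outcomeLaw k₁ k₂ (fun v => selProb fun u => S v (c u).2)
      a b c o * ind (S o.2.1 (c o.2.2.1).2 ∧ ¬T a b (c o.2.2.1) o.1 o.2.2.2) =
      ∑ u, ∑ v, selProb (fun u => S v (c u).2) u * ind (S v (c u).2) * ∑ y, k₁ a b y v *
        ∑ z, k₂ a b (c u).1 z * ind (¬T a b (c u) y z) := fun c => by
      rw [sum_outcomeLaw_mul _ a b c fun y v u z => ind (S v (c u).2 ∧ ¬T a b (c u) y z)]
      rw [Finset.sum_comm, Finset.sum_comm (s := (Finset.univ : Finset U))]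
      refine Finset.sum_congr rfl fun v _ => ?_
      simp only [Finset.mul_sum, ind_and]
      rw [Finset.sum_comm]
      refine Finset.sum_congr rfl fun u _ => Finset.sum_congr rfl fun y _ =>
        Finset.sum_congr rfl fun z _ => by ring
    simp only [h3]
    have h4 : ∀ F : (U → R × Q) → U → ℝ, ∑ c, PU c * ∑ u, F c u = ∑ u, ∑ c, PU c * F c u :=
      fun F => by
        simp only [Finset.mul_sum]
        rw [Finset.sum_comm]
    rw [h4]
    conv_rhs =>
      enter [2, c]
      rw [Finset.sum_comm]
    rw [h4]
    refine Finset.sum_congr rfl fun u _ => ?_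
    -- The choice of `u` depends on the relay codebook through its quantization words only, so the
    -- relay word of `u` may be redrawn even though `u` was selected.
    rw [resampling_relay hR hQ u]
    refine Finset.sum_congr rfl fun c _ => ?_
    congr 1
    have h5 : ∀ r t, (Function.update c u (r, (c u).2) t).2 = (c t).2 := fun r t => by
      by_cases h : t = u
      · subst h; simp
      · simp [h]
    simp only [h5, Function.update_self, hG, Finset.mul_sum]
    rw [Finset.sum_comm]
    refine Finset.sum_congr rfl fun v _ => ?_
    rw [Finset.sum_comm]
    refine Finset.sum_congr rfl fun y _ => Finset.sum_congr rfl fun r _ =>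
      Finset.sum_congr rfl fun z _ => by ring
  rw [sum_bookLaw_apply h₁ h₂ w₁ w₂ fun a b c => ∑ o,
      outcomeLaw k₁ k₂ (fun v => selProb fun u => S v (c u).2) a b c o *
        ind (S o.2.1 (c o.2.2.1).2 ∧ ¬T a b (c o.2.2.1) o.1 o.2.2.2)]
  simp only [← hPU, hredraw]
  -- The selection probability does not involve the source words. Averaging over these first
  -- produces the left side of `hτ`, for each `v` and each selected quantization word.
  have hswap : ∑ a, P₁ a * ∑ b, P₂ b * ∑ c, PU c * ∑ v, ∑ u, selProb (fun u => S v (c u).2) u *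
        ind (S v (c u).2) * G v (c u).2 a b =
      ∑ c, PU c * ∑ v, ∑ u, selProb (fun u => S v (c u).2) u * (ind (S v (c u).2) *
        ∑ a, P₁ a * ∑ b, P₂ b * G v (c u).2 a b) := by
    simp only [Finset.mul_sum]
    have hc : ∀ f : A → B → (U → R × Q) → V → U → ℝ,
        ∑ a, ∑ b, ∑ c, ∑ v, ∑ u, f a b c v u = ∑ c, ∑ v, ∑ u, ∑ a, ∑ b, f a b c v u := fun f => by
      have h6 : ∀ t : A → B → (U → R × Q) × V × U → ℝ,
          ∑ a, ∑ b, ∑ i, t a b i = ∑ i, ∑ a, ∑ b, t a b i := fun t =>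
        (Finset.sum_congr rfl fun a _ => Finset.sum_comm).trans Finset.sum_comm
      have := h6 fun a b i => f a b i.1 i.2.1 i.2.2
      simpa only [Fintype.sum_prod_type] using this
    rw [hc]
    refine Finset.sum_congr rfl fun c _ => Finset.sum_congr rfl fun v _ =>
      Finset.sum_congr rfl fun u _ => Finset.sum_congr rfl fun a _ =>
      Finset.sum_congr rfl fun b _ => by ring
  rw [hswap]
  have hmass : ∑ v, obsLaw P₁ P₂ k₁ v = 1 := by
    have := sum_obsLaw_mul (P₁ := P₁) (P₂ := P₂) (k₁ := k₁) fun _ => 1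
    simpa only [mul_one, hk₁, h₁.2, h₂.2] using this
  calc _ ≤ ∑ c, PU c * ∑ v, ∑ u, selProb (fun u => S v (c u).2) u * (τ * obsLaw P₁ P₂ k₁ v) := by
        refine Finset.sum_le_sum fun c _ => mul_le_mul_of_nonneg_left ?_ (hPUm.1 c)
        refine Finset.sum_le_sum fun v _ => Finset.sum_le_sum fun u _ =>
          mul_le_mul_of_nonneg_left ?_ (selProb_nonneg _ _)
        by_cases h : S v (c u).2
        · rw [ind_of h, one_mul]
          exact hτ v _ h
        · rw [ind_of_not h, zero_mul]
          exact mul_nonneg hτ₀ (hobs v)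
    _ = τ := by
        simp only [← Finset.sum_mul, sum_selProb, one_mul, ← Finset.mul_sum, hmass, hPUm.2, mul_one]

variable [Nonempty U] {w₁ w₁' : W₁} {w₂ w₂' : W₂} {K : Type*} [Fintype K] {p : K → ℝ}
  {σ : K → (W₁ → A) × (W₂ → B) × (U → R × Q) → (W₁ → A) × (W₂ → B) × (U → R × Q)} {κ : ℝ}

/-- Words other than those sent pass the destination's test with the index of the relay. -/
theorem sum_wrong_words_le (h₁ : P₁ ∈ stdSimplex ℝ A) (h₂ : P₂ ∈ stdSimplex ℝ B)
    (hR : PR ∈ stdSimplex ℝ R) (hQ : PQ ∈ stdSimplex ℝ Q)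
    (hk₁ : ∀ a b, ∑ y, ∑ v, k₁ a b y v = 1) (hk₁₀ : ∀ a b y v, 0 ≤ k₁ a b y v)
    (hk₂ : ∀ a b r, k₂ a b r ∈ stdSimplex ℝ Z) (hσ : Resampling (bookLaw P₁ P₂ PR PQ) p σ)
    (hσ₁ : ∀ k g, (σ k g).1 w₁ = g.1 w₁) (hσ₂ : ∀ k g, (σ k g).2.1 w₂ = g.2.1 w₂)
    (hσ₃ : ∀ k g, (σ k g).2.2 = g.2.2) (hκ₀ : 0 ≤ κ)
    (hκ : ∀ g u y z, ∑ k, p k *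
      ind (T ((σ k g).1 w₁') ((σ k g).2.1 w₂') ((σ k g).2.2 u) y z) ≤ κ) :
    ∑ g : (W₁ → A) × (W₂ → B) × (U → R × Q), bookLaw P₁ P₂ PR PQ g * ∑ o,
      outcomeLaw k₁ k₂ (fun v => selProb fun u => S v (g.2.2 u).2) (g.1 w₁) (g.2.1 w₂) g.2.2 o *
        ind (T (g.1 w₁') (g.2.1 w₂') (g.2.2 o.2.2.1) o.1 o.2.2.2) ≤ κ := by
  refine hσ.sum_le (bookLaw_mem h₁ h₂ hR hQ)
    (μ := fun g o => outcomeLaw k₁ k₂ (fun v => selProb fun u => S v (g.2.2 u).2)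
      (g.1 w₁) (g.2.1 w₂) g.2.2 o)
    (H := fun g o => ind (T (g.1 w₁') (g.2.1 w₂') (g.2.2 o.2.2.1) o.1 o.2.2.2))
    (fun g o => outcomeLaw_nonneg hk₁₀ hk₂ (fun _ _ => selProb_nonneg _ _) _ _ _ _)
    (fun g => sum_outcomeLaw_le_one hk₁ hk₁₀ hk₂ (fun v => (sum_selProb _).le) _ _ _)
    (fun k g => ?_) hκ₀ fun g o => hκ g _ _ _
  simp only [hσ₁, hσ₂, hσ₃]

/-- Words other than those sent pass the destination's test with an index other than that of the
relay. -/
theorem sum_wrong_index_le (h₁ : P₁ ∈ stdSimplex ℝ A) (h₂ : P₂ ∈ stdSimplex ℝ B)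
    (hR : PR ∈ stdSimplex ℝ R) (hQ : PQ ∈ stdSimplex ℝ Q)
    (hk₁ : ∀ a b, ∑ y, ∑ v, k₁ a b y v = 1) (hk₁₀ : ∀ a b y v, 0 ≤ k₁ a b y v)
    (hk₂ : ∀ a b r, k₂ a b r ∈ stdSimplex ℝ Z) (hσ : Resampling (bookLaw P₁ P₂ PR PQ) p σ) (u' : U)
    (hσ₁ : ∀ k g, (σ k g).1 w₁ = g.1 w₁) (hσ₂ : ∀ k g, (σ k g).2.1 w₂ = g.2.1 w₂)
    (hσ₃ : ∀ k g, ∀ u ≠ u', (σ k g).2.2 u = g.2.2 u) (hκ₀ : 0 ≤ κ)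
    (hκ : ∀ g y z, ∑ k, p k *
      ind (T ((σ k g).1 w₁') ((σ k g).2.1 w₂') ((σ k g).2.2 u') y z) ≤ κ) :
    ∑ g : (W₁ → A) × (W₂ → B) × (U → R × Q), bookLaw P₁ P₂ PR PQ g * ∑ o,
      outcomeLaw k₁ k₂ (fun v => selProb fun u => S v (g.2.2 u).2) (g.1 w₁) (g.2.1 w₂) g.2.2 o *
        ind (o.2.2.1 ≠ u' ∧ T (g.1 w₁') (g.2.1 w₂') (g.2.2 u') o.1 o.2.2.2) ≤ κ := by
  -- The comparison rule never considers `u'` and is cut off at `u'`. By `selProb_le` it dominates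
  -- the true rule on `u ≠ u'`, and it does not depend on the words of `u'`, which can therefore be
  -- redrawn.
  set sel : (U → R × Q) → V → U → ℝ := fun c v u =>
    ind (u ≠ u') * selProb (fun t => S v (c t).2 ∧ t ≠ u') u with hsel
  have hsel₀ : ∀ c v u, 0 ≤ sel c v u := fun c v u => mul_nonneg (ind_nonneg _) (selProb_nonneg _ _)
  calc _ ≤ ∑ g : (W₁ → A) × (W₂ → B) × (U → R × Q), bookLaw P₁ P₂ PR PQ g * ∑ o,
      outcomeLaw k₁ k₂ (sel g.2.2) (g.1 w₁) (g.2.1 w₂) g.2.2 o *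
        ind (T (g.1 w₁') (g.2.1 w₂') (g.2.2 u') o.1 o.2.2.2) := by
        refine Finset.sum_le_sum fun g _ => mul_le_mul_of_nonneg_left ?_
          ((bookLaw_mem h₁ h₂ hR hQ).1 g)
        refine Finset.sum_le_sum fun o _ => ?_
        rw [ind_and, ← mul_assoc]
        refine mul_le_mul_of_nonneg_right ?_ (ind_nonneg _)
        by_cases h : o.2.2.1 = u'
        · rw [ind_of_not (not_not.2 h), mul_zero]
          exact outcomeLaw_nonneg hk₁₀ hk₂ (hsel₀ _) _ _ _ _
        · rw [ind_of h, mul_one]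
          unfold outcomeLaw
          refine mul_le_mul_of_nonneg_left (mul_le_mul_of_nonneg_right ?_ ((hk₂ _ _ _).1 _))
            (hk₁₀ _ _ _ _)
          simp only [hsel, ind_of h, one_mul]
          exact selProb_le h
    _ ≤ κ := by
        refine hσ.sum_le (bookLaw_mem h₁ h₂ hR hQ)
          (μ := fun g o => outcomeLaw k₁ k₂ (sel g.2.2) (g.1 w₁) (g.2.1 w₂) g.2.2 o)
          (H := fun g o => ind (T (g.1 w₁') (g.2.1 w₂') (g.2.2 u') o.1 o.2.2.2))
          (fun g o => outcomeLaw_nonneg hk₁₀ hk₂ (hsel₀ _) _ _ _ _)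
          (fun g => sum_outcomeLaw_le_one hk₁ hk₁₀ hk₂ (fun v => ?_) _ _ _)
          (fun k g => ?_) hκ₀ fun g o => hκ g _ _
        · rw [← sum_selProb fun t => S v (g.2.2 t).2 ∧ t ≠ u']
          exact Finset.sum_le_sum fun u _ =>
            mul_le_of_le_one_left (selProb_nonneg _ _) (ind_le_one _)
        · funext o
          have hs : ∀ v, (fun t => S v ((σ k g).2.2 t).2 ∧ t ≠ u') =
              fun t => S v (g.2.2 t).2 ∧ t ≠ u' := fun v => by
            funext t
            by_cases h : t = u'
            · simp [h]
            · rw [hσ₃ k g t h]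
          simp only [outcomeLaw, hσ₁, hσ₂, hsel, hs]
          by_cases h : o.2.2.1 = u'
          · simp [ind_of_not (not_not.2 h)]
          · rw [hσ₃ k g _ h]

/-- The random coding bound on the probability that the words sent are not the only ones that pass
the destination's test. -/
theorem sum_error_le (h₁ : P₁ ∈ stdSimplex ℝ A) (h₂ : P₂ ∈ stdSimplex ℝ B)
    (hR : PR ∈ stdSimplex ℝ R) (hQ : PQ ∈ stdSimplex ℝ Q)
    (hk₁ : ∀ a b, ∑ y, ∑ v, k₁ a b y v = 1) (hk₁₀ : ∀ a b y v, 0 ≤ k₁ a b y v)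
    (hk₂ : ∀ a b r, k₂ a b r ∈ stdSimplex ℝ Z) {α τ κ₁ κ₂ κ₁₂ κ₁U κ₂U κ₁₂U : ℝ}
    (hα : ∑ v, obsLaw P₁ P₂ k₁ v * (1 - ∑ q, PQ q * ind (S v q)) ^ Fintype.card U ≤ α)
    (hτ₀ : 0 ≤ τ)
    (hτ : ∀ v q, S v q → ∑ a, P₁ a * ∑ b, P₂ b * ∑ y, k₁ a b y v * ∑ r, PR r * ∑ z, k₂ a b r z *
      ind (¬T a b (r, q) y z) ≤ τ * obsLaw P₁ P₂ k₁ v)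
    (hκ₁₀ : 0 ≤ κ₁) (hκ₂₀ : 0 ≤ κ₂) (hκ₁₂₀ : 0 ≤ κ₁₂)
    (hκ₁U₀ : 0 ≤ κ₁U) (hκ₂U₀ : 0 ≤ κ₂U) (hκ₁₂U₀ : 0 ≤ κ₁₂U)
    (hκ₁ : ∀ b k y z, ∑ a, P₁ a * ind (T a b k y z) ≤ κ₁)
    (hκ₂ : ∀ a k y z, ∑ b, P₂ b * ind (T a b k y z) ≤ κ₂)
    (hκ₁₂ : ∀ k y z, ∑ c : A × B, P₁ c.1 * P₂ c.2 * ind (T c.1 c.2 k y z) ≤ κ₁₂)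
    (hκ₁U : ∀ b y z, ∑ c : A × R × Q, P₁ c.1 * (PR c.2.1 * PQ c.2.2) *
      ind (T c.1 b c.2 y z) ≤ κ₁U)
    (hκ₂U : ∀ a y z, ∑ c : B × R × Q, P₂ c.1 * (PR c.2.1 * PQ c.2.2) *
      ind (T a c.1 c.2 y z) ≤ κ₂U)
    (hκ₁₂U : ∀ y z, ∑ c : (A × B) × R × Q, P₁ c.1.1 * P₂ c.1.2 * (PR c.2.1 * PQ c.2.2) *
      ind (T c.1.1 c.1.2 c.2 y z) ≤ κ₁₂U)
    (w₁ : W₁) (w₂ : W₂) :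
    ∑ g : (W₁ → A) × (W₂ → B) × (U → R × Q), bookLaw P₁ P₂ PR PQ g * ∑ o,
      outcomeLaw k₁ k₂ (fun v => selProb fun u => S v (g.2.2 u).2) (g.1 w₁) (g.2.1 w₂) g.2.2 o *
        ind (¬((∃ u, T (g.1 w₁) (g.2.1 w₂) (g.2.2 u) o.1 o.2.2.2) ∧
          ∀ w : W₁ × W₂, (∃ u, T (g.1 w.1) (g.2.1 w.2) (g.2.2 u) o.1 o.2.2.2) → w = (w₁, w₂))) ≤
    α + τ +
      (Fintype.card W₁ * κ₁ + Fintype.card W₁ * Fintype.card U * κ₁U) +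
      (Fintype.card W₂ * κ₂ + Fintype.card W₂ * Fintype.card U * κ₂U) +
      (Fintype.card W₁ * Fintype.card W₂ * κ₁₂ +
        Fintype.card W₁ * Fintype.card W₂ * Fintype.card U * κ₁₂U) := by
  set μ : (W₁ → A) × (W₂ → B) × (U → R × Q) → Y × V × U × Z → ℝ := fun g o =>
    outcomeLaw k₁ k₂ (fun v => selProb fun u => S v (g.2.2 u).2) (g.1 w₁) (g.2.1 w₂) g.2.2 o with hμ
  set M : ((W₁ → A) × (W₂ → B) × (U → R × Q) → Y × V × U × Z → ℝ) → ℝ := fun F =>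
    ∑ g, bookLaw P₁ P₂ PR PQ g * ∑ o, μ g o * F g o with hM
  have hμ₀ : ∀ g o, 0 ≤ μ g o := fun g o =>
    outcomeLaw_nonneg hk₁₀ hk₂ (fun _ _ => selProb_nonneg _ _) _ _ _ _
  have hobs : ∀ v, 0 ≤ obsLaw P₁ P₂ k₁ v := fun v =>
    Finset.sum_nonneg fun a _ => mul_nonneg (h₁.1 a) <| Finset.sum_nonneg fun b _ =>
      mul_nonneg (h₂.1 b) <| Finset.sum_nonneg fun y _ => hk₁₀ a b y v
  have hadd : ∀ F G, M (fun g o => F g o + G g o) = M F + M G := fun F G => by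
    simp only [hM, mul_add, Finset.sum_add_distrib]
  have hmono : ∀ {F G}, (∀ g o, μ g o ≠ 0 → F g o ≤ G g o) → M F ≤ M G := fun {F G} h => by
    refine Finset.sum_le_sum fun g _ => mul_le_mul_of_nonneg_left ?_
      ((bookLaw_mem h₁ h₂ hR hQ).1 g)
    refine Finset.sum_le_sum fun o _ => ?_
    by_cases h0 : μ g o = 0
    · simp [h0]
    · exact mul_le_mul_of_nonneg_left (h g o h0) (hμ₀ g o)
  -- The union bounds run over all messages, including the ones sent. The condition `P` inside the
  -- indicator makes the terms of the latter vanish, and it is available when a competitor is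
  -- redrawn.
  have hand : ∀ {P : Prop} {F : (W₁ → A) × (W₂ → B) × (U → R × Q) → Y × V × U × Z → Prop} {κ : ℝ},
      0 ≤ κ → (P → M (fun g o => ind (F g o)) ≤ κ) → M (fun g o => ind (P ∧ F g o)) ≤ κ :=
    fun {P F κ} hκ h => by
      by_cases hP : P
      · simpa only [hP, true_and] using h hP
      · simpa only [hM, hP, false_and, ind_of_not not_false, mul_zero, Finset.sum_const_zero]
          using hκ
  set E₁ : (W₁ → A) × (W₂ → B) × (U → R × Q) → Y × V × U × Z → ℝ := fun g o =>
    ind (∀ u, ¬S o.2.1 (g.2.2 u).2)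
  set E₂ : (W₁ → A) × (W₂ → B) × (U → R × Q) → Y × V × U × Z → ℝ := fun g o =>
    ind (S o.2.1 (g.2.2 o.2.2.1).2 ∧ ¬T (g.1 w₁) (g.2.1 w₂) (g.2.2 o.2.2.1) o.1 o.2.2.2)
  set F₁ : W₁ → (W₁ → A) × (W₂ → B) × (U → R × Q) → Y × V × U × Z → ℝ := fun w g o =>
    ind (w ≠ w₁ ∧ T (g.1 w) (g.2.1 w₂) (g.2.2 o.2.2.1) o.1 o.2.2.2)
  set G₁ : W₁ × U → (W₁ → A) × (W₂ → B) × (U → R × Q) → Y × V × U × Z → ℝ := fun w g o =>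
    ind (w.1 ≠ w₁ ∧ o.2.2.1 ≠ w.2 ∧ T (g.1 w.1) (g.2.1 w₂) (g.2.2 w.2) o.1 o.2.2.2)
  set F₂ : W₂ → (W₁ → A) × (W₂ → B) × (U → R × Q) → Y × V × U × Z → ℝ := fun w g o =>
    ind (w ≠ w₂ ∧ T (g.1 w₁) (g.2.1 w) (g.2.2 o.2.2.1) o.1 o.2.2.2)
  set G₂ : W₂ × U → (W₁ → A) × (W₂ → B) × (U → R × Q) → Y × V × U × Z → ℝ := fun w g o =>
    ind (w.1 ≠ w₂ ∧ o.2.2.1 ≠ w.2 ∧ T (g.1 w₁) (g.2.1 w.1) (g.2.2 w.2) o.1 o.2.2.2)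
  set F₁₂ : W₁ × W₂ → (W₁ → A) × (W₂ → B) × (U → R × Q) → Y × V × U × Z → ℝ := fun w g o =>
    ind ((w.1 ≠ w₁ ∧ w.2 ≠ w₂) ∧ T (g.1 w.1) (g.2.1 w.2) (g.2.2 o.2.2.1) o.1 o.2.2.2)
  set G₁₂ : (W₁ × W₂) × U → (W₁ → A) × (W₂ → B) × (U → R × Q) → Y × V × U × Z → ℝ := fun w g o =>
    ind ((w.1.1 ≠ w₁ ∧ w.1.2 ≠ w₂) ∧
      o.2.2.1 ≠ w.2 ∧ T (g.1 w.1.1) (g.2.1 w.1.2) (g.2.2 w.2) o.1 o.2.2.2)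
  have hE₁ : M E₁ ≤ α := (sum_relay_fails_le h₁ h₂ hR hQ hk₂ w₁ w₂).le.trans hα
  have hE₂ : M E₂ ≤ τ := sum_test_fails_le h₁ h₂ hR hQ hk₁ hτ₀ hτ hobs w₁ w₂
  have hF₁ : M (fun g o => ∑ w, F₁ w g o) ≤ Fintype.card W₁ * κ₁ :=
    sum_mul_sum_mul_sum_le fun w => hand hκ₁₀ fun hw =>
      sum_wrong_words_le h₁ h₂ hR hQ hk₁ hk₁₀ hk₂ (resampling_update₁ h₁ w)
        (fun k g => Function.update_of_ne hw.symm _ _) (fun _ _ => rfl) (fun _ _ => rfl) hκ₁₀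
        fun g u y z => by simpa only [Function.update_self] using hκ₁ _ _ y z
  have hF₂ : M (fun g o => ∑ w, F₂ w g o) ≤ Fintype.card W₂ * κ₂ :=
    sum_mul_sum_mul_sum_le fun w => hand hκ₂₀ fun hw =>
      sum_wrong_words_le h₁ h₂ hR hQ hk₁ hk₁₀ hk₂ (resampling_update₂ h₂ w)
        (fun _ _ => rfl) (fun k g => Function.update_of_ne hw.symm _ _) (fun _ _ => rfl) hκ₂₀
        fun g u y z => by simpa only [Function.update_self] using hκ₂ _ _ y z
  have hF₁₂ : M (fun g o => ∑ w, F₁₂ w g o) ≤ Fintype.card (W₁ × W₂) * κ₁₂ :=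
    sum_mul_sum_mul_sum_le fun w => hand hκ₁₂₀ fun hw =>
      sum_wrong_words_le h₁ h₂ hR hQ hk₁ hk₁₀ hk₂
        ((resampling_update₁ h₁ w.1).comp (resampling_update₂ h₂ w.2))
        (fun k g => Function.update_of_ne hw.1.symm _ _)
        (fun k g => Function.update_of_ne hw.2.symm _ _) (fun _ _ => rfl) hκ₁₂₀
        fun g u y z => by simpa only [Function.update_self] using hκ₁₂ _ y z
  have hG₁ : M (fun g o => ∑ w, G₁ w g o) ≤ Fintype.card (W₁ × U) * κ₁U :=
    sum_mul_sum_mul_sum_le fun w => hand hκ₁U₀ fun hw =>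
      sum_wrong_index_le h₁ h₂ hR hQ hk₁ hk₁₀ hk₂
        ((resampling_update₁ h₁ w.1).comp (resampling_update₃ hR hQ w.2)) w.2
        (fun k g => Function.update_of_ne hw.symm _ _) (fun _ _ => rfl)
        (fun k g u hu => Function.update_of_ne hu _ _) hκ₁U₀
        fun g y z => by simpa only [Function.update_self] using hκ₁U _ y z
  have hG₂ : M (fun g o => ∑ w, G₂ w g o) ≤ Fintype.card (W₂ × U) * κ₂U :=
    sum_mul_sum_mul_sum_le fun w => hand hκ₂U₀ fun hw =>
      sum_wrong_index_le h₁ h₂ hR hQ hk₁ hk₁₀ hk₂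
        ((resampling_update₂ h₂ w.1).comp (resampling_update₃ hR hQ w.2)) w.2
        (fun _ _ => rfl) (fun k g => Function.update_of_ne hw.symm _ _)
        (fun k g u hu => Function.update_of_ne hu _ _) hκ₂U₀
        fun g y z => by simpa only [Function.update_self] using hκ₂U _ y z
  have hG₁₂ : M (fun g o => ∑ w, G₁₂ w g o) ≤ Fintype.card ((W₁ × W₂) × U) * κ₁₂U :=
    sum_mul_sum_mul_sum_le fun w => hand hκ₁₂U₀ fun hw =>
      sum_wrong_index_le h₁ h₂ hR hQ hk₁ hk₁₀ hk₂
        (((resampling_update₁ h₁ w.1.1).comp (resampling_update₂ h₂ w.1.2)).comp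
          (resampling_update₃ hR hQ w.2)) w.2
        (fun k g => Function.update_of_ne hw.1.symm _ _)
        (fun k g => Function.update_of_ne hw.2.symm _ _)
        (fun k g u hu => Function.update_of_ne hu _ _) hκ₁₂U₀
        fun g y z => by simpa only [Function.update_self] using hκ₁₂U y z
  have hunion : ∀ g o, μ g o ≠ 0 →
      ind (¬((∃ u, T (g.1 w₁) (g.2.1 w₂) (g.2.2 u) o.1 o.2.2.2) ∧
          ∀ w : W₁ × W₂, (∃ u, T (g.1 w.1) (g.2.1 w.2) (g.2.2 u) o.1 o.2.2.2) → w = (w₁, w₂))) ≤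
        E₁ g o + E₂ g o + (∑ w, F₁ w g o + ∑ w, G₁ w g o) + (∑ w, F₂ w g o + ∑ w, G₂ w g o) +
          (∑ w, F₁₂ w g o + ∑ w, G₁₂ w g o) := by
    intro g o ho
    -- Outcomes of weight zero are excluded, so the chosen index is compatible as soon as some index
    -- is.
    have hsel : (∃ u, S o.2.1 (g.2.2 u).2) → S o.2.1 (g.2.2 o.2.2.1).2 := fun ⟨u, hu⟩ => by
      by_contra hne
      apply ho
      simp only [hμ, outcomeLaw]
      rw [selProb_eq_zero (s := fun u => S o.2.1 (g.2.2 u).2) hu hne, zero_mul, mul_zero]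
    have hle : ∀ {P Q : Prop} {x y : ℝ}, ind P ≤ x → ind Q ≤ y → ind (P ∨ Q) ≤ x + y :=
      fun hx hy => (ind_or_le _ _).trans (add_le_add hx hy)
    refine le_trans (ind_mono fun h => ?_) (hle (hle (hle (hle le_rfl le_rfl)
      (hle (ind_exists_le _) (ind_exists_le _))) (hle (ind_exists_le _) (ind_exists_le _)))
      (hle (ind_exists_le _) (ind_exists_le _)))
    by_cases hS : ∃ u, S o.2.1 (g.2.2 u).2
    · by_cases hT : T (g.1 w₁) (g.2.1 w₂) (g.2.2 o.2.2.1) o.1 o.2.2.2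
      · have : ∃ w : W₁ × W₂, (∃ u, T (g.1 w.1) (g.2.1 w.2) (g.2.2 u) o.1 o.2.2.2) ∧
            w ≠ (w₁, w₂) := by
          by_contra hne
          push Not at hne
          exact h ⟨⟨_, hT⟩, hne⟩
        -- The competitor is sorted by the components in which it differs from the pair sent, and by
        -- whether its witness `u` is the relay's index.
        obtain ⟨⟨v₁, v₂⟩, ⟨u, hu⟩, hv⟩ := this
        dsimp only at hu
        by_cases hv₁ : v₁ = w₁
        · subst hv₁
          have hv₂ : v₂ ≠ w₂ := fun h => hv (by rw [h])
          refine Or.inl (Or.inr ?_)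
          by_cases huo : o.2.2.1 = u
          · exact Or.inl ⟨v₂, hv₂, by rwa [huo]⟩
          · exact Or.inr ⟨(v₂, u), hv₂, huo, hu⟩
        · by_cases hv₂ : v₂ = w₂
          · subst hv₂
            refine Or.inl (Or.inl (Or.inr ?_))
            by_cases huo : o.2.2.1 = u
            · exact Or.inl ⟨v₁, hv₁, by rwa [huo]⟩
            · exact Or.inr ⟨(v₁, u), hv₁, huo, hu⟩
          · refine Or.inr ?_
            by_cases huo : o.2.2.1 = u
            · exact Or.inl ⟨(v₁, v₂), ⟨hv₁, hv₂⟩, by rwa [huo]⟩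
            · exact Or.inr ⟨((v₁, v₂), u), ⟨hv₁, hv₂⟩, huo, hu⟩
      · exact Or.inl (Or.inl (Or.inl (Or.inr ⟨hsel hS, hT⟩)))
    · push Not at hS
      exact Or.inl (Or.inl (Or.inl (Or.inl hS)))
  refine (hmono hunion).trans ?_
  simp only [hadd]
  simp only [Fintype.card_prod, Nat.cast_mul] at hF₁₂ hG₁ hG₂ hG₁₂
  exact add_le_add (add_le_add (add_le_add (add_le_add hE₁ hE₂) (add_le_add hF₁ hG₁))
    (add_le_add hF₂ hG₂)) (add_le_add hF₁₂ hG₁₂)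

end OneShot

/-! ### Laws and information measures -/

section Law

variable {Ω A B C : Type*} [Fintype Ω] {p : Ω → ℝ}

theorem law_eq_sum_ind (p : Ω → ℝ) (X : Ω → A) (a : A) :
    law p X a = ∑ ω, p ω * ind (X ω = a) := by
  unfold law ind
  exact Finset.sum_congr rfl fun ω _ => by split_ifs <;> simp

theorem law_nonneg (hp : ∀ ω, 0 ≤ p ω) (X : Ω → A) (a : A) : 0 ≤ law p X a := by
  rw [law_eq_sum_ind]
  exact Finset.sum_nonneg fun ω _ => mul_nonneg (hp ω) (ind_nonneg _)

theorem le_law_apply (hp : ∀ ω, 0 ≤ p ω) (X : Ω → A) (ω : Ω) : p ω ≤ law p X (X ω) := by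
  rw [law_eq_sum_ind]
  refine le_trans (le_of_eq ?_) (Finset.single_le_sum
    (fun ω' _ => mul_nonneg (hp ω') (ind_nonneg (X ω' = X ω))) (Finset.mem_univ ω))
  rw [ind_of rfl, mul_one]

/-- Both sides are the probability of the same event. This is how tuples are reordered and regrouped
below. -/
theorem law_apply_congr (p : Ω → ℝ) {X : Ω → A} {Y : Ω → B} {ω : Ω}
    (h : ∀ ω', X ω' = X ω ↔ Y ω' = Y ω) : law p X (X ω) = law p Y (Y ω) := by
  simp only [law_eq_sum_ind, h]

theorem law_id (p : Ω → ℝ) : law p (fun ω => ω) = p := by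
  funext a
  rw [law_eq_sum_ind, ← ind_sum_eq a p]
  exact Finset.sum_congr rfl fun ω _ => mul_comm _ _

theorem law_apply_of_injective (p : Ω → ℝ) {X : Ω → A} (hX : Function.Injective X) (ω : Ω) :
    law p X (X ω) = p ω := by
  rw [law_apply_congr p (Y := fun ω => ω) fun ω' => hX.eq_iff, law_id]

theorem sum_law_mul [Fintype A] (p : Ω → ℝ) (X : Ω → A) (g : A → ℝ) :
    ∑ a, law p X a * g a = ∑ ω, p ω * g (X ω) := by
  simp only [law_eq_sum_ind, Finset.sum_mul]
  rw [Finset.sum_comm]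
  refine Finset.sum_congr rfl fun ω _ => ?_
  simp only [mul_assoc, ← Finset.mul_sum]
  rw [← ind_sum_eq (X ω) g]
  simp only [eq_comm]

theorem sum_law [Fintype A] (p : Ω → ℝ) (X : Ω → A) : ∑ a, law p X a = ∑ ω, p ω := by
  simpa using sum_law_mul p X fun _ => 1

theorem law_mem [Fintype A] (hp : p ∈ stdSimplex ℝ Ω) (X : Ω → A) :
    law p X ∈ stdSimplex ℝ A :=
  ⟨law_nonneg hp.1 X, (sum_law p X).trans hp.2⟩

/-- Absolute continuity of a law with respect to its marginals, as required by the change of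
measure. -/
theorem law_eq_zero_of_comp (hp : ∀ ω, 0 ≤ p ω) {X : Ω → A} {f : A → B} {a : A}
    (h : law p (fun ω => f (X ω)) (f a) = 0) : law p X a = 0 := by
  refine le_antisymm ?_ (law_nonneg hp X a)
  rw [← h, law_eq_sum_ind, law_eq_sum_ind]
  exact Finset.sum_le_sum fun ω _ => mul_le_mul_of_nonneg_left
    (ind_mono fun h => congrArg f h) (hp ω)

theorem sum_law_equiv [Fintype A] (p : Ω → ℝ) (X : Ω → C) (e : A × B ≃ C) (b : B) :
    ∑ a, law p X (e (a, b)) = law p (fun ω => (e.symm (X ω)).2) b := by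
  simp only [law_eq_sum_ind]
  rw [Finset.sum_comm]
  refine Finset.sum_congr rfl fun ω _ => ?_
  rw [← Finset.mul_sum]
  congr 1
  have : ∀ a, ind (X ω = e (a, b)) = ind (a = (e.symm (X ω)).1) * ind ((e.symm (X ω)).2 = b) :=
    fun a => by
      rw [← ind_and]
      congr 1
      rw [← Equiv.symm_apply_eq, Prod.ext_iff, eq_comm (a := a)]
  simp only [this]
  exact ind_sum_eq (ι := A) _ fun _ => ind ((e.symm (X ω)).2 = b)

variable [Fintype A] [Fintype B] [Fintype C]

theorem mutualInfo_eq_sum (p : Ω → ℝ) (X : Ω → A) (Y : Ω → B) :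
    mutualInfo p X Y = ∑ ω, p ω * Real.logb 2 (law p (fun ω => (X ω, Y ω)) (X ω, Y ω) /
      (law p X (X ω) * law p Y (Y ω))) := by
  rw [← sum_law_mul p (fun ω => (X ω, Y ω)) fun c => Real.logb 2 (law p (fun ω => (X ω, Y ω)) c /
    (law p X c.1 * law p Y c.2)), Fintype.sum_prod_type]
  rfl

theorem condMutualInfo_eq_sum (p : Ω → ℝ) (X : Ω → A) (Y : Ω → B) (Z : Ω → C) :
    condMutualInfo p X Y Z = ∑ ω, p ω * Real.logb 2
      (law p (fun ω => (X ω, Y ω, Z ω)) (X ω, Y ω, Z ω) * law p Z (Z ω) /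
        (law p (fun ω => (X ω, Z ω)) (X ω, Z ω) * law p (fun ω => (Y ω, Z ω)) (Y ω, Z ω))) := by
  rw [← sum_law_mul p (fun ω => (X ω, Y ω, Z ω)) fun c => Real.logb 2
    (law p (fun ω => (X ω, Y ω, Z ω)) c * law p Z c.2.2 /
      (law p (fun ω => (X ω, Z ω)) (c.1, c.2.2) * law p (fun ω => (Y ω, Z ω)) c.2)),
    Fintype.sum_prod_type]
  simp only [Fintype.sum_prod_type]
  rfl

/-- Termwise `log t ≥ 1 - 1/t` gives the lower bound `(p(x, y) - p(x) p(y)) / log 2`, whose sum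
vanishes because both laws have mass `1`. -/
theorem mutualInfo_nonneg (hp : p ∈ stdSimplex ℝ Ω) (X : Ω → A) (Y : Ω → B) :
    0 ≤ mutualInfo p X Y := by
  set q := law p fun ω => (X ω, Y ω) with hq
  have hterm : ∀ a b, (q (a, b) - law p X a * law p Y b) / Real.log 2 ≤
      q (a, b) * Real.logb 2 (q (a, b) / (law p X a * law p Y b)) := fun a b => by
    have hl : 0 < Real.log 2 := Real.log_pos one_lt_two
    have h0 : 0 ≤ q (a, b) := law_nonneg hp.1 _ _
    have hX := law_nonneg hp.1 X a
    have hY := law_nonneg hp.1 Y b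
    unfold Real.logb
    rw [← mul_div_assoc]
    refine div_le_div_of_nonneg_right ?_ hl.le
    rcases h0.eq_or_lt with h | h
    · rw [← h]
      simp only [zero_sub, zero_mul, neg_nonpos]
      positivity
    · have hX' : 0 < law p X a := lt_of_le_of_ne hX fun hz =>
        h.ne' (law_eq_zero_of_comp hp.1 (f := Prod.fst) (a := (a, b)) hz.symm)
      have hY' : 0 < law p Y b := lt_of_le_of_ne hY fun hz =>
        h.ne' (law_eq_zero_of_comp hp.1 (f := Prod.snd) (a := (a, b)) hz.symm)
      have := Real.one_sub_inv_le_log_of_pos (div_pos h (mul_pos hX' hY'))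
      calc _ = q (a, b) * (1 - (q (a, b) / (law p X a * law p Y b))⁻¹) := by field_simp
        _ ≤ _ := mul_le_mul_of_nonneg_left this h.le
  refine le_trans (le_of_eq ?_) (Finset.sum_le_sum fun a _ => Finset.sum_le_sum fun b _ => hterm a b)
  simp only [← Finset.sum_div, Finset.sum_sub_distrib, ← Finset.mul_sum, ← Finset.sum_mul]
  rw [(law_mem hp X).2, (law_mem hp Y).2, ← Fintype.sum_prod_type, (law_mem hp _).2]
  simp

omit [Fintype B] in
theorem divergence_law (p : Ω → ℝ) (X : Ω → C) (e : A × B ≃ C) (r : A → ℝ) :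
    divergence (law p X) e r = ∑ ω, p ω * Real.logb 2 (law p X (X ω) /
      (r (e.symm (X ω)).1 * law p (fun ω => (e.symm (X ω)).2) (e.symm (X ω)).2)) := by
  unfold divergence infoDensity
  rw [sum_law_mul]
  simp only [sum_law_equiv]

omit [Fintype B] [Fintype C] in
theorem divergence_self (p : Ω → ℝ) (e : A × B ≃ Ω) (r : A → ℝ) :
    divergence p e r = ∑ ω, p ω * Real.logb 2 (p ω /
      (r (e.symm ω).1 * law p (fun ω => (e.symm ω).2) (e.symm ω).2)) := by
  have := divergence_law p (fun ω => ω) e r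
  rwa [law_id] at this

/-- Identities between information densities are only needed, and often only true, on the support of
`p`, where all marginals are positive. -/
theorem sum_mul_congr {f g : Ω → ℝ} (hp : ∀ ω, 0 ≤ p ω) (h : ∀ ω, 0 < p ω → f ω = g ω) :
    ∑ ω, p ω * f ω = ∑ ω, p ω * g ω := by
  refine Finset.sum_congr rfl fun ω _ => ?_
  rcases (hp ω).eq_or_lt with h0 | h0
  · rw [← h0, zero_mul, zero_mul]
  · rw [h ω h0]

end Law

/-! ### Marginals of the two single-letter laws -/

section Joint

variable {X₁₁ X₂₁ X₁₂ X₂₂ XR YD1 YR YD2 YQ : Type*}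
  [Fintype X₁₁] [Fintype X₂₁] [Fintype X₁₂] [Fintype X₂₂] [Fintype XR]
  [Fintype YD1] [Fintype YR] [Fintype YD2] [Fintype YQ]
  (ch : Channel X₁₁ X₂₁ X₁₂ X₂₂ XR YD1 YR YD2) (p : Inputs X₁₁ X₂₁ X₁₂ X₂₂ XR YR YQ)

theorem joint1_nonneg (s : Outcome1 X₁₁ X₂₁ YD1 YR YQ) : 0 ≤ joint1 ch p s :=
  mul_nonneg (mul_nonneg (mul_nonneg (p.p11.2.1 _) (p.p21.2.1 _)) ((ch.slot1 _ _).2.1 _))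
    ((p.quant _).2.1 _)

theorem joint2_nonneg (s : Outcome2 X₁₂ X₂₂ XR YD2) : 0 ≤ joint2 ch p s :=
  mul_nonneg (mul_nonneg (mul_nonneg (p.p12.2.1 _) (p.p22.2.1 _)) (p.pR.2.1 _))
    ((ch.slot2 _ _ _).2.1 _)

theorem sum_joint1_mul (F : X₁₁ → X₂₁ → YD1 → YR → ℝ) :
    ∑ s, joint1 ch p s * F s.x11 s.x21 s.yD1 s.yR =
      ∑ a, p.p11 a * ∑ b, p.p21 b * ∑ y, ∑ v, ch.slot1 a b (y, v) * F a b y v := by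
  simp only [joint1, Outcome1.x11, Outcome1.x21, Outcome1.yD1, Outcome1.yR, Outcome1.yQ,
    Fintype.sum_prod_type, mul_right_comm _ (p.quant _ _), ← Finset.mul_sum,
    stdSimplex.sum_eq_one, mul_one]
  simp only [mul_assoc, ← Finset.mul_sum]

theorem sum_joint2_mul (F : X₁₂ → X₂₂ → XR → ℝ) :
    ∑ s, joint2 ch p s * F s.x12 s.x22 s.xR =
      ∑ a, p.p12 a * ∑ b, p.p22 b * ∑ r, p.pR r * F a b r := by
  simp only [joint2, Outcome2.x12, Outcome2.x22, Outcome2.xR, Outcome2.yD2,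
    Fintype.sum_prod_type, mul_right_comm _ (ch.slot2 _ _ _ _), ← Finset.mul_sum,
    stdSimplex.sum_eq_one, mul_one]
  simp only [mul_assoc, ← Finset.mul_sum]

omit [Fintype X₁₁] [Fintype X₂₁] [Fintype X₁₂] [Fintype X₂₂] [Fintype XR] in
theorem sum_slot1 (a : X₁₁) (b : X₂₁) : ∑ y, ∑ v, ch.slot1 a b (y, v) = 1 := by
  rw [← Fintype.sum_prod_type, stdSimplex.sum_eq_one]

theorem sum_joint1_mul_inputs (F : X₁₁ → X₂₁ → ℝ) :
    ∑ s, joint1 ch p s * F s.x11 s.x21 = ∑ a, p.p11 a * ∑ b, p.p21 b * F a b := by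
  rw [sum_joint1_mul ch p fun a b _ _ => F a b]
  simp only [← Finset.sum_mul, sum_slot1, one_mul]

theorem joint1_mem : joint1 ch p ∈ stdSimplex ℝ (Outcome1 X₁₁ X₂₁ YD1 YR YQ) := by
  refine ⟨joint1_nonneg ch p, ?_⟩
  have := sum_joint1_mul_inputs ch p fun _ _ => 1
  simpa only [mul_one, stdSimplex.sum_eq_one] using this

theorem joint2_mem : joint2 ch p ∈ stdSimplex ℝ (Outcome2 X₁₂ X₂₂ XR YD2) := by
  refine ⟨joint2_nonneg ch p, ?_⟩
  have := sum_joint2_mul ch p fun _ _ _ => 1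
  simpa only [mul_one, stdSimplex.sum_eq_one] using this

theorem law_joint1_x11 (a : X₁₁) : law (joint1 ch p) (fun s => s.x11) a = p.p11 a := by
  rw [law_eq_sum_ind, sum_joint1_mul_inputs ch p fun x _ => ind (x = a)]
  simp only [← Finset.sum_mul, stdSimplex.sum_eq_one, one_mul, sum_mul_ind_eq]

theorem law_joint1_x21 (b : X₂₁) : law (joint1 ch p) (fun s => s.x21) b = p.p21 b := by
  rw [law_eq_sum_ind, sum_joint1_mul_inputs ch p fun _ x => ind (x = b)]
  simp only [← Finset.sum_mul, stdSimplex.sum_eq_one, one_mul, sum_mul_ind_eq]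

theorem law_joint1_x11_x21 (a : X₁₁) (b : X₂₁) :
    law (joint1 ch p) (fun s => (s.x11, s.x21)) (a, b) = p.p11 a * p.p21 b := by
  rw [law_eq_sum_ind, sum_joint1_mul_inputs ch p fun x y => ind ((x, y) = (a, b))]
  simp only [Prod.mk.injEq, ind_and, ← mul_assoc, sum_mul_ind_eq]

theorem law_joint2_x12 (a : X₁₂) : law (joint2 ch p) (fun s => s.x12) a = p.p12 a := by
  rw [law_eq_sum_ind, sum_joint2_mul ch p fun x _ _ => ind (x = a)]
  simp only [← Finset.sum_mul, stdSimplex.sum_eq_one, one_mul, sum_mul_ind_eq]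

theorem law_joint2_x22 (b : X₂₂) : law (joint2 ch p) (fun s => s.x22) b = p.p22 b := by
  rw [law_eq_sum_ind, sum_joint2_mul ch p fun _ x _ => ind (x = b)]
  simp only [← Finset.sum_mul, stdSimplex.sum_eq_one, one_mul, sum_mul_ind_eq]

theorem law_joint2_xR (r : XR) : law (joint2 ch p) (fun s => s.xR) r = p.pR r := by
  rw [law_eq_sum_ind, sum_joint2_mul ch p fun _ _ x => ind (x = r)]
  simp only [← Finset.sum_mul, stdSimplex.sum_eq_one, one_mul, sum_mul_ind_eq]

theorem law_joint2_x12_xR (a : X₁₂) (r : XR) :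
    law (joint2 ch p) (fun s => (s.x12, s.xR)) (a, r) = p.p12 a * p.pR r := by
  rw [law_eq_sum_ind, sum_joint2_mul ch p fun x _ z => ind ((x, z) = (a, r))]
  simp only [Prod.mk.injEq, ind_and, ← mul_assoc, sum_mul_ind_eq]
  simp only [← Finset.sum_mul, stdSimplex.sum_eq_one, one_mul, mul_right_comm _ (ind (_ = a)),
    sum_mul_ind_eq, ← mul_assoc, mul_comm (p.pR r)]

theorem law_joint2_x22_xR (b : X₂₂) (r : XR) :
    law (joint2 ch p) (fun s => (s.x22, s.xR)) (b, r) = p.p22 b * p.pR r := by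
  rw [law_eq_sum_ind, sum_joint2_mul ch p fun _ y z => ind ((y, z) = (b, r))]
  simp only [Prod.mk.injEq, ind_and, ← mul_assoc, sum_mul_ind_eq, ← Finset.sum_mul,
    stdSimplex.sum_eq_one, one_mul]

theorem law_joint2_inputs (a : X₁₂) (b : X₂₂) (r : XR) :
    law (joint2 ch p) (fun s => (s.x12, s.x22, s.xR)) (a, b, r) = p.p12 a * p.p22 b * p.pR r := by
  rw [law_eq_sum_ind, sum_joint2_mul ch p fun x y z => ind ((x, y, z) = (a, b, r))]
  simp only [Prod.mk.injEq, ind_and, ← mul_assoc, sum_mul_ind_eq]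

end Joint

/-! ### The exponents of the decoding errors -/

section Split

variable {A B C D : Type*}

/-- Splitting off the second of four letters. -/
def splitSecond : B × A × C × D ≃ A × B × C × D :=
  ⟨fun t => (t.2.1, t.1, t.2.2), fun t => (t.2.1, t.1, t.2.2), fun _ => rfl, fun _ => rfl⟩

/-- Splitting off the first and the second of four letters. -/
def splitFirstSecond : (A × B) × C × D ≃ A × B × C × D :=
  ⟨fun t => (t.1.1, t.1.2, t.2), fun t => ((t.1, t.2.1), t.2.2), fun _ => rfl, fun _ => rfl⟩

/-- Splitting off the first and the third of four letters. -/
def splitFirstThird : (A × C) × B × D ≃ A × B × C × D :=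
  ⟨fun t => (t.1.1, t.2.1, t.1.2, t.2.2), fun t => ((t.1, t.2.2.1), t.2.1, t.2.2.2),
    fun _ => rfl, fun _ => rfl⟩

/-- Splitting off the second and the third of four letters. -/
def splitSecondThird : (B × C) × A × D ≃ A × B × C × D :=
  ⟨fun t => (t.2.1, t.1.1, t.1.2, t.2.2), fun t => ((t.2.1, t.2.2.1), t.1, t.2.2.2),
    fun _ => rfl, fun _ => rfl⟩

/-- Splitting off the first three of four letters. -/
def splitFirstSecondThird : ((A × B) × C) × D ≃ A × B × C × D :=
  ⟨fun t => (t.1.1.1, t.1.1.2, t.1.2, t.2), fun t => (((t.1, t.2.1), t.2.2.1), t.2.2.2),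
    fun _ => rfl, fun _ => rfl⟩

/-- Splitting off the first and the fourth of four letters. -/
def splitFirstFourth : (A × D) × B × C ≃ A × B × C × D :=
  ⟨fun t => (t.1.1, t.2.1, t.2.2, t.1.2), fun t => ((t.1, t.2.2.2), t.2.1, t.2.2.1),
    fun _ => rfl, fun _ => rfl⟩

/-- Splitting off the second and the fourth of four letters. -/
def splitSecondFourth : (B × D) × A × C ≃ A × B × C × D :=
  ⟨fun t => (t.2.1, t.1.1, t.2.2, t.1.2), fun t => ((t.2.1, t.2.2.2), t.1, t.2.2.1),
    fun _ => rfl, fun _ => rfl⟩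

/-- Splitting off all but the third of four letters. -/
def splitFirstSecondFourth : ((A × B) × D) × C ≃ A × B × C × D :=
  ⟨fun t => (t.1.1.1, t.1.1.2, t.2, t.1.2), fun t => (((t.1, t.2.1), t.2.2.2), t.2.2.1),
    fun _ => rfl, fun _ => rfl⟩

end Split

/-! ### Divergences as mutual informations -/

section Exponents

variable {X₁₁ X₂₁ X₁₂ X₂₂ XR YD1 YR YD2 YQ : Type*}
  [Fintype X₁₁] [Fintype X₂₁] [Fintype X₁₂] [Fintype X₂₂] [Fintype XR]
  [Fintype YD1] [Fintype YR] [Fintype YD2] [Fintype YQ]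
  (ch : Channel X₁₁ X₂₁ X₁₂ X₂₂ XR YD1 YR YD2) (p : Inputs X₁₁ X₂₁ X₁₂ X₂₂ XR YR YQ)

/-- The law of the letters that the destination tests in the first slot. -/
def destLaw : X₁₁ × X₂₁ × YD1 × YQ → ℝ :=
  law (joint1 ch p) fun s => (s.x11, s.x21, s.yD1, s.yQ)

/-- The law of the letters of the quantization words. -/
def quantLaw : YQ → ℝ := law (joint1 ch p) fun s => s.yQ

/-- The divergence is `I(X₁₁; X₂₁, Y_D1, Ŷ_R)`. Independence of the inputs, `p(x₁₁, x₂₁) = p(x₁₁)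
p(x₂₁)`, allows `X₂₁` to be moved into the condition. -/
theorem divergence_slot1_first :
    divergence (destLaw ch p) (Equiv.refl _) (fun a => p.p11 a) =
      condMutualInfo (joint1 ch p) (fun s => s.x11) (fun s => (s.yD1, s.yQ)) (fun s => s.x21) := by
  rw [destLaw, divergence_law, condMutualInfo_eq_sum]
  refine sum_mul_congr (joint1_nonneg ch p) fun s hs => congrArg _ ?_
  have hX := hs.trans_le (le_law_apply (joint1_nonneg ch p) (fun s => s.x11) s)
  have hY := hs.trans_le (le_law_apply (joint1_nonneg ch p) (fun s => s.x21) s)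
  have e₁ : law (joint1 ch p) (fun s => (s.x11, (s.yD1, s.yQ), s.x21))
      (s.x11, (s.yD1, s.yQ), s.x21) = law (joint1 ch p) (fun s => (s.x11, s.x21, s.yD1, s.yQ))
      (s.x11, s.x21, s.yD1, s.yQ) :=
    law_apply_congr _ fun s' => by simp only [Prod.mk.injEq]; tauto
  have e₂ : law (joint1 ch p) (fun s => ((s.yD1, s.yQ), s.x21))
      ((s.yD1, s.yQ), s.x21) = law (joint1 ch p) (fun s => (s.x21, s.yD1, s.yQ))
      (s.x21, s.yD1, s.yQ) :=
    law_apply_congr _ fun s' => by simp only [Prod.mk.injEq]; tauto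
  rw [law_joint1_x11] at hX
  rw [law_joint1_x21] at hY
  rw [e₁, e₂, law_joint1_x11_x21, law_joint1_x21]
  simp only [Equiv.refl_symm, Equiv.refl_apply]
  field_simp

theorem divergence_slot1_second :
    divergence (destLaw ch p) splitSecond (fun b => p.p21 b) =
      condMutualInfo (joint1 ch p) (fun s => s.x21) (fun s => (s.yD1, s.yQ))
        (fun s => s.x11) := by
  rw [destLaw, divergence_law, condMutualInfo_eq_sum]
  refine sum_mul_congr (joint1_nonneg ch p) fun s hs => congrArg _ ?_
  have hX := hs.trans_le (le_law_apply (joint1_nonneg ch p) (fun s => s.x11) s)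
  have hY := hs.trans_le (le_law_apply (joint1_nonneg ch p) (fun s => s.x21) s)
  have e₁ : law (joint1 ch p) (fun s => (s.x21, (s.yD1, s.yQ), s.x11)) (s.x21, (s.yD1, s.yQ), s.x11) =
      law (joint1 ch p) (fun s => (s.x11, s.x21, s.yD1, s.yQ)) (s.x11, s.x21, s.yD1, s.yQ) :=
    law_apply_congr _ fun s' => by simp only [Prod.mk.injEq]; tauto
  have e₂ : law (joint1 ch p) (fun s => ((s.yD1, s.yQ), s.x11)) ((s.yD1, s.yQ), s.x11) =
      law (joint1 ch p) (fun s => (s.x11, s.yD1, s.yQ)) (s.x11, s.yD1, s.yQ) :=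
    law_apply_congr _ fun s' => by simp only [Prod.mk.injEq]; tauto
  have e₃ : law (joint1 ch p) (fun s => (s.x21, s.x11)) (s.x21, s.x11) =
      law (joint1 ch p) (fun s => (s.x11, s.x21)) (s.x11, s.x21) :=
    law_apply_congr _ fun s' => by simp only [Prod.mk.injEq]; tauto
  rw [law_joint1_x11] at hX
  rw [law_joint1_x21] at hY
  rw [e₁, e₂, e₃, law_joint1_x11_x21, law_joint1_x11]
  simp only [splitSecond, Equiv.coe_fn_symm_mk]
  field_simp

theorem divergence_slot1_firstSecond :
    divergence (destLaw ch p) splitFirstSecond (fun c => p.p11 c.1 * p.p21 c.2) =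
      mutualInfo (joint1 ch p) (fun s => (s.x11, s.x21)) (fun s => (s.yD1, s.yQ)) := by
  rw [destLaw, divergence_law, mutualInfo_eq_sum]
  refine sum_mul_congr (joint1_nonneg ch p) fun s hs => congrArg _ ?_
  have e₁ : law (joint1 ch p) (fun s => ((s.x11, s.x21), s.yD1, s.yQ)) ((s.x11, s.x21), s.yD1, s.yQ) =
      law (joint1 ch p) (fun s => (s.x11, s.x21, s.yD1, s.yQ)) (s.x11, s.x21, s.yD1, s.yQ) :=
    law_apply_congr _ fun s' => by simp only [Prod.mk.injEq]; tauto
  rw [e₁, law_joint1_x11_x21]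
  rfl

/-- Here `x₁₁` and `ŷ_R` are drawn independently of each other and of the rest. Inserting the factor
`p(x₁₁, ŷ_R)` in numerator and denominator splits the density into the two mutual informations. -/
theorem divergence_slot1_firstFourth :
    divergence (destLaw ch p) splitFirstFourth (fun c => p.p11 c.1 * quantLaw ch p c.2) =
      mutualInfo (joint1 ch p) (fun s => (s.x11, s.yQ)) (fun s => (s.x21, s.yD1)) +
      mutualInfo (joint1 ch p) (fun s => s.x11) (fun s => s.yQ) := by
  rw [destLaw, divergence_law, mutualInfo_eq_sum, mutualInfo_eq_sum, ← Finset.sum_add_distrib]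
  simp only [← mul_add]
  refine sum_mul_congr (joint1_nonneg ch p) fun s hs => ?_
  have hZ := hs.trans_le (le_law_apply (joint1_nonneg ch p) (fun s => (s.x11, s.x21, s.yD1, s.yQ)) s)
  have hX := hs.trans_le (le_law_apply (joint1_nonneg ch p) (fun s => s.x11) s)
  have hQ := hs.trans_le (le_law_apply (joint1_nonneg ch p) (fun s => s.yQ) s)
  have hXQ := hs.trans_le (le_law_apply (joint1_nonneg ch p) (fun s => (s.x11, s.yQ)) s)
  have hY := hs.trans_le (le_law_apply (joint1_nonneg ch p) (fun s => (s.x21, s.yD1)) s)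
  have e₁ : law (joint1 ch p) (fun s => ((s.x11, s.yQ), s.x21, s.yD1)) ((s.x11, s.yQ), s.x21, s.yD1) =
      law (joint1 ch p) (fun s => (s.x11, s.x21, s.yD1, s.yQ)) (s.x11, s.x21, s.yD1, s.yQ) :=
    law_apply_congr _ fun s' => by simp only [Prod.mk.injEq]; tauto
  rw [e₁, ← Real.logb_mul (by positivity) (by positivity)]
  refine congrArg _ ?_
  rw [law_joint1_x11] at hX ⊢
  simp only [splitFirstFourth, Equiv.coe_fn_symm_mk, quantLaw]
  field_simp

/-- The exact exponent is `I(X₂₁, Ŷ_R; X₁₁, Y_D1) + I(X₂₁; Ŷ_R)`. By the chain rule its first term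
exceeds `I(X₂₁, Ŷ_R; Y_D1 | X₁₁)` by `I(X₂₁, Ŷ_R; X₁₁) ≥ 0`, so only an inequality holds here. -/
theorem le_divergence_slot1_secondFourth :
    condMutualInfo (joint1 ch p) (fun s => (s.x21, s.yQ)) (fun s => s.yD1)
        (fun s => s.x11) +
      mutualInfo (joint1 ch p) (fun s => s.x21) (fun s => s.yQ) ≤
    divergence (destLaw ch p) splitSecondFourth (fun c => p.p21 c.1 * quantLaw ch p c.2) := by
  refine (le_add_of_nonneg_right (mutualInfo_nonneg (joint1_mem ch p)
    (fun s => (s.x21, s.yQ)) (fun s => s.x11))).trans (le_of_eq ?_)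
  rw [destLaw, divergence_law, condMutualInfo_eq_sum, mutualInfo_eq_sum, mutualInfo_eq_sum,
    ← Finset.sum_add_distrib, ← Finset.sum_add_distrib]
  simp only [← mul_add]
  refine sum_mul_congr (joint1_nonneg ch p) fun s hs => ?_
  have hZ := hs.trans_le (le_law_apply (joint1_nonneg ch p) (fun s => (s.x11, s.x21, s.yD1, s.yQ)) s)
  have hX := hs.trans_le (le_law_apply (joint1_nonneg ch p) (fun s => s.x11) s)
  have hY := hs.trans_le (le_law_apply (joint1_nonneg ch p) (fun s => s.x21) s)
  have hQ := hs.trans_le (le_law_apply (joint1_nonneg ch p) (fun s => s.yQ) s)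
  have hYQ := hs.trans_le (le_law_apply (joint1_nonneg ch p) (fun s => (s.x21, s.yQ)) s)
  have hXD := hs.trans_le (le_law_apply (joint1_nonneg ch p) (fun s => (s.x11, s.yD1)) s)
  have hYQX := hs.trans_le (le_law_apply (joint1_nonneg ch p) (fun s => ((s.x21, s.yQ), s.x11)) s)
  have e₁ : law (joint1 ch p) (fun s => ((s.x21, s.yQ), s.yD1, s.x11)) ((s.x21, s.yQ), s.yD1, s.x11) =
      law (joint1 ch p) (fun s => (s.x11, s.x21, s.yD1, s.yQ)) (s.x11, s.x21, s.yD1, s.yQ) :=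
    law_apply_congr _ fun s' => by simp only [Prod.mk.injEq]; tauto
  have e₂ : law (joint1 ch p) (fun s => (s.yD1, s.x11)) (s.yD1, s.x11) =
      law (joint1 ch p) (fun s => (s.x11, s.yD1)) (s.x11, s.yD1) :=
    law_apply_congr _ fun s' => by simp only [Prod.mk.injEq]; tauto
  rw [e₁, e₂, ← Real.logb_mul (by positivity) (by positivity),
    ← Real.logb_mul (by positivity) (by positivity)]
  refine congrArg _ ?_
  rw [law_joint1_x21] at hY ⊢
  simp only [splitSecondFourth, Equiv.coe_fn_symm_mk, quantLaw]
  field_simp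

theorem divergence_slot1_firstSecondFourth :
    divergence (destLaw ch p) splitFirstSecondFourth
        (fun c => p.p11 c.1.1 * p.p21 c.1.2 * quantLaw ch p c.2) =
      mutualInfo (joint1 ch p) (fun s => (s.x11, s.x21, s.yQ)) (fun s => s.yD1) +
      mutualInfo (joint1 ch p) (fun s => (s.x11, s.x21)) (fun s => s.yQ) := by
  rw [destLaw, divergence_law, mutualInfo_eq_sum, mutualInfo_eq_sum, ← Finset.sum_add_distrib]
  simp only [← mul_add]
  refine sum_mul_congr (joint1_nonneg ch p) fun s hs => ?_
  have hZ := hs.trans_le (le_law_apply (joint1_nonneg ch p) (fun s => (s.x11, s.x21, s.yD1, s.yQ)) s)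
  have hX := hs.trans_le (le_law_apply (joint1_nonneg ch p) (fun s => (s.x11, s.x21)) s)
  have hQ := hs.trans_le (le_law_apply (joint1_nonneg ch p) (fun s => s.yQ) s)
  have hXQ := hs.trans_le (le_law_apply (joint1_nonneg ch p) (fun s => (s.x11, s.x21, s.yQ)) s)
  have hD := hs.trans_le (le_law_apply (joint1_nonneg ch p) (fun s => s.yD1) s)
  have e₁ : law (joint1 ch p) (fun s => ((s.x11, s.x21, s.yQ), s.yD1)) ((s.x11, s.x21, s.yQ), s.yD1) =
      law (joint1 ch p) (fun s => (s.x11, s.x21, s.yD1, s.yQ)) (s.x11, s.x21, s.yD1, s.yQ) :=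
    law_apply_congr _ fun s' => by simp only [Prod.mk.injEq]; tauto
  have e₂ : law (joint1 ch p) (fun s => ((s.x11, s.x21), s.yQ)) ((s.x11, s.x21), s.yQ) =
      law (joint1 ch p) (fun s => (s.x11, s.x21, s.yQ)) (s.x11, s.x21, s.yQ) :=
    law_apply_congr _ fun s' => by simp only [Prod.mk.injEq]; tauto
  rw [e₁, e₂, ← Real.logb_mul (by positivity) (by positivity)]
  refine congrArg _ ?_
  rw [law_joint1_x11_x21] at hX ⊢
  simp only [splitFirstSecondFourth, Equiv.coe_fn_symm_mk, quantLaw]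
  field_simp

/-- In the second slot all three inputs are independent, so those not redrawn can always be moved
into the condition. The same reason gives the next four identities. -/
theorem divergence_slot2_first :
    divergence (joint2 ch p) (Equiv.refl _) (fun a => p.p12 a) =
      condMutualInfo (joint2 ch p) (fun s => s.x12) (fun s => s.yD2)
        (fun s => (s.x22, s.xR)) := by
  rw [divergence_self, condMutualInfo_eq_sum]
  refine sum_mul_congr (joint2_nonneg ch p) fun s hs => congrArg _ ?_
  have hA := hs.trans_le (le_law_apply (joint2_nonneg ch p) (fun s => s.x12) s)
  have hB := hs.trans_le (le_law_apply (joint2_nonneg ch p) (fun s => s.x22) s)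
  have hR := hs.trans_le (le_law_apply (joint2_nonneg ch p) (fun s => s.xR) s)
  have e₁ : law (joint2 ch p) (fun s => (s.x12, s.yD2, s.x22, s.xR))
      (s.x12, s.yD2, s.x22, s.xR) = joint2 ch p s :=
    law_apply_of_injective _ (X := fun s : Outcome2 X₁₂ X₂₂ XR YD2 => (s.x12, s.yD2, s.x22, s.xR))
      (fun s s' h => by simp only [Prod.mk.injEq] at h; ext <;> tauto) s
  have e₂ : law (joint2 ch p) (fun s => (s.yD2, s.x22, s.xR)) (s.yD2, s.x22, s.xR) =
      law (joint2 ch p) (fun s => (s.x22, s.xR, s.yD2)) (s.x22, s.xR, s.yD2) :=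
    law_apply_congr _ fun s' => by simp only [Prod.mk.injEq]; tauto
  rw [law_joint2_x12] at hA
  rw [law_joint2_x22] at hB
  rw [law_joint2_xR] at hR
  rw [e₁, e₂, law_joint2_inputs, law_joint2_x22_xR]
  simp only [Equiv.refl_symm, Equiv.refl_apply]
  field_simp

theorem divergence_slot2_second :
    divergence (joint2 ch p) splitSecond (fun b => p.p22 b) =
      condMutualInfo (joint2 ch p) (fun s => s.x22) (fun s => s.yD2)
        (fun s => (s.x12, s.xR)) := by
  rw [divergence_self, condMutualInfo_eq_sum]
  refine sum_mul_congr (joint2_nonneg ch p) fun s hs => congrArg _ ?_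
  have hA := hs.trans_le (le_law_apply (joint2_nonneg ch p) (fun s => s.x12) s)
  have hB := hs.trans_le (le_law_apply (joint2_nonneg ch p) (fun s => s.x22) s)
  have hR := hs.trans_le (le_law_apply (joint2_nonneg ch p) (fun s => s.xR) s)
  have e₁ : law (joint2 ch p) (fun s => (s.x22, s.yD2, s.x12, s.xR))
      (s.x22, s.yD2, s.x12, s.xR) = joint2 ch p s :=
    law_apply_of_injective _ (X := fun s : Outcome2 X₁₂ X₂₂ XR YD2 => (s.x22, s.yD2, s.x12, s.xR))
      (fun s s' h => by simp only [Prod.mk.injEq] at h; ext <;> tauto) s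
  have e₂ : law (joint2 ch p) (fun s => (s.yD2, s.x12, s.xR)) (s.yD2, s.x12, s.xR) =
      law (joint2 ch p) (fun s => (s.x12, s.xR, s.yD2)) (s.x12, s.xR, s.yD2) :=
    law_apply_congr _ fun s' => by simp only [Prod.mk.injEq]; tauto
  have e₃ : law (joint2 ch p) (fun s => (s.x22, s.x12, s.xR)) (s.x22, s.x12, s.xR) =
      law (joint2 ch p) (fun s => (s.x12, s.x22, s.xR)) (s.x12, s.x22, s.xR) :=
    law_apply_congr _ fun s' => by simp only [Prod.mk.injEq]; tauto
  rw [law_joint2_x12] at hA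
  rw [law_joint2_x22] at hB
  rw [law_joint2_xR] at hR
  rw [e₁, e₂, e₃, law_joint2_inputs, law_joint2_x12_xR]
  simp only [splitSecond, Equiv.coe_fn_symm_mk]
  field_simp

theorem divergence_slot2_firstSecond :
    divergence (joint2 ch p) splitFirstSecond (fun c => p.p12 c.1 * p.p22 c.2) =
      condMutualInfo (joint2 ch p) (fun s => (s.x12, s.x22)) (fun s => s.yD2)
        (fun s => s.xR) := by
  rw [divergence_self, condMutualInfo_eq_sum]
  refine sum_mul_congr (joint2_nonneg ch p) fun s hs => congrArg _ ?_
  have hA := hs.trans_le (le_law_apply (joint2_nonneg ch p) (fun s => s.x12) s)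
  have hB := hs.trans_le (le_law_apply (joint2_nonneg ch p) (fun s => s.x22) s)
  have hR := hs.trans_le (le_law_apply (joint2_nonneg ch p) (fun s => s.xR) s)
  have e₁ : law (joint2 ch p) (fun s => ((s.x12, s.x22), s.yD2, s.xR)) ((s.x12, s.x22), s.yD2, s.xR) = joint2 ch p s :=
    law_apply_of_injective _ (X := fun s : Outcome2 X₁₂ X₂₂ XR YD2 => ((s.x12, s.x22), s.yD2, s.xR))
      (fun s s' h => by simp only [Prod.mk.injEq] at h; ext <;> tauto) s
  have e₂ : law (joint2 ch p) (fun s => (s.yD2, s.xR)) (s.yD2, s.xR) =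
      law (joint2 ch p) (fun s => (s.xR, s.yD2)) (s.xR, s.yD2) :=
    law_apply_congr _ fun s' => by simp only [Prod.mk.injEq]; tauto
  have e₃ : law (joint2 ch p) (fun s => ((s.x12, s.x22), s.xR)) ((s.x12, s.x22), s.xR) =
      law (joint2 ch p) (fun s => (s.x12, s.x22, s.xR)) (s.x12, s.x22, s.xR) :=
    law_apply_congr _ fun s' => by simp only [Prod.mk.injEq]; tauto
  rw [law_joint2_x12] at hA
  rw [law_joint2_x22] at hB
  rw [law_joint2_xR] at hR
  rw [e₁, e₂, e₃, law_joint2_inputs, law_joint2_xR]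
  simp only [splitFirstSecond, Equiv.coe_fn_symm_mk]
  field_simp

theorem divergence_slot2_firstThird :
    divergence (joint2 ch p) splitFirstThird (fun c => p.p12 c.1 * p.pR c.2) =
      condMutualInfo (joint2 ch p) (fun s => (s.x12, s.xR)) (fun s => s.yD2)
        (fun s => s.x22) := by
  rw [divergence_self, condMutualInfo_eq_sum]
  refine sum_mul_congr (joint2_nonneg ch p) fun s hs => congrArg _ ?_
  have hA := hs.trans_le (le_law_apply (joint2_nonneg ch p) (fun s => s.x12) s)
  have hB := hs.trans_le (le_law_apply (joint2_nonneg ch p) (fun s => s.x22) s)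
  have hR := hs.trans_le (le_law_apply (joint2_nonneg ch p) (fun s => s.xR) s)
  have e₁ : law (joint2 ch p) (fun s => ((s.x12, s.xR), s.yD2, s.x22)) ((s.x12, s.xR), s.yD2, s.x22) = joint2 ch p s :=
    law_apply_of_injective _ (X := fun s : Outcome2 X₁₂ X₂₂ XR YD2 => ((s.x12, s.xR), s.yD2, s.x22))
      (fun s s' h => by simp only [Prod.mk.injEq] at h; ext <;> tauto) s
  have e₂ : law (joint2 ch p) (fun s => (s.yD2, s.x22)) (s.yD2, s.x22) =
      law (joint2 ch p) (fun s => (s.x22, s.yD2)) (s.x22, s.yD2) :=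
    law_apply_congr _ fun s' => by simp only [Prod.mk.injEq]; tauto
  have e₃ : law (joint2 ch p) (fun s => ((s.x12, s.xR), s.x22)) ((s.x12, s.xR), s.x22) =
      law (joint2 ch p) (fun s => (s.x12, s.x22, s.xR)) (s.x12, s.x22, s.xR) :=
    law_apply_congr _ fun s' => by simp only [Prod.mk.injEq]; tauto
  rw [law_joint2_x12] at hA
  rw [law_joint2_x22] at hB
  rw [law_joint2_xR] at hR
  rw [e₁, e₂, e₃, law_joint2_inputs, law_joint2_x22]
  simp only [splitFirstThird, Equiv.coe_fn_symm_mk]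
  field_simp

theorem divergence_slot2_secondThird :
    divergence (joint2 ch p) splitSecondThird (fun c => p.p22 c.1 * p.pR c.2) =
      condMutualInfo (joint2 ch p) (fun s => (s.x22, s.xR)) (fun s => s.yD2)
        (fun s => s.x12) := by
  rw [divergence_self, condMutualInfo_eq_sum]
  refine sum_mul_congr (joint2_nonneg ch p) fun s hs => congrArg _ ?_
  have hA := hs.trans_le (le_law_apply (joint2_nonneg ch p) (fun s => s.x12) s)
  have hB := hs.trans_le (le_law_apply (joint2_nonneg ch p) (fun s => s.x22) s)
  have hR := hs.trans_le (le_law_apply (joint2_nonneg ch p) (fun s => s.xR) s)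
  have e₁ : law (joint2 ch p) (fun s => ((s.x22, s.xR), s.yD2, s.x12)) ((s.x22, s.xR), s.yD2, s.x12) = joint2 ch p s :=
    law_apply_of_injective _ (X := fun s : Outcome2 X₁₂ X₂₂ XR YD2 => ((s.x22, s.xR), s.yD2, s.x12))
      (fun s s' h => by simp only [Prod.mk.injEq] at h; ext <;> tauto) s
  have e₂ : law (joint2 ch p) (fun s => (s.yD2, s.x12)) (s.yD2, s.x12) =
      law (joint2 ch p) (fun s => (s.x12, s.yD2)) (s.x12, s.yD2) :=
    law_apply_congr _ fun s' => by simp only [Prod.mk.injEq]; tauto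
  have e₃ : law (joint2 ch p) (fun s => ((s.x22, s.xR), s.x12)) ((s.x22, s.xR), s.x12) =
      law (joint2 ch p) (fun s => (s.x12, s.x22, s.xR)) (s.x12, s.x22, s.xR) :=
    law_apply_congr _ fun s' => by simp only [Prod.mk.injEq]; tauto
  rw [law_joint2_x12] at hA
  rw [law_joint2_x22] at hB
  rw [law_joint2_xR] at hR
  rw [e₁, e₂, e₃, law_joint2_inputs, law_joint2_x12]
  simp only [splitSecondThird, Equiv.coe_fn_symm_mk]
  field_simp

theorem divergence_slot2_firstSecondThird :
    divergence (joint2 ch p) splitFirstSecondThird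
        (fun c => p.p12 c.1.1 * p.p22 c.1.2 * p.pR c.2) =
      mutualInfo (joint2 ch p) (fun s => (s.x12, s.x22, s.xR)) (fun s => s.yD2) := by
  rw [divergence_self, mutualInfo_eq_sum]
  refine sum_mul_congr (joint2_nonneg ch p) fun s hs => congrArg _ ?_
  have e₁ : law (joint2 ch p) (fun s => ((s.x12, s.x22, s.xR), s.yD2)) ((s.x12, s.x22, s.xR), s.yD2) = joint2 ch p s :=
    law_apply_of_injective _ (X := fun s : Outcome2 X₁₂ X₂₂ XR YD2 => ((s.x12, s.x22, s.xR), s.yD2))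
      (fun s s' h => by simp only [Prod.mk.injEq] at h; ext <;> tauto) s
  rw [e₁, law_joint2_inputs]
  rfl

theorem divergence_quantizer :
    divergence (law (joint1 ch p) fun s => (s.yR, s.yQ)) (Equiv.prodComm YQ YR) (quantLaw ch p) =
      mutualInfo (joint1 ch p) (fun s => s.yR) (fun s => s.yQ) := by
  rw [divergence_law, mutualInfo_eq_sum]
  refine sum_mul_congr (joint1_nonneg ch p) fun s hs => congrArg _ ?_
  rw [mul_comm]
  rfl

end Exponents

/-! ### The random coding bound for the scheme -/

section Words

variable {Ω A A' A'' B : Type*} [Fintype Ω] [Fintype A] [Fintype A'] [Fintype A''] {n m : ℕ}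

/-- Two independent words form one word over the product alphabet, so the single-word bound also
covers several simultaneous redraws. -/
theorem sum_seqLaw_seqLaw (r : Fin n → A → ℝ) (r' : Fin n → A' → ℝ)
    (F : (Fin n → A) → (Fin n → A') → ℝ) :
    ∑ a, ∑ a', seqLaw r a * seqLaw r' a' * F a a' =
      ∑ c : Fin n → A × A', seqLaw (fun i c => r i c.1 * r' i c.2) c *
        F (fun i => (c i).1) (fun i => (c i).2) := by
  rw [sum_arrow_prod fun a a' => seqLaw r a * seqLaw r' a' * F a a']
  simp only [seqLaw, Finset.prod_mul_distrib]

theorem sum_seqLaw_ind_typical_le_pair {q : Ω → ℝ} (hq : ∀ c, 0 ≤ q c) (e : (A × A') × B ≃ Ω)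
    {r : A → ℝ} {r' : A' → ℝ} (hr : ∀ a, 0 ≤ r a) (hr' : ∀ a, 0 ≤ r' a)
    (hqr : ∀ a b, r a.1 * r' a.2 = 0 → q (e (a, b)) = 0) (ε : ℝ) (b : Fin n → B) :
    ∑ a : Fin n → A, ∑ a' : Fin n → A', seqLaw (fun _ => r) a * seqLaw (fun _ => r') a' *
        ind (Typical q ε fun i => e ((a i, a' i), b i)) ≤
      (2 : ℝ) ^ (-(n * (divergence q e (fun c => r c.1 * r' c.2) -
        ε * absDivergence q e fun c => r c.1 * r' c.2))) := by
  rw [sum_seqLaw_seqLaw _ _ fun a a' => ind (Typical q ε fun i => e ((a i, a' i), b i))]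
  exact sum_seqLaw_ind_typical_le hq e (fun c => mul_nonneg (hr _) (hr' _)) hqr ε b

theorem sum_seqLaw_ind_typical_le_triple {q : Ω → ℝ} (hq : ∀ c, 0 ≤ q c)
    (e : ((A × A') × A'') × B ≃ Ω) {r : A → ℝ} {r' : A' → ℝ} {r'' : A'' → ℝ} (hr : ∀ a, 0 ≤ r a)
    (hr' : ∀ a, 0 ≤ r' a) (hr'' : ∀ a, 0 ≤ r'' a)
    (hqr : ∀ a b, r a.1.1 * r' a.1.2 * r'' a.2 = 0 → q (e (a, b)) = 0) (ε : ℝ) (b : Fin n → B) :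
    ∑ a : Fin n → A, ∑ a' : Fin n → A', ∑ a'' : Fin n → A'',
        seqLaw (fun _ => r) a * seqLaw (fun _ => r') a' * seqLaw (fun _ => r'') a'' *
        ind (Typical q ε fun i => e (((a i, a' i), a'' i), b i)) ≤
      (2 : ℝ) ^ (-(n * (divergence q e (fun c => r c.1.1 * r' c.1.2 * r'' c.2) -
        ε * absDivergence q e fun c => r c.1.1 * r' c.1.2 * r'' c.2))) := by
  refine le_trans (le_of_eq ?_) (sum_seqLaw_ind_typical_le_pair hq e (r := fun c => r c.1 * r' c.2)
    (fun c => mul_nonneg (hr _) (hr' _)) hr'' hqr ε b)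
  have := sum_seqLaw_seqLaw (fun _ : Fin n => r) (fun _ => r') fun a a' =>
    ∑ a'' : Fin n → A'', seqLaw (fun _ => r'') a'' *
      ind (Typical q ε fun i => e (((a i, a' i), a'' i), b i))
  simpa only [Finset.mul_sum, mul_assoc] using this

/-- The law of a pair of words with independent letters. -/
def wordLaw (p : A → ℝ) (q : A' → ℝ) (a : (Fin n → A) × (Fin m → A')) : ℝ :=
  seqLaw (fun _ => p) a.1 * seqLaw (fun _ => q) a.2

theorem wordLaw_mem {p : A → ℝ} {q : A' → ℝ} (hp : p ∈ stdSimplex ℝ A) (hq : q ∈ stdSimplex ℝ A') :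
    wordLaw p q ∈ stdSimplex ℝ ((Fin n → A) × (Fin m → A')) := by
  have h := mul_mem_stdSimplex_prod (seqLaw_mem fun _ : Fin n => hp) (seqLaw_mem fun _ : Fin m => hq)
  exact h

variable {B' C C' : Type*} [Fintype B] [Fintype B'] [Fintype C] [Fintype C']

theorem sum_mul_factor (f I : A → ℝ) (g J : A' → ℝ) :
    ∑ c : A × A', f c.1 * g c.2 * (I c.1 * J c.2) = (∑ a, f a * I a) * ∑ a, g a * J a := by
  rw [Fintype.sum_prod_type, Finset.sum_mul_sum]
  exact Finset.sum_congr rfl fun a _ => Finset.sum_congr rfl fun a' _ => by ring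

theorem sum_mul_factor_pair (f : A → ℝ) (g : A' → ℝ) (h : B → ℝ) (k : B' → ℝ)
    (I : A → B → ℝ) (J : A' → B' → ℝ) :
    ∑ c : (A × A') × B × B', f c.1.1 * g c.1.2 * (h c.2.1 * k c.2.2) *
        (I c.1.1 c.2.1 * J c.1.2 c.2.2) =
      (∑ a, ∑ b, f a * h b * I a b) * ∑ a, ∑ b, g a * k b * J a b := by
  have e : ∀ a a' b b', f a * g a' * (h b * k b') * (I a b * J a' b') =
      (f a * h b * I a b) * (g a' * k b' * J a' b') := fun a a' b b' => by ring
  simp only [Fintype.sum_prod_type, e, ← Finset.mul_sum, ← Finset.sum_mul]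

/-- The relay's pair lists the slot 2 word before the slot 1 word, while the source's pair has the
opposite order; hence the crossed indices. -/
theorem sum_mul_factor_pair_swap (f : A → ℝ) (g : A' → ℝ) (h : B → ℝ) (k : B' → ℝ)
    (I : A → B → ℝ) (J : A' → B' → ℝ) :
    ∑ c : (A × A') × B' × B, f c.1.1 * g c.1.2 * (k c.2.1 * h c.2.2) *
        (I c.1.1 c.2.2 * J c.1.2 c.2.1) =
      (∑ a, ∑ b, f a * h b * I a b) * ∑ a, ∑ b, g a * k b * J a b := by
  have e : ∀ a a' b b', f a * g a' * (k b' * h b) * (I a b * J a' b') =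
      (f a * h b * I a b) * (g a' * k b' * J a' b') := fun a a' b b' => by ring
  simp only [Fintype.sum_prod_type, e, ← Finset.mul_sum, ← Finset.sum_mul]

theorem sum_mul_factor_triple_swap (f : A → ℝ) (g : A' → ℝ) (h : B → ℝ) (k : B' → ℝ) (s : C → ℝ)
    (t : C' → ℝ) (I : A → B → C → ℝ) (J : A' → B' → C' → ℝ) :
    ∑ c : ((A × A') × B × B') × C' × C, f c.1.1.1 * g c.1.1.2 * (h c.1.2.1 * k c.1.2.2) *
        (t c.2.1 * s c.2.2) * (I c.1.1.1 c.1.2.1 c.2.2 * J c.1.1.2 c.1.2.2 c.2.1) =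
      (∑ a, ∑ b, ∑ c, f a * h b * s c * I a b c) * ∑ a, ∑ b, ∑ c, g a * k b * t c * J a b c := by
  have e : ∀ a a' b b' c c', f a * g a' * (h b * k b') * (t c' * s c) * (I a b c * J a' b' c') =
      (f a * h b * s c * I a b c) * (g a' * k b' * t c' * J a' b' c') :=
    fun a a' b b' c c' => by ring
  simp only [Fintype.sum_prod_type, e, ← Finset.mul_sum, ← Finset.sum_mul]

theorem simplex_nonneg (p : stdSimplex ℝ A) (a : A) : 0 ≤ p a := p.2.1 a

theorem seqLaw_simplex_mem {ι : Type*} [Fintype ι] [DecidableEq ι] (p : stdSimplex ℝ A) :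
    seqLaw (fun _ : ι => p) ∈ stdSimplex ℝ (ι → A) :=
  seqLaw_mem fun _ => p.2

end Words

/-! ### Word-level kernels, tests and wrong-word bounds -/

section Scheme

variable {X₁₁ X₂₁ X₁₂ X₂₂ XR YD1 YR YD2 YQ : Type*}
  [Fintype X₁₁] [Fintype X₂₁] [Fintype X₁₂] [Fintype X₂₂] [Fintype XR]
  [Fintype YD1] [Fintype YR] [Fintype YD2] [Fintype YQ]
  (ch : Channel X₁₁ X₂₁ X₁₂ X₂₂ XR YD1 YR YD2) (p : Inputs X₁₁ X₂₁ X₁₂ X₂₂ XR YR YQ) {n m : ℕ}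

/-- The transition probabilities of words in the first slot. -/
def wordKernel1 (a : (Fin n → X₁₁) × (Fin m → X₁₂)) (b : (Fin n → X₂₁) × (Fin m → X₂₂))
    (y : Fin n → YD1) (v : Fin n → YR) : ℝ :=
  ∏ i, ch.slot1 (a.1 i) (b.1 i) (y i, v i)

/-- The transition probabilities of words in the second slot. -/
def wordKernel2 (a : (Fin n → X₁₁) × (Fin m → X₁₂)) (b : (Fin n → X₂₁) × (Fin m → X₂₂))
    (r : Fin m → XR) (z : Fin m → YD2) : ℝ :=
  ∏ j, ch.slot2 (a.2 j) (b.2 j) (r j) (z j)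

/-- The relay's test. -/
def RelayTest (ε : ℝ) (v : Fin n → YR) (q : Fin n → YQ) : Prop :=
  Typical (law (joint1 ch p) fun s => (s.yR, s.yQ)) ε fun i => (v i, q i)

/-- The destination's test. -/
def DestTest (ε : ℝ) (a : (Fin n → X₁₁) × (Fin m → X₁₂)) (b : (Fin n → X₂₁) × (Fin m → X₂₂))
    (k : (Fin m → XR) × (Fin n → YQ)) (y : Fin n → YD1) (z : Fin m → YD2) : Prop :=
  Typical (destLaw ch p) ε (fun i => (a.1 i, b.1 i, y i, k.2 i)) ∧
    Typical (joint2 ch p) ε (fun j => (a.2 j, b.2 j, k.1 j, z j))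

omit [Fintype X₁₁] [Fintype X₂₁] [Fintype X₁₂] [Fintype X₂₂] [Fintype XR] in
theorem wordKernel1_nonneg (a : (Fin n → X₁₁) × (Fin m → X₁₂)) (b : (Fin n → X₂₁) × (Fin m → X₂₂))
    (y : Fin n → YD1) (v : Fin n → YR) : 0 ≤ wordKernel1 ch a b y v :=
  Finset.prod_nonneg fun _ _ => (ch.slot1 _ _).2.1 _

omit [Fintype X₁₁] [Fintype X₂₁] [Fintype X₁₂] [Fintype X₂₂] [Fintype XR] in
theorem sum_wordKernel1 (a : (Fin n → X₁₁) × (Fin m → X₁₂)) (b : (Fin n → X₂₁) × (Fin m → X₂₂)) :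
    ∑ y, ∑ v, wordKernel1 ch a b y v = 1 := by
  rw [sum_arrow_prod fun y v => wordKernel1 ch a b y v]
  unfold wordKernel1
  dsimp only
  rw [sum_prod_apply fun i (c : YD1 × YR) => ch.slot1 (a.1 i) (b.1 i) (c.1, c.2)]
  exact Finset.prod_eq_one fun i _ => stdSimplex.sum_eq_one _

omit [Fintype X₁₁] [Fintype X₂₁] [Fintype X₁₂] [Fintype X₂₂] [Fintype XR] in
theorem wordKernel2_mem (a : (Fin n → X₁₁) × (Fin m → X₁₂)) (b : (Fin n → X₂₁) × (Fin m → X₂₂))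
    (r : Fin m → XR) : wordKernel2 ch a b r ∈ stdSimplex ℝ (Fin m → YD2) := by
  have h := seqLaw_mem fun j => (ch.slot2 (a.2 j) (b.2 j) (r j)).2
  exact h

theorem quantLaw_mem : quantLaw ch p ∈ stdSimplex ℝ YQ := law_mem (joint1_mem ch p) _

theorem destLaw_nonneg (c : X₁₁ × X₂₁ × YD1 × YQ) : 0 ≤ destLaw ch p c :=
  law_nonneg (joint1_nonneg ch p) _ c

theorem destLaw_eq_zero {c : X₁₁ × X₂₁ × YD1 × YQ}
    (h : p.p11 c.1 = 0 ∨ p.p21 c.2.1 = 0 ∨ quantLaw ch p c.2.2.2 = 0) : destLaw ch p c = 0 := by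
  rcases h with h | h | h
  · rw [← law_joint1_x11 ch p] at h
    exact law_eq_zero_of_comp (joint1_nonneg ch p) (f := fun c => c.1) h
  · rw [← law_joint1_x21 ch p] at h
    exact law_eq_zero_of_comp (joint1_nonneg ch p) (f := fun c => c.2.1) h
  · unfold quantLaw at h
    exact law_eq_zero_of_comp (joint1_nonneg ch p) (f := fun c => c.2.2.2) h

theorem joint2_eq_zero {c : X₁₂ × X₂₂ × XR × YD2}
    (h : p.p12 c.1 = 0 ∨ p.p22 c.2.1 = 0 ∨ p.pR c.2.2.1 = 0) : joint2 ch p c = 0 := by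
  unfold joint2
  rcases h with h | h | h <;> simp [h]

/-! #### Wrong words -/

/-- The bound on the probability that independent words pass the tests of both slots. -/
def wrongBound {Ω Ω' A A' B B' : Type*} [Fintype Ω] [Fintype Ω'] [Fintype A] [Fintype A']
    (q : Ω → ℝ) (e : A × B ≃ Ω) (r : A → ℝ) (q' : Ω' → ℝ) (e' : A' × B' ≃ Ω') (r' : A' → ℝ)
    (ε : ℝ) (n m : ℕ) : ℝ :=
  (2 : ℝ) ^ (-(n * (divergence q e r - ε * absDivergence q e r))) *
    (2 : ℝ) ^ (-(m * (divergence q' e' r' - ε * absDivergence q' e' r')))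

theorem wrongBound_nonneg {Ω Ω' A A' B B' : Type*} [Fintype Ω] [Fintype Ω'] [Fintype A] [Fintype A']
    (q : Ω → ℝ) (e : A × B ≃ Ω) (r : A → ℝ) (q' : Ω' → ℝ) (e' : A' × B' ≃ Ω') (r' : A' → ℝ)
    (ε : ℝ) (n m : ℕ) : 0 ≤ wrongBound q e r q' e' r' ε n m := by
  unfold wrongBound
  positivity

variable (ε : ℝ)

/-- The two halves of a source word are independent and each enters the test of one slot only. With
everything else fixed, the probability factors and the bounds of the two slots multiply; the five
bounds that follow have the same structure. -/
theorem sum_destTest_first_le (b : (Fin n → X₂₁) × (Fin m → X₂₂))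
    (k : (Fin m → XR) × (Fin n → YQ)) (y : Fin n → YD1) (z : Fin m → YD2) :
    ∑ a, wordLaw p.p11 p.p12 a * ind (DestTest ch p ε a b k y z) ≤
      wrongBound (destLaw ch p) (Equiv.refl _) (fun a => p.p11 a)
        (joint2 ch p) (Equiv.refl _) (fun a => p.p12 a) ε n m := by
  have h₁ := sum_seqLaw_ind_typical_le (destLaw_nonneg ch p) (Equiv.refl _) (simplex_nonneg p.p11)
    (fun _ _ h => destLaw_eq_zero ch p (.inl h)) ε fun i : Fin n => (b.1 i, y i, k.2 i)
  have h₂ := sum_seqLaw_ind_typical_le (joint2_nonneg ch p) (Equiv.refl _) (simplex_nonneg p.p12)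
    (fun _ _ h => joint2_eq_zero ch p (.inl h)) ε fun j : Fin m => (b.2 j, k.1 j, z j)
  have h := mul_le_mul h₁ h₂ (Finset.sum_nonneg fun a _ => mul_nonneg
    (seqLaw_nonneg (fun _ => (simplex_nonneg p.p12)) a) (ind_nonneg _)) (by positivity)
  simp only [wordLaw, DestTest, ind_and]
  rw [← sum_mul_factor] at h
  exact h

theorem sum_destTest_second_le (a : (Fin n → X₁₁) × (Fin m → X₁₂))
    (k : (Fin m → XR) × (Fin n → YQ)) (y : Fin n → YD1) (z : Fin m → YD2) :
    ∑ b, wordLaw p.p21 p.p22 b * ind (DestTest ch p ε a b k y z) ≤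
      wrongBound (destLaw ch p) splitSecond (fun a => p.p21 a)
        (joint2 ch p) splitSecond (fun a => p.p22 a) ε n m := by
  have h₁ := sum_seqLaw_ind_typical_le (destLaw_nonneg ch p) splitSecond (simplex_nonneg p.p21)
    (fun _ _ h => destLaw_eq_zero ch p (.inr (.inl h))) ε fun i : Fin n => (a.1 i, y i, k.2 i)
  have h₂ := sum_seqLaw_ind_typical_le (joint2_nonneg ch p) splitSecond (simplex_nonneg p.p22)
    (fun _ _ h => joint2_eq_zero ch p (.inr (.inl h))) ε fun j : Fin m => (a.2 j, k.1 j, z j)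
  have h := mul_le_mul h₁ h₂ (Finset.sum_nonneg fun a _ => mul_nonneg
    (seqLaw_nonneg (fun _ => (simplex_nonneg p.p22)) a) (ind_nonneg _)) (by positivity)
  simp only [wordLaw, DestTest, ind_and]
  rw [← sum_mul_factor] at h
  exact h

theorem sum_destTest_firstSecond_le
    (k : (Fin m → XR) × (Fin n → YQ)) (y : Fin n → YD1) (z : Fin m → YD2) :
    ∑ c : ((Fin n → X₁₁) × (Fin m → X₁₂)) × ((Fin n → X₂₁) × (Fin m → X₂₂)),
      wordLaw p.p11 p.p12 c.1 * wordLaw p.p21 p.p22 c.2 * ind (DestTest ch p ε c.1 c.2 k y z) ≤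
      wrongBound (destLaw ch p) splitFirstSecond (fun c => p.p11 c.1 * p.p21 c.2)
        (joint2 ch p) splitFirstSecond (fun c => p.p12 c.1 * p.p22 c.2) ε n m := by
  have h₁ := sum_seqLaw_ind_typical_le_pair (destLaw_nonneg ch p) splitFirstSecond (simplex_nonneg p.p11)
    (simplex_nonneg p.p21) (fun _ _ h => destLaw_eq_zero ch p ((mul_eq_zero.1 h).imp id .inl)) ε
    fun i : Fin n => (y i, k.2 i)
  have h₂ := sum_seqLaw_ind_typical_le_pair (joint2_nonneg ch p) splitFirstSecond (simplex_nonneg p.p12)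
    (simplex_nonneg p.p22) (fun _ _ h => joint2_eq_zero ch p ((mul_eq_zero.1 h).imp id .inl)) ε
    fun j : Fin m => (k.1 j, z j)
  have h := mul_le_mul h₁ h₂ (Finset.sum_nonneg fun a _ =>
    Finset.sum_nonneg fun b _ => mul_nonneg (mul_nonneg (seqLaw_nonneg (fun _ => (simplex_nonneg p.p12)) a)
      (seqLaw_nonneg (fun _ => (simplex_nonneg p.p22)) b)) (ind_nonneg _)) (by positivity)
  simp only [wordLaw, DestTest, ind_and]
  rw [← sum_mul_factor_pair] at h
  exact h

theorem sum_destTest_firstIndex_le (b : (Fin n → X₂₁) × (Fin m → X₂₂))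
    (y : Fin n → YD1) (z : Fin m → YD2) :
    ∑ c : ((Fin n → X₁₁) × (Fin m → X₁₂)) × ((Fin m → XR) × (Fin n → YQ)),
      wordLaw p.p11 p.p12 c.1 * (seqLaw (fun _ => p.pR) c.2.1 *
        seqLaw (fun _ => quantLaw ch p) c.2.2) * ind (DestTest ch p ε c.1 b c.2 y z) ≤
      wrongBound (destLaw ch p) splitFirstFourth (fun c => p.p11 c.1 * quantLaw ch p c.2)
        (joint2 ch p) splitFirstThird (fun c => p.p12 c.1 * p.pR c.2) ε n m := by
  have h₁ := sum_seqLaw_ind_typical_le_pair (destLaw_nonneg ch p) splitFirstFourth (simplex_nonneg p.p11)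
    (quantLaw_mem ch p).1 (fun _ _ h => destLaw_eq_zero ch p ((mul_eq_zero.1 h).imp id .inr)) ε
    fun i : Fin n => (b.1 i, y i)
  have h₂ := sum_seqLaw_ind_typical_le_pair (joint2_nonneg ch p) splitFirstThird (simplex_nonneg p.p12)
    (simplex_nonneg p.pR) (fun _ _ h => joint2_eq_zero ch p ((mul_eq_zero.1 h).imp id .inr)) ε
    fun j : Fin m => (b.2 j, z j)
  have h := mul_le_mul h₁ h₂ (Finset.sum_nonneg fun a _ =>
    Finset.sum_nonneg fun b _ => mul_nonneg (mul_nonneg (seqLaw_nonneg (fun _ => (simplex_nonneg p.p12)) a)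
      (seqLaw_nonneg (fun _ => (simplex_nonneg p.pR)) b)) (ind_nonneg _)) (by positivity)
  simp only [wordLaw, DestTest, ind_and]
  rw [← sum_mul_factor_pair_swap] at h
  exact h

theorem sum_destTest_secondIndex_le (a : (Fin n → X₁₁) × (Fin m → X₁₂))
    (y : Fin n → YD1) (z : Fin m → YD2) :
    ∑ c : ((Fin n → X₂₁) × (Fin m → X₂₂)) × ((Fin m → XR) × (Fin n → YQ)),
      wordLaw p.p21 p.p22 c.1 * (seqLaw (fun _ => p.pR) c.2.1 *
        seqLaw (fun _ => quantLaw ch p) c.2.2) * ind (DestTest ch p ε a c.1 c.2 y z) ≤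
      wrongBound (destLaw ch p) splitSecondFourth (fun c => p.p21 c.1 * quantLaw ch p c.2)
        (joint2 ch p) splitSecondThird (fun c => p.p22 c.1 * p.pR c.2) ε n m := by
  have h₁ := sum_seqLaw_ind_typical_le_pair (destLaw_nonneg ch p) splitSecondFourth (simplex_nonneg p.p21)
    (quantLaw_mem ch p).1 (fun _ _ h => destLaw_eq_zero ch p (.inr (mul_eq_zero.1 h))) ε
    fun i : Fin n => (a.1 i, y i)
  have h₂ := sum_seqLaw_ind_typical_le_pair (joint2_nonneg ch p) splitSecondThird (simplex_nonneg p.p22)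
    (simplex_nonneg p.pR) (fun _ _ h => joint2_eq_zero ch p (.inr (mul_eq_zero.1 h))) ε
    fun j : Fin m => (a.2 j, z j)
  have h := mul_le_mul h₁ h₂ (Finset.sum_nonneg fun a _ =>
    Finset.sum_nonneg fun b _ => mul_nonneg (mul_nonneg (seqLaw_nonneg (fun _ => (simplex_nonneg p.p22)) a)
      (seqLaw_nonneg (fun _ => (simplex_nonneg p.pR)) b)) (ind_nonneg _)) (by positivity)
  simp only [wordLaw, DestTest, ind_and]
  rw [← sum_mul_factor_pair_swap] at h
  exact h

theorem sum_destTest_firstSecondIndex_le (y : Fin n → YD1) (z : Fin m → YD2) :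
    ∑ c : (((Fin n → X₁₁) × (Fin m → X₁₂)) × ((Fin n → X₂₁) × (Fin m → X₂₂))) ×
        ((Fin m → XR) × (Fin n → YQ)),
      wordLaw p.p11 p.p12 c.1.1 * wordLaw p.p21 p.p22 c.1.2 * (seqLaw (fun _ => p.pR) c.2.1 *
        seqLaw (fun _ => quantLaw ch p) c.2.2) * ind (DestTest ch p ε c.1.1 c.1.2 c.2 y z) ≤
      wrongBound (destLaw ch p) splitFirstSecondFourth
        (fun c => p.p11 c.1.1 * p.p21 c.1.2 * quantLaw ch p c.2)
        (joint2 ch p) splitFirstSecondThird (fun c => p.p12 c.1.1 * p.p22 c.1.2 * p.pR c.2)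
        ε n m := by
  have h₁ := sum_seqLaw_ind_typical_le_triple (destLaw_nonneg ch p) splitFirstSecondFourth
    (simplex_nonneg p.p11) (simplex_nonneg p.p21) (quantLaw_mem ch p).1 (fun _ _ h => destLaw_eq_zero ch p (or_assoc.1
      ((mul_eq_zero.1 h).imp mul_eq_zero.1 id))) ε fun i : Fin n => y i
  have h₂ := sum_seqLaw_ind_typical_le_triple (joint2_nonneg ch p) splitFirstSecondThird
    (simplex_nonneg p.p12) (simplex_nonneg p.p22) (simplex_nonneg p.pR) (fun _ _ h => joint2_eq_zero ch p (or_assoc.1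
      ((mul_eq_zero.1 h).imp mul_eq_zero.1 id))) ε fun j : Fin m => z j
  have h := mul_le_mul h₁ h₂ (Finset.sum_nonneg fun a _ =>
    Finset.sum_nonneg fun b _ => Finset.sum_nonneg fun r _ => mul_nonneg (mul_nonneg
      (mul_nonneg (seqLaw_nonneg (fun _ => (simplex_nonneg p.p12)) a) (seqLaw_nonneg (fun _ => (simplex_nonneg p.p22)) b))
      (seqLaw_nonneg (fun _ => (simplex_nonneg p.pR)) r)) (ind_nonneg _)) (by positivity)
  simp only [wordLaw, DestTest, ind_and]
  rw [← sum_mul_factor_triple_swap] at h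
  exact h

end Scheme

section Correct

variable {X₁₁ X₂₁ X₁₂ X₂₂ XR YD1 YR YD2 YQ : Type*}
  [Fintype X₁₁] [Fintype X₂₁] [Fintype X₁₂] [Fintype X₂₂] [Fintype XR]
  [Fintype YD1] [Fintype YR] [Fintype YD2] [Fintype YQ]
  (ch : Channel X₁₁ X₂₁ X₁₂ X₂₂ XR YD1 YR YD2) (p : Inputs X₁₁ X₂₁ X₁₂ X₂₂ XR YR YQ) {n m : ℕ}

/-! #### The words sent -/

/-- The joint law of `(X₁₁, X₂₁, Y_D1)` and `Y_R`. -/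
def obsJoint (v : YR) (x : X₁₁ × X₂₁ × YD1) : ℝ :=
  p.p11 x.1 * p.p21 x.2.1 * ch.slot1 x.1 x.2.1 (x.2.2, v)

/-- The law of the letters received by the relay. -/
def relayLaw : YR → ℝ := law (joint1 ch p) fun s => s.yR

/-- The joint law of the letters received by the relay and of their quantization. -/
def relayPairLaw : YR × YQ → ℝ := law (joint1 ch p) fun s => (s.yR, s.yQ)

theorem obsJoint_nonneg (v : YR) (x : X₁₁ × X₂₁ × YD1) : 0 ≤ obsJoint ch p v x :=
  mul_nonneg (mul_nonneg (simplex_nonneg _ _) (simplex_nonneg _ _)) (simplex_nonneg _ _)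

theorem relayLaw_mem : relayLaw ch p ∈ stdSimplex ℝ YR := law_mem (joint1_mem ch p) _

theorem relayPairLaw_mem : relayPairLaw ch p ∈ stdSimplex ℝ (YR × YQ) := law_mem (joint1_mem ch p) _

theorem sum_obsJoint (v : YR) : ∑ x, obsJoint ch p v x = relayLaw ch p v := by
  rw [relayLaw, law_eq_sum_ind, sum_joint1_mul ch p fun _ _ _ v' => ind (v' = v)]
  simp only [obsJoint, Fintype.sum_prod_type, sum_mul_ind_eq, mul_assoc, ← Finset.mul_sum]

theorem sum_outcome1 (F : X₁₁ × X₂₁ × YD1 → YR × YQ → ℝ) :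
    ∑ s : Outcome1 X₁₁ X₂₁ YD1 YR YQ, F (s.x11, s.x21, s.yD1) (s.yR, s.yQ) = ∑ b, ∑ x, F x b := by
  rw [Finset.sum_comm]
  simp only [Fintype.sum_prod_type]

/-- The quantizer sees `y_R` only. This is the Markov chain `(X₁₁, X₂₁, Y_D1) - Y_R - Ŷ_R` behind
the analysis of the words sent. -/
theorem relayPairLaw_apply (b : YR × YQ) :
    relayPairLaw ch p b = relayLaw ch p b.1 * p.quant b.1 b.2 := by
  have h := sum_outcome1 (X₁₁ := X₁₁) (X₂₁ := X₂₁) (YD1 := YD1)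
    fun x b' => obsJoint ch p b'.1 x * p.quant b'.1 b'.2 * ind (b' = b)
  rw [relayPairLaw, law_eq_sum_ind, ← sum_obsJoint, Finset.sum_mul]
  refine Eq.trans h ?_
  simp only [← Finset.sum_mul, sum_mul_ind_eq]

theorem relayLaw_eq_zero {b : YR × YQ} (h : relayLaw ch p b.1 = 0) : relayPairLaw ch p b = 0 := by
  rw [relayPairLaw_apply, h, zero_mul]

theorem quantLaw_eq_zero {b : YR × YQ} (h : quantLaw ch p b.2 = 0) : relayPairLaw ch p b = 0 := by
  unfold quantLaw at h
  exact law_eq_zero_of_comp (joint1_nonneg ch p) (f := fun c => c.2) h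

/-- Summation over the words of one message of each source and the first output. -/
theorem sum_words_mul (v : Fin n → YR) (G : (Fin n → X₁₁) → (Fin n → X₂₁) → (Fin n → YD1) → ℝ)
    (H : (Fin m → X₁₂) → (Fin m → X₂₂) → ℝ) :
    ∑ a, wordLaw p.p11 p.p12 a * ∑ b, wordLaw p.p21 p.p22 b *
        ∑ y, wordKernel1 ch a b y v * (G a.1 b.1 y * H a.2 b.2) =
      (∑ x, seqLaw (fun i => obsJoint ch p (v i)) x *
        G (fun i => (x i).1) (fun i => (x i).2.1) (fun i => (x i).2.2)) *
      ∑ a, ∑ b, seqLaw (fun _ => p.p12) a * seqLaw (fun _ => p.p22) b * H a b := by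
  have h₁ : ∑ x, seqLaw (fun i => obsJoint ch p (v i)) x *
        G (fun i => (x i).1) (fun i => (x i).2.1) (fun i => (x i).2.2) =
      ∑ a, ∑ b, seqLaw (fun _ => p.p11) a * seqLaw (fun _ => p.p21) b *
        ∑ y : Fin n → YD1, (∏ i, ch.slot1 (a i) (b i) (y i, v i)) * G a b y := by
    have h₂ : ∀ a : Fin n → X₁₁, ∑ b, seqLaw (fun _ => p.p11) a * seqLaw (fun _ => p.p21) b *
        ∑ y : Fin n → YD1, (∏ i, ch.slot1 (a i) (b i) (y i, v i)) * G a b y =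
        ∑ c : Fin n → X₂₁ × YD1, seqLaw (fun _ => p.p11) a *
          seqLaw (fun _ => p.p21) (fun i => (c i).1) *
          ((∏ i, ch.slot1 (a i) (c i).1 ((c i).2, v i)) *
            G a (fun i => (c i).1) fun i => (c i).2) := fun a => by
      simp only [Finset.mul_sum]
      rw [sum_arrow_prod fun b y => seqLaw (fun _ => p.p11) a * seqLaw (fun _ => p.p21) b *
        ((∏ i, ch.slot1 (a i) (b i) (y i, v i)) * G a b y)]
    simp only [h₂]
    rw [sum_arrow_prod fun a (c : Fin n → X₂₁ × YD1) => seqLaw (fun _ => p.p11) a *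
          seqLaw (fun _ => p.p21) (fun i => (c i).1) *
          ((∏ i, ch.slot1 (a i) (c i).1 ((c i).2, v i)) *
            G a (fun i => (c i).1) fun i => (c i).2)]
    refine Finset.sum_congr rfl fun x _ => ?_
    rw [← mul_assoc]
    simp only [seqLaw, obsJoint, Finset.prod_mul_distrib]
  rw [h₁, ← sum_mul_factor_pair]
  conv_rhs => rw [Fintype.sum_prod_type]
  refine Finset.sum_congr rfl fun a _ => ?_
  rw [Finset.mul_sum]
  refine Finset.sum_congr rfl fun b _ => ?_
  simp only [wordLaw, wordKernel1, ← mul_assoc, ← Finset.sum_mul]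

theorem obsLaw_eq (v : Fin n → YR) :
    obsLaw (wordLaw (m := m) p.p11 p.p12) (wordLaw p.p21 p.p22) (wordKernel1 ch) v =
      seqLaw (fun _ => relayLaw ch p) v := by
  have h := sum_words_mul ch p (m := m) v (fun _ _ _ => 1) fun _ _ => 1
  simp only [mul_one] at h
  unfold obsLaw
  rw [h]
  have h₂ : ∑ a : Fin m → X₁₂, ∑ b : Fin m → X₂₂,
      seqLaw (fun _ => p.p12) a * seqLaw (fun _ => p.p22) b = 1 := by
    simp only [← Finset.mul_sum, ← Finset.sum_mul]
    rw [(seqLaw_simplex_mem p.p12).2, (seqLaw_simplex_mem p.p22).2, one_mul]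
  rw [h₂, mul_one]
  unfold seqLaw
  rw [sum_prod_apply]
  simp only [sum_obsJoint]

/-- With a fresh relay word, the four slot 2 sequences together are i.i.d. with law `joint2`. -/
theorem sum_slot2_words (F : (Fin m → X₁₂) → (Fin m → X₂₂) → (Fin m → XR) → (Fin m → YD2) → ℝ) :
    ∑ a, ∑ b, seqLaw (fun _ => p.p12) a * seqLaw (fun _ => p.p22) b *
      ∑ r, seqLaw (fun _ => p.pR) r * ∑ z, (∏ j, ch.slot2 (a j) (b j) (r j) (z j)) * F a b r z =
    ∑ s : Fin m → Outcome2 X₁₂ X₂₂ XR YD2, seqLaw (fun _ => joint2 ch p) s *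
      F (fun j => (s j).x12) (fun j => (s j).x22) (fun j => (s j).xR) (fun j => (s j).yD2) := by
  set Φ : (Fin m → X₁₂) → (Fin m → X₂₂) → (Fin m → XR) → (Fin m → YD2) → ℝ := fun a b r z =>
    seqLaw (fun _ => p.p12) a * seqLaw (fun _ => p.p22) b * seqLaw (fun _ => p.pR) r *
      (∏ j, ch.slot2 (a j) (b j) (r j) (z j)) * F a b r z with hΦ
  have h₁ : ∀ a b r, ∑ z, Φ a b r z = seqLaw (fun _ => p.p12) a * seqLaw (fun _ => p.p22) b *
      (seqLaw (fun _ => p.pR) r * ∑ z, (∏ j, ch.slot2 (a j) (b j) (r j) (z j)) * F a b r z) :=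
    fun a b r => by simp only [hΦ, mul_assoc, ← Finset.mul_sum]
  simp only [Finset.mul_sum _ _ (seqLaw (fun _ => ⇑p.p12) _ * seqLaw (fun _ => ⇑p.p22) _), ← h₁]
  have h₂ : ∀ a b, ∑ r, ∑ z, Φ a b r z = ∑ c : Fin m → XR × YD2,
      Φ a b (fun j => (c j).1) fun j => (c j).2 := fun a b => sum_arrow_prod _
  have h₃ : ∀ a, ∑ b, ∑ c : Fin m → XR × YD2, Φ a b (fun j => (c j).1) (fun j => (c j).2) =
      ∑ c : Fin m → X₂₂ × XR × YD2,
      Φ a (fun j => (c j).1) (fun j => (c j).2.1) fun j => (c j).2.2 := fun a =>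
    sum_arrow_prod fun b (c : Fin m → XR × YD2) => Φ a b (fun j => (c j).1) fun j => (c j).2
  simp only [h₂, h₃]
  rw [sum_arrow_prod fun a (c : Fin m → X₂₂ × XR × YD2) =>
    Φ a (fun j => (c j).1) (fun j => (c j).2.1) fun j => (c j).2.2]
  refine Finset.sum_congr rfl fun s _ => ?_
  simp only [hΦ, seqLaw, joint2, Finset.prod_mul_distrib]

/-- The words sent pass the destination's test with high probability, whatever the relay received
and whichever compatible index it chose. -/
theorem exists_sum_destTest_fails_le {ε' ε : ℝ} (hε' : 0 < ε') (hε : ε' < ε) :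
    ∃ C₁ C₂ : ℝ, 0 ≤ C₁ ∧ 0 ≤ C₂ ∧ ∀ (n m : ℕ) (v : Fin n → YR) (q : Fin n → YQ),
      RelayTest ch p ε' v q →
      ∑ a : (Fin n → X₁₁) × (Fin m → X₁₂), wordLaw p.p11 p.p12 a * ∑ b, wordLaw p.p21 p.p22 b * ∑ y, wordKernel1 ch a b y v *
        ∑ r, seqLaw (fun _ => p.pR) r * ∑ z, wordKernel2 ch a b r z *
          ind (¬DestTest ch p ε a b (r, q) y z) ≤
      (C₁ / n + C₂ / m) *
        obsLaw (wordLaw (m := m) p.p11 p.p12) (wordLaw p.p21 p.p22) (wordKernel1 ch) v := by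
  -- The kernel is the conditional law of `(x₁₁, x₂₁, y_D1)` given `y_R`. By the Markov chain,
  -- further conditioning on `ŷ_R` would not change it, so this kernel and the pair law compose to
  -- `destLaw`.
  obtain ⟨C₁, hC₁, H₁⟩ := exists_sum_ind_not_typical_le (relayPairLaw_mem ch p).1
    (w := fun b x => obsJoint ch p b.1 x / relayLaw ch p b.1)
    (fun b hb => by
      have hb' : relayLaw ch p b.1 ≠ 0 := fun h => hb (relayLaw_eq_zero ch p h)
      refine ⟨fun x => div_nonneg (obsJoint_nonneg ch p _ _) ((relayLaw_mem ch p).1 _), ?_⟩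
      rw [← Finset.sum_div, sum_obsJoint, div_self hb'])
    (fun x b => (x.1, x.2.1, x.2.2, b.2)) (q := destLaw ch p)
    (fun c => by
      have h := sum_outcome1 fun (x : X₁₁ × X₂₁ × YD1) (b : YR × YQ) =>
        obsJoint ch p b.1 x * p.quant b.1 b.2 * ind ((x.1, x.2.1, x.2.2, b.2) = c)
      rw [destLaw, law_eq_sum_ind]
      refine Eq.trans h (Finset.sum_congr rfl fun b _ => ?_)
      rw [Finset.mul_sum]
      refine Finset.sum_congr rfl fun x _ => ?_
      rw [relayPairLaw_apply]
      by_cases hb : relayLaw ch p b.1 = 0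
      · have : obsJoint ch p b.1 x = 0 :=
          (Finset.sum_eq_zero_iff_of_nonneg fun x _ => obsJoint_nonneg ch p b.1 x).1
            ((sum_obsJoint ch p b.1).trans hb) x (Finset.mem_univ x)
        rw [this, hb]
        simp
      · field_simp) hε
  obtain ⟨C₂, hC₂, H₂⟩ := exists_sum_seqLaw_ind_not_typical_le (joint2_mem ch p) (hε'.trans hε)
  refine ⟨C₁, C₂, hC₁, hC₂, fun n m v q hvq => ?_⟩
  have hobs₀ : 0 ≤ seqLaw (fun _ => relayLaw ch p) v := seqLaw_nonneg (fun _ => (relayLaw_mem ch p).1) v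
  -- Compatibility of `(v, q)` rules out letters of probability zero, so the joint weight is the
  -- conditional law times the law of `v`.
  have hpos : ∀ i, relayLaw ch p (v i) ≠ 0 := fun i h =>
    (Typical.pos (relayPairLaw_mem ch p).1 hvq i).ne' (relayLaw_eq_zero ch p (b := (v i, q i)) h)
  have hR := seqLaw_simplex_mem (ι := Fin m) p.pR
  set T₁ : (Fin n → X₁₁) → (Fin n → X₂₁) → (Fin n → YD1) → Prop := fun a b y =>
    Typical (destLaw ch p) ε fun i => (a i, b i, y i, q i) with hT₁
  set T₂ : (Fin m → X₁₂) → (Fin m → X₂₂) → (Fin m → XR) → (Fin m → YD2) → Prop := fun a b r z =>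
    Typical (joint2 ch p) ε fun j => (a j, b j, r j, z j) with hT₂
  have hsplit : ∀ a b y, ∑ r, seqLaw (fun _ => p.pR) r * ∑ z, wordKernel2 ch a b r z *
      ind (¬DestTest ch p ε a b (r, q) y z) ≤ ind (¬T₁ a.1 b.1 y) +
      ∑ r, seqLaw (fun _ => p.pR) r * ∑ z, (∏ j, ch.slot2 (a.2 j) (b.2 j) (r j) (z j)) *
        ind (¬T₂ a.2 b.2 r z) := fun a b y => by
    have h1 : ind (¬T₁ a.1 b.1 y) = ∑ r, seqLaw (fun _ => p.pR) r * ∑ z, wordKernel2 ch a b r z *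
        ind (¬T₁ a.1 b.1 y) := by
      simp only [← Finset.sum_mul, (wordKernel2_mem ch a b _).2, one_mul]
      rw [hR.2, one_mul]
    rw [h1, ← Finset.sum_add_distrib]
    refine Finset.sum_le_sum fun r _ => ?_
    rw [← mul_add, ← Finset.sum_add_distrib]
    refine mul_le_mul_of_nonneg_left (Finset.sum_le_sum fun z _ => ?_) (hR.1 r)
    refine le_trans (mul_le_mul_of_nonneg_left ?_ ((wordKernel2_mem ch a b r).1 z))
      (le_of_eq (mul_add _ _ _))
    refine le_trans (ind_mono fun h => ?_) (ind_or_le _ _)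
    exact not_and_or.1 h
  have hA := sum_words_mul ch p (m := m) v (fun a b y => ind (¬T₁ a b y)) fun _ _ => 1
  have hB := sum_words_mul ch p v (fun _ _ _ => 1) fun a b =>
    ∑ r, seqLaw (fun _ => p.pR) r * ∑ z, (∏ j, ch.slot2 (a j) (b j) (r j) (z j)) *
        ind (¬T₂ a b r z)
  have hmass : ∑ a : Fin m → X₁₂, ∑ b : Fin m → X₂₂,
      seqLaw (fun _ => p.p12) a * seqLaw (fun _ => p.p22) b = 1 := by
    simp only [← Finset.mul_sum, ← Finset.sum_mul]
    rw [(seqLaw_simplex_mem p.p12).2, (seqLaw_simplex_mem p.p22).2, one_mul]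
  have hmass' : ∑ x, seqLaw (fun i => obsJoint ch p (v i)) x = seqLaw (fun _ => relayLaw ch p) v := by
    unfold seqLaw
    rw [sum_prod_apply]
    simp only [sum_obsJoint]
  have hA' : ∑ x, seqLaw (fun i => obsJoint ch p (v i)) x *
      ind (¬T₁ (fun i => (x i).1) (fun i => (x i).2.1) fun i => (x i).2.2) ≤
      C₁ / n * seqLaw (fun _ => relayLaw ch p) v := by
    rw [mul_comm]
    refine le_trans (le_of_eq ?_) (mul_le_mul_of_nonneg_left (H₁ n (fun i => (v i, q i)) hvq) hobs₀)
    rw [Finset.mul_sum]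
    refine Finset.sum_congr rfl fun x _ => ?_
    rw [← mul_assoc]
    congr 1
    unfold seqLaw
    rw [← Finset.prod_mul_distrib]
    exact Finset.prod_congr rfl fun i _ => (mul_div_cancel₀ _ (hpos i)).symm
  rw [obsLaw_eq, add_mul]
  calc _ ≤ ∑ a, wordLaw p.p11 p.p12 a * ∑ b, wordLaw p.p21 p.p22 b * ∑ y, wordKernel1 ch a b y v *
        (ind (¬T₁ a.1 b.1 y) + ∑ r, seqLaw (fun _ => p.pR) r *
          ∑ z, (∏ j, ch.slot2 (a.2 j) (b.2 j) (r j) (z j)) * ind (¬T₂ a.2 b.2 r z)) :=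
        Finset.sum_le_sum fun a _ => mul_le_mul_of_nonneg_left (Finset.sum_le_sum fun b _ =>
          mul_le_mul_of_nonneg_left (Finset.sum_le_sum fun y _ =>
            mul_le_mul_of_nonneg_left (hsplit a b y) (wordKernel1_nonneg ch a b y v))
          ((wordLaw_mem p.p21.2 p.p22.2).1 b)) ((wordLaw_mem p.p11.2 p.p12.2).1 a)
    _ ≤ _ := by
        simp only [mul_add, Finset.sum_add_distrib]
        simp only [mul_one, one_mul] at hA hB
        rw [hA, hB, hmass, mul_one, hmass', sum_slot2_words ch p fun a b r z => ind (¬T₂ a b r z)]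
        refine add_le_add hA' ?_
        rw [mul_comm]
        exact mul_le_mul_of_nonneg_right (H₂ m) hobs₀

/-! #### The relay -/

/-- `(1 - x) ^ M ≤ exp (-a M δ)`, and convexity of `exp` on the segment from `0` to `-M δ` bounds
this by `(1 - a) + a exp (-M δ)`. Here `a` is the conditional probability of compatibility; no
separate treatment of atypical observations is needed. -/
theorem one_sub_pow_le {x a δ : ℝ} (ha₀ : 0 ≤ a) (ha₁ : a ≤ 1) (hx : a * δ ≤ x) (hx₁ : x ≤ 1)
    (M : ℕ) : (1 - x) ^ M ≤ 1 - a + Real.exp (-(M * δ)) := by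
  have h₁ : (1 - x) ^ M ≤ Real.exp (-(a * (M * δ))) := by
    calc (1 - x) ^ M ≤ Real.exp (-(a * δ)) ^ M :=
          pow_le_pow_left₀ (by linarith) (by linarith [Real.one_sub_le_exp_neg (a * δ)]) M
      _ = _ := by
          rw [← Real.exp_nat_mul]
          congr 1
          ring
  have h₂ := convexOn_exp.2 (Set.mem_univ 0) (Set.mem_univ (-(M * δ))) (sub_nonneg.2 ha₁) ha₀
    (by ring)
  simp only [smul_eq_mul, mul_zero, zero_add, Real.exp_zero, mul_one] at h₂
  have h₃ : a * Real.exp (-(M * δ)) ≤ Real.exp (-(M * δ)) :=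
    mul_le_of_le_one_left (Real.exp_pos _).le ha₁
  calc _ ≤ _ := h₁
    _ = Real.exp (a * -(M * δ)) := by
        congr 1
        ring
    _ ≤ _ := by linarith

/-- The relay finds a compatible index with high probability. -/
theorem exists_sum_relay_fails_le {ε : ℝ} (hε : 0 < ε) :
    ∃ C : ℝ, 0 ≤ C ∧ ∀ n M : ℕ, ∑ v : Fin n → YR, seqLaw (fun _ => relayLaw ch p) v *
        (1 - ∑ q, seqLaw (fun _ => quantLaw ch p) q * ind (RelayTest ch p ε v q)) ^ M ≤
      C / n + Real.exp (-(M * (2 : ℝ) ^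
        (-(n * (divergence (relayPairLaw ch p) (Equiv.prodComm YQ YR) (quantLaw ch p) +
          ε * absDivergence (relayPairLaw ch p) (Equiv.prodComm YQ YR) (quantLaw ch p)))))) := by
  obtain ⟨C, hC, H⟩ := exists_sum_seqLaw_ind_not_typical_le (relayPairLaw_mem ch p) hε
  refine ⟨C, hC, fun n M => ?_⟩
  set e := Equiv.prodComm YQ YR with he
  set δ := (2 : ℝ) ^ (-(n * (divergence (relayPairLaw ch p) e (quantLaw ch p) +
          ε * absDivergence (relayPairLaw ch p) e (quantLaw ch p))))
  have hpair := relayPairLaw_mem ch p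
  have hmarg : ∀ v, ∑ q, relayPairLaw ch p (e (q, v)) = relayLaw ch p v := fun v =>
    sum_law_equiv _ _ e v
  have hcond : ∀ v q, relayLaw ch p v * condProb (relayPairLaw ch p) e v q =
      relayPairLaw ch p (v, q) := fun v q => by
    unfold condProb
    rw [hmarg]
    by_cases h : relayLaw ch p v = 0
    · rw [h, zero_mul, relayLaw_eq_zero ch p (b := (v, q)) h]
    · exact mul_div_cancel₀ _ h
  -- `a v` is the probability that a word drawn from the true conditional law given `v` is
  -- compatible with `v`. The change of measure bounds the probability for an independent word below
  -- by `a v * δ`.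
  set a : (Fin n → YR) → ℝ := fun v => ∑ q : Fin n → YQ,
    seqLaw (fun i => condProb (relayPairLaw ch p) e (v i)) q * ind (RelayTest ch p ε v q) with ha
  have ha₀ : ∀ v, 0 ≤ a v := fun v => Finset.sum_nonneg fun q _ =>
    mul_nonneg (seqLaw_nonneg (fun i => condProb_nonneg hpair.1 e (v i)) q) (ind_nonneg _)
  have ha₁ : ∀ v, a v ≤ 1 := fun v => by
    calc a v ≤ ∑ q : Fin n → YQ, seqLaw (fun i => condProb (relayPairLaw ch p) e (v i)) q :=
          Finset.sum_le_sum fun q _ => mul_ind_le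
            (seqLaw_nonneg (fun i => condProb_nonneg hpair.1 e (v i)) q) _
      _ ≤ 1 := by
          unfold seqLaw
          rw [sum_prod_apply]
          exact Finset.prod_le_one
            (fun i _ => Finset.sum_nonneg fun q _ => condProb_nonneg hpair.1 e _ q)
            fun i _ => sum_condProb_le_one _ e _
  have hquant := seqLaw_mem fun _ : Fin n => quantLaw_mem ch p
  have hrelay := seqLaw_mem fun _ : Fin n => relayLaw_mem ch p
  have hpow : ∀ v, (1 - ∑ q, seqLaw (fun _ => quantLaw ch p) q *
      ind (RelayTest ch p ε v q)) ^ M ≤ 1 - a v + Real.exp (-(M * δ)) := fun v => by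
    refine one_sub_pow_le (ha₀ v) (ha₁ v) ?_ ?_ M
    · exact le_sum_seqLaw_ind_typical hpair.1 e (quantLaw_mem ch p).1
        (fun q v h => quantLaw_eq_zero ch p (b := (v, q)) h) ε v
    · rw [← hquant.2]
      exact Finset.sum_le_sum fun q _ => mul_ind_le (hquant.1 q) _
  -- Averaged over `v`, the conditional draw becomes an i.i.d. draw of pairs, so the mean of `1 - a
  -- v` is the probability that an i.i.d. sequence is atypical.
  have hmean : ∑ v, seqLaw (fun _ => relayLaw ch p) v * a v =
      1 - ∑ s : Fin n → YR × YQ, seqLaw (fun _ => relayPairLaw ch p) s *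
        ind (¬Typical (relayPairLaw ch p) ε s) := by
    simp only [ha, Finset.mul_sum]
    rw [sum_arrow_prod fun v q => seqLaw (fun _ => relayLaw ch p) v *
      (seqLaw (fun i => condProb (relayPairLaw ch p) e (v i)) q * ind (RelayTest ch p ε v q))]
    rw [← (seqLaw_mem fun _ : Fin n => hpair).2, ← Finset.sum_sub_distrib]
    refine Finset.sum_congr rfl fun s _ => ?_
    rw [ind_not, mul_sub, mul_one, sub_sub_cancel, ← mul_assoc]
    congr 1
    unfold seqLaw
    rw [← Finset.prod_mul_distrib]
    exact Finset.prod_congr rfl fun i _ => hcond _ _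
  calc _ ≤ ∑ v, seqLaw (fun _ => relayLaw ch p) v * (1 - a v + Real.exp (-(M * δ))) :=
        Finset.sum_le_sum fun v _ => mul_le_mul_of_nonneg_left (hpow v) (hrelay.1 v)
    _ = (1 - ∑ v, seqLaw (fun _ => relayLaw ch p) v * a v) + Real.exp (-(M * δ)) := by
        simp only [mul_add, mul_sub, mul_one, Finset.sum_add_distrib, Finset.sum_sub_distrib,
          ← Finset.sum_mul]
        rw [hrelay.2, one_mul]
    _ ≤ _ := by
        rw [hmean]
        linarith [H n]

end Correct

/-! ### From the scheme to the abstract bound -/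

section Ensemble

variable {X₁₁ X₂₁ X₁₂ X₂₂ XR YD1 YR YD2 YQ : Type*}
  [Fintype X₁₁] [Fintype X₂₁] [Fintype X₁₂] [Fintype X₂₂] [Fintype XR]
  [Fintype YD1] [Fintype YR] [Fintype YD2] [Fintype YQ]
  (ch : Channel X₁₁ X₂₁ X₁₂ X₂₂ XR YD1 YR YD2) (p : Inputs X₁₁ X₂₁ X₁₂ X₂₂ XR YR YQ)
  {W₁ W₂ U : Type} [Fintype W₁] [Fintype W₂] [Fintype U] [Nonempty U] {n m : ℕ}

/-! #### The error probability of the scheme -/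

omit [Fintype W₁] [Fintype W₂] in
theorem toCode_dec_eq_some_iff (c : Codebook X₁₁ X₂₁ X₁₂ X₂₂ XR YQ W₁ W₂ U n m) (ε' ε : ℝ)
    (y : Fin n → YD1) (z : Fin m → YD2) (w : W₁ × W₂) :
    (c.toCode ch p ε' ε).dec y z = some w ↔
      DestTypical ch p ε c y z w ∧ ∀ w', DestTypical ch p ε c y z w' → w' = w := by
  simp only [Codebook.toCode]
  split_ifs with h
  · constructor
    · intro h'
      have hw : h.choose = w := Option.some.inj h'
      rw [← hw]
      exact h.choose_spec
    · intro h'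
      rw [h.unique h.choose_spec.1 h'.1]
  · simp only [false_iff]
    exact fun h' => h ⟨w, h'.1, h'.2⟩

-- The relay's kernel is the push-forward of the law of its index; undoing this restores the index
-- as part of the outcome, even if two indices share a relay word.
omit [Fintype W₁] [Fintype W₂] in
theorem sum_relay_mul (c : Codebook X₁₁ X₂₁ X₁₂ X₂₂ XR YQ W₁ W₂ U n m) (ε' ε : ℝ) (v : Fin n → YR)
    (F : (Fin m → XR) → ℝ) :
    ∑ x, (c.toCode ch p ε' ε).relay v x * F x = ∑ u, relayIndexProb ch p ε' c v u * F (c.xR u) := by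
  classical
  have h : ∀ x, (c.toCode ch p ε' ε).relay v x =
      ∑ u, relayIndexProb ch p ε' c v u * ind (x = c.xR u) := fun x => by
    change (∑ u, if c.xR u = x then relayIndexProb ch p ε' c v u else 0) = _
    refine Finset.sum_congr rfl fun u _ => ?_
    by_cases hx : c.xR u = x
    · rw [if_pos hx, ind_of hx.symm, mul_one]
    · rw [if_neg hx, ind_of_not fun h => hx h.symm, mul_zero]
  simp only [h, Finset.sum_mul]
  rw [Finset.sum_comm]
  refine Finset.sum_congr rfl fun u _ => ?_
  simp only [mul_assoc, ← Finset.mul_sum, ind_sum_eq]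

/-- The codebook that consists of given words. -/
def toCodebook (g : (W₁ → (Fin n → X₁₁) × (Fin m → X₁₂)) × (W₂ → (Fin n → X₂₁) × (Fin m → X₂₂)) ×
    (U → (Fin m → XR) × (Fin n → YQ))) : Codebook X₁₁ X₂₁ X₁₂ X₂₂ XR YQ W₁ W₂ U n m where
  x11 w := (g.1 w).1
  x12 w := (g.1 w).2
  x21 w := (g.2.1 w).1
  x22 w := (g.2.1 w).2
  xR u := (g.2.2 u).1
  yQ u := (g.2.2 u).2

theorem errorProb_toCode (g : (W₁ → (Fin n → X₁₁) × (Fin m → X₁₂)) ×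
    (W₂ → (Fin n → X₂₁) × (Fin m → X₂₂)) × (U → (Fin m → XR) × (Fin n → YQ))) (ε' ε : ℝ) :
    ((toCodebook g).toCode ch p ε' ε).errorProb ch =
      1 / ((Fintype.card W₁ : ℝ) * Fintype.card W₂) * ∑ w₁, ∑ w₂, ∑ o,
        outcomeLaw (wordKernel1 ch) (wordKernel2 ch)
          (fun v => selProb fun u => RelayTest ch p ε' v (g.2.2 u).2) (g.1 w₁) (g.2.1 w₂) g.2.2 o *
        ind (¬((∃ u, DestTest ch p ε (g.1 w₁) (g.2.1 w₂) (g.2.2 u) o.1 o.2.2.2) ∧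
          ∀ w : W₁ × W₂, (∃ u, DestTest ch p ε (g.1 w.1) (g.2.1 w.2) (g.2.2 u) o.1 o.2.2.2) →
            w = (w₁, w₂))) := by
  unfold Code.errorProb
  congr 1
  refine Finset.sum_congr rfl fun w₁ _ => Finset.sum_congr rfl fun w₂ _ => ?_
  rw [sum_outcomeLaw_mul _ _ _ _ fun y _ _ z =>
    ind (¬((∃ u, DestTest ch p ε (g.1 w₁) (g.2.1 w₂) (g.2.2 u) y z) ∧
          ∀ w : W₁ × W₂, (∃ u, DestTest ch p ε (g.1 w.1) (g.2.1 w.2) (g.2.2 u) y z) →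
            w = (w₁, w₂)))]
  refine Finset.sum_congr rfl fun y _ => Finset.sum_congr rfl fun v _ => ?_
  have hrelay := sum_relay_mul ch p (toCodebook g) ε' ε v fun x =>
    ∑ z, wordKernel2 ch (g.1 w₁) (g.2.1 w₂) x z *
    ind (¬((∃ u, DestTest ch p ε (g.1 w₁) (g.2.1 w₂) (g.2.2 u) y z) ∧
          ∀ w : W₁ × W₂, (∃ u, DestTest ch p ε (g.1 w.1) (g.2.1 w.2) (g.2.2 u) y z) →
            w = (w₁, w₂)))
  -- For the codebook `toCodebook g`, `relayIndexProb` unfolds to `selProb` of the relay's test, so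
  -- the right-hand sides agree by definition.
  refine Eq.trans ?_ (congrArg (fun t => wordKernel1 ch (g.1 w₁) (g.2.1 w₂) y v * t) hrelay)
  rw [Finset.mul_sum]
  refine Finset.sum_congr rfl fun x _ => ?_
  rw [Finset.mul_sum, Finset.mul_sum]
  refine Finset.sum_congr rfl fun z _ => ?_
  rw [← mul_assoc, ← mul_assoc]
  refine congrArg₂ (· * ·) rfl ?_
  by_cases h : ((toCodebook g).toCode ch p ε' ε).dec y z = some (w₁, w₂)
  · rw [if_pos h]
    exact (ind_of_not (not_not.2 ((toCode_dec_eq_some_iff ch p _ ε' ε y z _).1 h))).symm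
  · rw [if_neg h]
    exact (ind_of fun h' => h ((toCode_dec_eq_some_iff ch p _ ε' ε y z _).2 h')).symm

variable [DecidableEq W₁] [DecidableEq W₂] [DecidableEq U]

theorem ensembleError_eq (ε' ε : ℝ) :
    ensembleError W₁ W₂ U n m ch p ε' ε =
      ∑ g : (W₁ → (Fin n → X₁₁) × (Fin m → X₁₂)) × (W₂ → (Fin n → X₂₁) × (Fin m → X₂₂)) ×
          (U → (Fin m → XR) × (Fin n → YQ)),
        bookLaw (wordLaw p.p11 p.p12) (wordLaw p.p21 p.p22) (seqLaw fun _ => p.pR)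
          (seqLaw fun _ => quantLaw ch p) g * ((toCodebook g).toCode ch p ε' ε).errorProb ch := by
  unfold ensembleError
  rw [sum_arrow_prod, Fintype.sum_prod_type]
  refine Finset.sum_congr rfl fun g₁ _ => ?_
  rw [sum_arrow_prod, Fintype.sum_prod_type]
  refine Finset.sum_congr rfl fun g₂ _ => ?_
  rw [sum_arrow_prod]
  refine Finset.sum_congr rfl fun g₃ _ => congrArg₂ (· * ·) ?_ rfl
  simp only [bookLaw, wordLaw, seqLaw, Finset.prod_mul_distrib, quantLaw]
  ring

/-- The random coding bound for the scheme. -/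
theorem exists_ensembleError_le {ε' ε : ℝ} (hε' : 0 < ε') (hε : ε' < ε) :
    ∃ C₀ C₁ C₂ : ℝ, 0 ≤ C₀ ∧ 0 ≤ C₁ ∧ 0 ≤ C₂ ∧ ∀ (W₁ W₂ U : Type) [Fintype W₁] [Fintype W₂]
      [Fintype U] [Nonempty W₁] [Nonempty W₂] [Nonempty U] [DecidableEq W₁] [DecidableEq W₂]
      [DecidableEq U] (n m : ℕ), ensembleError W₁ W₂ U n m ch p ε' ε ≤
      C₀ / n + Real.exp (-(Fintype.card U * (2 : ℝ) ^
        (-(n * (divergence (relayPairLaw ch p) (Equiv.prodComm YQ YR) (quantLaw ch p) +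
          ε' * absDivergence (relayPairLaw ch p) (Equiv.prodComm YQ YR) (quantLaw ch p)))))) +
      (C₁ / n + C₂ / m) +
      (Fintype.card W₁ * wrongBound (destLaw ch p) (Equiv.refl _) (fun a => p.p11 a)
          (joint2 ch p) (Equiv.refl _) (fun a => p.p12 a) ε n m +
        Fintype.card W₁ * Fintype.card U * wrongBound (destLaw ch p) splitFirstFourth
          (fun c => p.p11 c.1 * quantLaw ch p c.2)
          (joint2 ch p) splitFirstThird (fun c => p.p12 c.1 * p.pR c.2) ε n m) +
      (Fintype.card W₂ * wrongBound (destLaw ch p) splitSecond (fun a => p.p21 a)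
          (joint2 ch p) splitSecond (fun a => p.p22 a) ε n m +
        Fintype.card W₂ * Fintype.card U * wrongBound (destLaw ch p) splitSecondFourth
          (fun c => p.p21 c.1 * quantLaw ch p c.2)
          (joint2 ch p) splitSecondThird (fun c => p.p22 c.1 * p.pR c.2) ε n m) +
      (Fintype.card W₁ * Fintype.card W₂ * wrongBound (destLaw ch p) splitFirstSecond
          (fun c => p.p11 c.1 * p.p21 c.2)
          (joint2 ch p) splitFirstSecond (fun c => p.p12 c.1 * p.p22 c.2) ε n m +
        Fintype.card W₁ * Fintype.card W₂ * Fintype.card U *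
          wrongBound (destLaw ch p) splitFirstSecondFourth
          (fun c => p.p11 c.1.1 * p.p21 c.1.2 * quantLaw ch p c.2)
          (joint2 ch p) splitFirstSecondThird (fun c => p.p12 c.1.1 * p.p22 c.1.2 * p.pR c.2)
          ε n m) := by
  obtain ⟨C₀, hC₀, H₀⟩ := exists_sum_relay_fails_le ch p hε'
  obtain ⟨C₁, C₂, hC₁, hC₂, H₁⟩ := exists_sum_destTest_fails_le ch p hε' hε
  refine ⟨C₀, C₁, C₂, hC₀, hC₁, hC₂, ?_⟩
  intro W₁ W₂ U _ _ _ _ _ _ _ _ _ n m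
  have hrelay := H₀ n (Fintype.card U)
  simp only [← obsLaw_eq ch p (m := m)] at hrelay
  have key := sum_error_le (W₁ := W₁) (W₂ := W₂) (U := U) (S := RelayTest ch p ε')
    (T := DestTest ch p ε) (P₁ := wordLaw p.p11 p.p12) (P₂ := wordLaw p.p21 p.p22)
    (PR := seqLaw fun _ => p.pR) (PQ := seqLaw fun _ => quantLaw ch p)
    (k₁ := wordKernel1 ch) (k₂ := wordKernel2 ch)
    (wordLaw_mem (n := n) (m := m) p.p11.2 p.p12.2) (wordLaw_mem (n := n) (m := m) p.p21.2 p.p22.2)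
    (seqLaw_simplex_mem p.pR) (seqLaw_mem fun _ => quantLaw_mem ch p) (sum_wordKernel1 ch)
    (wordKernel1_nonneg ch) (wordKernel2_mem ch)
    hrelay (by positivity) (H₁ n m)
    (wrongBound_nonneg _ _ _ _ _ _ _ _ _) (wrongBound_nonneg _ _ _ _ _ _ _ _ _)
    (wrongBound_nonneg _ _ _ _ _ _ _ _ _) (wrongBound_nonneg _ _ _ _ _ _ _ _ _)
    (wrongBound_nonneg _ _ _ _ _ _ _ _ _) (wrongBound_nonneg _ _ _ _ _ _ _ _ _)
    (sum_destTest_first_le ch p ε) (sum_destTest_second_le ch p ε)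
    (sum_destTest_firstSecond_le ch p ε) (sum_destTest_firstIndex_le ch p ε)
    (sum_destTest_secondIndex_le ch p ε) (sum_destTest_firstSecondIndex_le ch p ε)
  rw [ensembleError_eq]
  simp only [errorProb_toCode]
  set P := bookLaw (W₁ := W₁) (W₂ := W₂) (U := U) (wordLaw (n := n) (m := m) p.p11 p.p12)
    (wordLaw (n := n) (m := m) p.p21 p.p22) (seqLaw fun _ : Fin m => p.pR)
    (seqLaw fun _ : Fin n => quantLaw ch p)
  have hc : (0 : ℝ) < (Fintype.card W₁ : ℝ) * Fintype.card W₂ := by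
    have h₁ := Fintype.card_pos (α := W₁)
    have h₂ := Fintype.card_pos (α := W₂)
    positivity
  have havg : ∀ (E : _ → W₁ → W₂ → ℝ) {b : ℝ}, (∀ w₁ w₂, ∑ g, P g * E g w₁ w₂ ≤ b) →
      ∑ g, P g * (1 / ((Fintype.card W₁ : ℝ) * Fintype.card W₂) * ∑ w₁, ∑ w₂, E g w₁ w₂) ≤ b := by
    intro E b hE
    have h : ∑ g, P g * (1 / ((Fintype.card W₁ : ℝ) * Fintype.card W₂) * ∑ w₁, ∑ w₂, E g w₁ w₂) =
        1 / ((Fintype.card W₁ : ℝ) * Fintype.card W₂) * ∑ w₁, ∑ w₂, ∑ g, P g * E g w₁ w₂ := by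
      simp only [Finset.mul_sum]
      rw [Finset.sum_comm]
      refine Finset.sum_congr rfl fun w₁ _ => ?_
      rw [Finset.sum_comm]
      refine Finset.sum_congr rfl fun w₂ _ => Finset.sum_congr rfl fun g _ => by ring
    rw [h, one_div, inv_mul_le_iff₀ hc]
    calc _ ≤ ∑ _w₁ : W₁, ∑ _w₂ : W₂, b := Finset.sum_le_sum fun w₁ _ =>
          Finset.sum_le_sum fun w₂ _ => hE w₁ w₂
      _ = _ := by
          simp only [Finset.sum_const, Finset.card_univ, nsmul_eq_mul, mul_assoc]
  exact havg _ key

/-- Some codebook is at least as good as the average. -/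
theorem exists_codebook_errorProb_le {ε' ε η : ℝ} (h : ensembleError W₁ W₂ U n m ch p ε' ε ≤ η) :
    ∃ c : Codebook X₁₁ X₂₁ X₁₂ X₂₂ XR YQ W₁ W₂ U n m,
      (c.toCode ch p ε' ε).errorProb ch ≤ η := by
  by_contra hne
  push Not at hne
  rw [ensembleError_eq] at h
  set P := bookLaw (W₁ := W₁) (W₂ := W₂) (U := U) (wordLaw (n := n) (m := m) p.p11 p.p12)
    (wordLaw (n := n) (m := m) p.p21 p.p22) (seqLaw fun _ : Fin m => p.pR)
    (seqLaw fun _ : Fin n => quantLaw ch p)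
  have hP : P ∈ stdSimplex ℝ ((W₁ → (Fin n → X₁₁) × (Fin m → X₁₂)) ×
      (W₂ → (Fin n → X₂₁) × (Fin m → X₂₂)) × (U → (Fin m → XR) × (Fin n → YQ))) := bookLaw_mem (wordLaw_mem p.p11.2 p.p12.2)
    (wordLaw_mem p.p21.2 p.p22.2) (seqLaw_simplex_mem p.pR) (seqLaw_mem fun _ => quantLaw_mem ch p)
  have hpos : ∃ g ∈ Finset.univ, 0 < P g := by
    refine Finset.exists_lt_of_sum_lt (f := fun _ => (0 : ℝ)) ?_
    rw [Finset.sum_const_zero, hP.2]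
    exact zero_lt_one
  obtain ⟨g₀, -, hg₀⟩ := hpos
  refine absurd h (not_le.2 ?_)
  calc η = ∑ g, P g * η := by rw [← Finset.sum_mul, hP.2, one_mul]
    _ < _ := Finset.sum_lt_sum
        (fun g _ => mul_le_mul_of_nonneg_left (hne _).le (hP.1 g))
        ⟨g₀, Finset.mem_univ _, mul_lt_mul_of_pos_left (hne _) hg₀⟩

end Ensemble

section Asymptotics

open Filter Topology

/-! #### Block lengths -/

/-- The pairs of slot lengths `(n, m)` with `n = β (n + m)`, as `n + m → ∞`. -/
def blockLengths (β : ℚ) : Filter (ℕ × ℕ) :=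
  comap (fun x => x.1 + x.2) atTop ⊓ 𝓟 {x | (x.1 : ℚ) = β * ((x.1 + x.2 : ℕ) : ℚ)}

variable {β : ℚ}

theorem exists_forall_of_eventually_blockLengths {P : ℕ × ℕ → Prop}
    (h : ∀ᶠ x in blockLengths β, P x) :
    ∃ L : ℕ, ∀ n m : ℕ, L ≤ n + m → (n : ℚ) = β * ((n + m : ℕ) : ℚ) → P (n, m) := by
  rw [blockLengths, eventually_inf_principal, eventually_comap] at h
  obtain ⟨L, hL⟩ := eventually_atTop.1 h
  exact ⟨L, fun n m hl hn => hL (n + m) hl (n, m) rfl hn⟩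

theorem eventually_fst_eq : ∀ᶠ x in blockLengths β, (x.1 : ℝ) = β * ((x.1 + x.2 : ℕ) : ℝ) := by
  rw [blockLengths, eventually_inf_principal]
  refine Eventually.of_forall fun x (hx : (x.1 : ℚ) = _) => ?_
  have := congrArg (fun t : ℚ => (t : ℝ)) hx
  simpa using this

theorem eventually_snd_eq :
    ∀ᶠ x in blockLengths β, (x.2 : ℝ) = (1 - β) * ((x.1 + x.2 : ℕ) : ℝ) := by
  filter_upwards [eventually_fst_eq (β := β)] with x hx
  rw [sub_mul, ← hx]
  push_cast
  ring

theorem tendsto_blockLengths :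
    Tendsto (fun x : ℕ × ℕ => ((x.1 + x.2 : ℕ) : ℝ)) (blockLengths β) atTop :=
  tendsto_natCast_atTop_atTop.comp (tendsto_comap.mono_left inf_le_left)

/-- True also for `γ = 0`, where the function is `0` by the convention for division; this covers `β
= 0` and `β = 1`. -/
theorem tendsto_div_mul_blockLengths (C γ : ℝ) :
    Tendsto (fun x : ℕ × ℕ => C / (γ * ((x.1 + x.2 : ℕ) : ℝ))) (blockLengths β) (𝓝 0) := by
  simp only [← div_div]
  exact tendsto_blockLengths.const_div_atTop _

theorem tendsto_div_fst (C : ℝ) :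
    Tendsto (fun x : ℕ × ℕ => C / (x.1 : ℝ)) (blockLengths β) (𝓝 0) :=
  (tendsto_div_mul_blockLengths C β).congr' <| by
    filter_upwards [eventually_fst_eq] with x hx
    rw [hx]

theorem tendsto_div_snd (C : ℝ) :
    Tendsto (fun x : ℕ × ℕ => C / (x.2 : ℝ)) (blockLengths β) (𝓝 0) :=
  (tendsto_div_mul_blockLengths C (1 - β)).congr' <| by
    filter_upwards [eventually_snd_eq] with x hx
    rw [hx]

theorem tendsto_two_rpow_neg {δ : ℝ} (hδ : 0 < δ) :
    Tendsto (fun x : ℕ × ℕ => (2 : ℝ) ^ (-(((x.1 + x.2 : ℕ) : ℝ) * δ))) (blockLengths β) (𝓝 0) :=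
  (tendsto_rpow_atBot_of_base_gt_one 2 one_lt_two).comp
    (tendsto_neg_atTop_atBot.comp (tendsto_blockLengths.atTop_mul_const hδ))

theorem le_numMsgs (l : ℕ) (R : ℝ) : (2 : ℝ) ^ ((l : ℝ) * R) ≤ numMsgs l R := Nat.le_ceil _

/-- The ceiling costs at most a factor `2`, because `2 ^ (l R) ≥ 1` for a nonnegative rate. -/
theorem numMsgs_le (l : ℕ) {R : ℝ} (hR : 0 ≤ R) :
    (numMsgs l R : ℝ) ≤ 2 * (2 : ℝ) ^ ((l : ℝ) * R) := by
  have h₁ : (1 : ℝ) ≤ (2 : ℝ) ^ ((l : ℝ) * R) := Real.one_le_rpow one_le_two (by positivity)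
  have h₂ := Nat.ceil_lt_add_one (zero_le_one.trans h₁)
  unfold numMsgs
  linarith

theorem mul_le_mul_two_rpow {N N' c c' l R R' : ℝ} (hN' : 0 ≤ N') (hc : 0 ≤ c)
    (h : N ≤ c * 2 ^ (l * R)) (h' : N' ≤ c' * 2 ^ (l * R')) :
    N * N' ≤ c * c' * 2 ^ (l * (R + R')) := by
  rw [mul_add, Real.rpow_add two_pos, mul_mul_mul_comm]
  exact mul_le_mul h h' hN' (by positivity)

/-! #### The terms of the random coding bound -/

/-- At `ε = 0` the exponent is the hypothesis `h`; by continuity a positive gap to `R` remains for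
small `ε`, and the term is at most `c` times `2` to minus block length times gap. -/
theorem eventually_tendsto_mul_wrongBound {Ω Ω' A A' B B' : Type*} [Fintype Ω] [Fintype Ω']
    [Fintype A] [Fintype A'] (q : Ω → ℝ) (e : A × B ≃ Ω) (r : A → ℝ) (q' : Ω' → ℝ)
    (e' : A' × B' ≃ Ω') (r' : A' → ℝ) {R c : ℝ} {N : ℕ → ℝ} (hN₀ : ∀ l, 0 ≤ N l)
    (hN : ∀ l, N l ≤ c * 2 ^ ((l : ℝ) * R))
    (h : R < β * divergence q e r + (1 - β) * divergence q' e' r') :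
    ∀ᶠ ε in 𝓝[>] 0, Tendsto (fun x : ℕ × ℕ => N (x.1 + x.2) *
      wrongBound q e r q' e' r' ε x.1 x.2) (blockLengths β) (𝓝 0) := by
  have hcont : Continuous fun ε : ℝ => (β : ℝ) * (divergence q e r - ε * absDivergence q e r) +
      (1 - β) * (divergence q' e' r' - ε * absDivergence q' e' r') := by fun_prop
  have hev := (hcont.tendsto 0).eventually (lt_mem_nhds (a := R) (by simpa using h))
  filter_upwards [hev.filter_mono nhdsWithin_le_nhds] with ε hε
  refine squeeze_zero' (Eventually.of_forall fun x =>
    mul_nonneg (hN₀ _) (wrongBound_nonneg _ _ _ _ _ _ _ _ _)) ?_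
    (by simpa using (tendsto_two_rpow_neg (β := β) (sub_pos.2 hε)).const_mul c)
  filter_upwards [eventually_fst_eq (β := β), eventually_snd_eq (β := β)] with x h₁ h₂
  refine (mul_le_mul_of_nonneg_right (hN _) (wrongBound_nonneg _ _ _ _ _ _ _ _ _)).trans_eq ?_
  rw [wrongBound, ← Real.rpow_add two_pos, mul_assoc, ← Real.rpow_add two_pos, h₁, h₂]
  congr 2
  ring

/-- The expected number of compatible words grows exponentially once `RU` exceeds `β * I`; `exp (-y)
≤ 1 / y` already turns this into exponential decay. -/
theorem eventually_tendsto_exp_neg_numMsgs {I C RU : ℝ} (h : β * I < RU) :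
    ∀ᶠ ε in 𝓝[>] 0, Tendsto (fun x : ℕ × ℕ => Real.exp (-(numMsgs (x.1 + x.2) RU *
      (2 : ℝ) ^ (-(x.1 * (I + ε * C)))))) (blockLengths β) (𝓝 0) := by
  have hcont : Continuous fun ε : ℝ => (β : ℝ) * (I + ε * C) := by fun_prop
  have hev := (hcont.tendsto 0).eventually (eventually_lt_nhds (b := RU) (by simpa using h))
  filter_upwards [hev.filter_mono nhdsWithin_le_nhds] with ε hε
  refine squeeze_zero' (Eventually.of_forall fun x => (Real.exp_pos _).le) ?_
    (tendsto_two_rpow_neg (β := β) (sub_pos.2 hε))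
  filter_upwards [eventually_fst_eq (β := β)] with x h₁
  set y : ℝ := numMsgs (x.1 + x.2) RU * (2 : ℝ) ^ (-(x.1 * (I + ε * C)))
  have hy : (2 : ℝ) ^ (((x.1 + x.2 : ℕ) : ℝ) * (RU - β * (I + ε * C))) ≤ y := by
    refine le_trans (le_of_eq ?_)
      (mul_le_mul_of_nonneg_right (le_numMsgs _ _) (Real.rpow_nonneg two_pos.le _))
    rw [← Real.rpow_add two_pos, h₁]
    congr 1
    ring
  rw [Real.exp_neg, Real.rpow_neg two_pos.le]
  refine inv_anti₀ (by positivity) (hy.trans ?_)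
  linarith [Real.add_one_le_exp y]

end Asymptotics

end

end HalfDuplexMARC

/-! ### The achievability theorem -/

open HalfDuplexMARC in
theorem theorem1 {X₁₁ X₂₁ X₁₂ X₂₂ XR YD1 YR YD2 YQ : Type*}
    [Fintype X₁₁] [Fintype X₂₁] [Fintype X₁₂] [Fintype X₂₂] [Fintype XR]
    [Fintype YD1] [Fintype YR] [Fintype YD2] [Fintype YQ]
    (ch : Channel X₁₁ X₂₁ X₁₂ X₂₂ XR YD1 YR YD2)
    (p : Inputs X₁₁ X₂₁ X₁₂ X₂₂ XR YR YQ)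
    (β : ℚ) (hβ₀ : 0 ≤ β) (hβ₁ : β ≤ 1)
    (R₁ R₂ RU : ℝ) (hR₁ : 0 ≤ R₁) (hR₂ : 0 ≤ R₂)
    (hRU : RU > β * mutualInfo (joint1 ch p)
      (fun s => s.yR) (fun s => s.yQ))
    (h1 : R₁ <
      β * condMutualInfo (joint1 ch p) (fun s => s.x11)
        (fun s => (s.yD1, s.yQ)) (fun s => s.x21) +
      (1 - β) * condMutualInfo (joint2 ch p) (fun s => s.x12)
        (fun s => s.yD2) (fun s => (s.x22, s.xR)))
    (h1U : R₁ + RU <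
      β * (mutualInfo (joint1 ch p) (fun s => (s.x11, s.yQ))
          (fun s => (s.x21, s.yD1)) +
        mutualInfo (joint1 ch p) (fun s => s.x11) (fun s => s.yQ)) +
      (1 - β) * condMutualInfo (joint2 ch p) (fun s => (s.x12, s.xR))
        (fun s => s.yD2) (fun s => s.x22))
    (h2 : R₂ <
      β * condMutualInfo (joint1 ch p) (fun s => s.x21)
        (fun s => (s.yD1, s.yQ)) (fun s => s.x11) +
      (1 - β) * condMutualInfo (joint2 ch p) (fun s => s.x22)
        (fun s => s.yD2) (fun s => (s.x12, s.xR)))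
    (h2U : R₂ + RU <
      β * (condMutualInfo (joint1 ch p) (fun s => (s.x21, s.yQ))
          (fun s => s.yD1) (fun s => s.x11) +
        mutualInfo (joint1 ch p) (fun s => s.x21) (fun s => s.yQ)) +
      (1 - β) * condMutualInfo (joint2 ch p) (fun s => (s.x22, s.xR))
        (fun s => s.yD2) (fun s => s.x12))
    (h12 : R₁ + R₂ <
      β * mutualInfo (joint1 ch p) (fun s => (s.x11, s.x21))
        (fun s => (s.yD1, s.yQ)) +
      (1 - β) * condMutualInfo (joint2 ch p) (fun s => (s.x12, s.x22))
        (fun s => s.yD2) (fun s => s.xR))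
    (h12U : R₁ + R₂ + RU <
      β * (mutualInfo (joint1 ch p) (fun s => (s.x11, s.x21, s.yQ))
          (fun s => s.yD1) +
        mutualInfo (joint1 ch p) (fun s => (s.x11, s.x21))
          (fun s => s.yQ)) +
      (1 - β) * mutualInfo (joint2 ch p) (fun s => (s.x12, s.x22, s.xR))
        (fun s => s.yD2)) :
    GQFAchievable ch p β RU R₁ R₂ := by
  have hβ : (0 : ℝ) ≤ β := by exact_mod_cast hβ₀
  -- The sign of `RU`, needed to bound the number of indices above, follows from nonnegativity of
  -- `I(Y_R; Ŷ_R)`.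
  have hRU₀ : 0 ≤ RU :=
    (mul_nonneg hβ (mutualInfo_nonneg (joint1_mem ch p) _ _)).trans hRU.le
  have hD₀ : divergence (relayPairLaw ch p) (Equiv.prodComm YQ YR) (quantLaw ch p) =
      mutualInfo (joint1 ch p) (fun s => s.yR) (fun s => s.yQ) := divergence_quantizer ch p
  have h2U' := h2U.trans_le
    (add_le_add_left (mul_le_mul_of_nonneg_left (le_divergence_slot1_secondFourth ch p) hβ) _)
  rw [gt_iff_lt, ← hD₀] at hRU
  rw [← divergence_slot1_first, ← divergence_slot2_first] at h1
  rw [← divergence_slot1_second, ← divergence_slot2_second] at h2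
  rw [← divergence_slot1_firstSecond, ← divergence_slot2_firstSecond] at h12
  rw [← divergence_slot1_firstFourth, ← divergence_slot2_firstThird] at h1U
  rw [← divergence_slot2_secondThird] at h2U'
  rw [← divergence_slot1_firstSecondFourth, ← divergence_slot2_firstSecondThird] at h12U
  have hN : ∀ (R : ℝ) l, (0 : ℝ) ≤ numMsgs l R := fun R l => Nat.cast_nonneg _
  have hN₁ := fun l => numMsgs_le l hR₁
  have hN₂ := fun l => numMsgs_le l hR₂
  have hNU := fun l => numMsgs_le l hRU₀
  have hN₁U := fun l => mul_le_mul_two_rpow (hN RU l) two_pos.le (hN₁ l) (hNU l)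
  have hN₂U := fun l => mul_le_mul_two_rpow (hN RU l) two_pos.le (hN₂ l) (hNU l)
  have hN₁₂ := fun l => mul_le_mul_two_rpow (hN R₂ l) two_pos.le (hN₁ l) (hN₂ l)
  have hN₁₂U := fun l =>
    mul_le_mul_two_rpow (hN RU l) (mul_nonneg two_pos.le two_pos.le) (hN₁₂ l) (hNU l)
  have hN₁₂₀ := fun l => mul_nonneg (hN R₁ l) (hN R₂ l)
  have hsmall := (eventually_tendsto_exp_neg_numMsgs (C := absDivergence (relayPairLaw ch p)
      (Equiv.prodComm YQ YR) (quantLaw ch p)) hRU).and <|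
    (eventually_tendsto_mul_wrongBound _ _ _ _ _ _ (hN R₁) hN₁ h1).and <|
    (eventually_tendsto_mul_wrongBound _ _ _ _ _ _
      (fun l => mul_nonneg (hN R₁ l) (hN RU l)) hN₁U h1U).and <|
    (eventually_tendsto_mul_wrongBound _ _ _ _ _ _ (hN R₂) hN₂ h2).and <|
    (eventually_tendsto_mul_wrongBound _ _ _ _ _ _
      (fun l => mul_nonneg (hN R₂ l) (hN RU l)) hN₂U h2U').and <|
    (eventually_tendsto_mul_wrongBound _ _ _ _ _ _ hN₁₂₀ hN₁₂ h12).and <|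
    eventually_tendsto_mul_wrongBound _ _ _ _ _ _
      (fun l => mul_nonneg (hN₁₂₀ l) (hN RU l)) hN₁₂U h12U
  obtain ⟨ε₀, hε₀, hsub⟩ := mem_nhdsGT_iff_exists_Ioo_subset.1 hsmall
  refine ⟨ε₀, hε₀, fun ε' ε hε' hε hεε₀ η hη => ?_⟩
  obtain ⟨C₀, C₁, C₂, -, -, -, H⟩ := exists_ensembleError_le ch p hε' hε
  -- The relay's term is governed by `ε'` and the wrong-word terms by `ε`; both lie in the interval
  -- where all limits hold.
  have t₀ := (hsub ⟨hε', hε.trans hεε₀⟩).1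
  obtain ⟨t₁, t₁U, t₂, t₂U, t₁₂, t₁₂U⟩ := (hsub ⟨hε'.trans hε, hεε₀⟩).2
  have hlim := (((((tendsto_div_fst (β := β) C₀).add t₀).add
    ((tendsto_div_fst C₁).add (tendsto_div_snd C₂))).add (t₁.add t₁U)).add (t₂.add t₂U)).add
    (t₁₂.add t₁₂U)
  simp only [add_zero] at hlim
  obtain ⟨L, hL⟩ := exists_forall_of_eventually_blockLengths (hlim.eventually (ge_mem_nhds hη))
  refine ⟨L, fun n m hl hn => ?_⟩
  have hle := H (Fin (numMsgs (n + m) R₁)) (Fin (numMsgs (n + m) R₂)) (Fin (numMsgs (n + m) RU)) n m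
  simp only [Fintype.card_fin] at hle
  have herr := hle.trans (hL n m hl hn)
  exact ⟨herr, exists_codebook_errorProb_le ch p herr⟩
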